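/- Setting. Let $\mathcal G=(\mathcal V,\mathcal E)$ be a finite undirected graph with $N$ nodes and graph distance $d_{\mathcal G}$ (infinite between different components), $\mathcal N^\kappa[i]=\{j: d_{\mathcal G}(i,j)\le\kappa\}$. States $x_t=(x_t[i])_{i\in\mathcal V}\in\mathbb R^{n}$ and controls $u_t=(u_t[i])_{i\in\mathcal V}\in\mathbb R^{m}$ are stacked over the nodes and satisfy $x_{t+1}=Ax_t+Bu_t+w_t$, where the blocks $A[i,j],B[i,j]$ vanish unless $i=j$ or $(i,j)\in\mathcal E$. The costs are $f_t(x)=\sum_i f_t[i](x[i])$, $c_t(u)=\sum_i c_t[i](u[i])$, and $F:\mathbb R^n\to\mathbb R$ is a terminal cost. For a matrix or vector $M$, $M^{(i,\kappa)}$ denotes $M$ with all block rows $j\notin\mathcal N^\kappa[i]$ replaced by $0$. Norms are Euclidean norms and the induced operator norms. Optimal control problems. For matrices $A',B'$, a horizon $\ell$, a time $t$, an initial state $x$, disturbances $\zeta_{0:\ell-1}$ and a terminal cost $g$, consider minimizing $\sum_{\tau=0}^{\ell-1}f_{t+\tau}(y_\tau)+\sum_{\tau=1}^{\ell}c_{t+\tau}(v_{\tau-1})+g(y_\ell)$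 over $(y_{0:\ell},v_{0:\ell-1})$ subject to $y_0=x$ and $y_{\tau+1}=A'y_\tau+B'v_\tau+\zeta_\tau$ for $0\le\tau<\ell$. The offline optimal trajectory $x^*_{0:T}$ is the state part of the solution with $A'=A$, $B'=B$, $t=0$, $\ell=T$, $x=\bar x$, $\zeta=w$, $g=f_T$. The trajectory $x_{0:T}$ of $DTPC_k$ with truncation radius $\kappa$ starts at $x_0=\bar x$; at each time $0\le t<T$ every node $i$ solves the problem with $A'=A^{(i,\kappa)}$, $B'=B^{(i,\kappa)}$, $x=x_t^{(i,\kappa)}$, $\zeta_\tau=w_{t+\tau}^{(i,\kappa)}$, with $\ell=k$, $g=F$ if $t<T-k$ and $\ell=T-t$, $g=f_T$ otherwise, and puts $u_t[i]=v_0[i]$; then $x_{t+1}=Ax_t+Bu_t+w_t$. Assumptions, for constants $L>1$, $\gamma\in(0,1)$, $\mu>0$, $\sigma>0$, an integer $1\le d\le n$ and a function $p$ with $\lim_{r\to\infty}\frac{\log p(r)}{r}=0$: (1) $\|A\|,\|B\|,\|B^\dagger\|\le L$ ($B^\dagger$ the Moore–Penrose inverse); $\sigma_{\min}([B\;AB\;\cdots\;A^{d-1}B])\ge\sigma$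 (smallest singular value, positive exactly when the matrix has full row rank); there is an integer $0\le\kappa_0<\mathrm{diam}(\mathcal G)$ such that for all $i\in\mathcal V$ and all $\kappa\ge\kappa_0$ there is a matrix $K$ with $\|K\|\le L$ and $\|(A^{(i,\kappa)}-B^{(i,\kappa)}K)^t\|\le L\gamma^t$ for all $t\ge0$. (2) $f_0,\dots,f_T$, $c_1,\dots,c_T$ and $F$ are $\mu$-strongly convex, $L$-smooth and twice continuously differentiable; every $f_t$ and $c_t$ is non-negative and vanishes at $0$; $F(x)=\beta(\|x\|)$ with $\beta$ strictly increasing and $\beta(0)=0$. (3) For every node $i$ and every integer $r\ge0$, $|\{j: d_{\mathcal G}(i,j)=r\}|\le p(r)$. (4) $1\le k\le T$, $\kappa\ge\kappa_0$, and $\sum_{\tau=0}^{k-1}\|w_{s+\tau}\|\le D_k$ for all $0\le s\le T-k$. Theorem. There are $\delta\in(0,1)$, depending only on $L,\gamma,\mu,\sigma,d$, and $C>0$, depending only on these and on $p$, such that, with $L_N:=CLN$, in every setting satisfying (1)–(4) the following hold. If $0\le t$ and $t+1\le T-k$, then $$\|x_{t+1}-x^*_{t+1}\|\le C\delta^k\Big(2C\delta^T\|x_0\|+\frac{4C}{1-\delta}D_k\Big)+\sum_{m=0}^{t}\frac{4C^2L_N}{\delta(1-\delta)^2}\,\delta^m\Big((\delta^\kappa+\delta^{2k})\|x_{t-m}\|+(\delta^\kappa+\delta^k)D_k\Big),$$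 and if $T-k+1\le t+1\le T$, then $$\|x_{t+1}-x^*_{t+1}\|\le \sum_{m=0}^{t}CL_N\big(\|x_{t-m}\|+D_k\big)\delta^{\kappa+m}+\sum_{m=1}^{T-k}\frac{4C^3}{\delta(1-\delta)^2}\,\delta^{t+k-T+m}\Big(\delta^{2k}\|x_{T-k-m}\|+\delta^kD_k\Big).$$ -/

import Mathlib

open Filter Topology
open scoped Matrix.Norms.L2Operator

noncomputable section

namespace DTPC

section Network

variable {V : Type*}

/-- Index set of a vector stacked over the nodes, node `i` owning a block of size `n i`. -/
abbrev Idx (n : V → ℕ) : Type _ := Σ i : V, Fin (n i)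

/-- Stacked vectors `(x[i])_{i ∈ V}` with `x[i] ∈ ℝ^{n i}`, carrying the Euclidean norm. -/
abbrev Stacked (n : V → ℕ) : Type _ := EuclideanSpace ℝ (Idx n)

/-- Matrices `(M[i,j])_{i,j ∈ V}` with blocks `M[i,j] ∈ ℝ^{n i × m j}`.
The norm in force on matrices is the operator norm for the Euclidean norms. -/
abbrev BlockMatrix (n m : V → ℕ) : Type _ := Matrix (Idx n) (Idx m) ℝ

/-- The block `x[i]` of a stacked vector. -/
def block {n : V → ℕ} (x : Stacked n) (i : V) : EuclideanSpace ℝ (Fin (n i)) :=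
  WithLp.toLp 2 fun a => x ⟨i, a⟩

/-- `M[i,j] = 0` unless `j` is `i` itself or a neighbour of `i`. -/
def IsNetworked (G : SimpleGraph V) {n m : V → ℕ} (M : BlockMatrix n m) : Prop :=
  ∀ i j : V, i ≠ j → ¬ G.Adj i j → ∀ (a : Fin (n i)) (b : Fin (m j)), M ⟨i, a⟩ ⟨j, b⟩ = 0

/-- The `κ`-hop neighbourhood of node `i`. -/
def hood (G : SimpleGraph V) (κ : ℕ) (i : V) : Set V :=
  {j | G.edist i j ≤ (κ : ℕ∞)}

open Classical in
/-- `(i, κ)`-truncation of a matrix: block rows outside the `κ`-hop neighbourhood are zeroed. -/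
def truncMatrix (G : SimpleGraph V) (κ : ℕ) (i : V) {n m : V → ℕ} (M : BlockMatrix n m) :
    BlockMatrix n m :=
  fun p q => if p.1 ∈ hood G κ i then M p q else 0

open Classical in
/-- `(i, κ)`-truncation of a vector. -/
def truncVec (G : SimpleGraph V) (κ : ℕ) (i : V) {n : V → ℕ} (x : Stacked n) : Stacked n :=
  WithLp.toLp 2 fun p => if p.1 ∈ hood G κ i then x p else 0

/-- Centralized cost `g(x) = ∑_i g[i](x[i])` of decentralized costs `g[i]`. -/
def aggregate [Fintype V] {n : V → ℕ} (g : (i : V) → EuclideanSpace ℝ (Fin (n i)) → ℝ)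
    (x : Stacked n) : ℝ :=
  ∑ i, g i (block x i)

end Network

section LinearSystems

variable {X U : Type*} [Fintype X] [DecidableEq X] [Fintype U] [DecidableEq U]

/-- The action of a matrix on Euclidean vectors. -/
def act (M : Matrix X U ℝ) (v : EuclideanSpace ℝ U) : EuclideanSpace ℝ X :=
  WithLp.toLp 2 (M.mulVec (WithLp.ofLp v))

/-- `P` is the Moore-Penrose pseudo-inverse of `M` (the four Penrose equations). -/
structure IsMoorePenrose (M : Matrix X U ℝ) (P : Matrix U X ℝ) : Prop where
  mul_mul_left : M * P * M = M
  mul_mul_right : P * M * P = P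
  symm_left : (M * P).transpose = M * P
  symm_right : (P * M).transpose = P * M

/-- `(A, B)` is `(L, γ)`-stabilizable. -/
def IsStabilizable (L γ : ℝ) (A : Matrix X X ℝ) (B : Matrix X U ℝ) : Prop :=
  ∃ K : Matrix U X ℝ, ‖K‖ ≤ L ∧ ∀ t : ℕ, ‖(A - B * K) ^ t‖ ≤ L * γ ^ t

/-- The reduced controllability matrix `[B, AB, …, A^{d-1}B]`. -/
def ctrbMatrix (A : Matrix X X ℝ) (B : Matrix X U ℝ) (d : ℕ) : Matrix X (Fin d × U) ℝ :=
  fun r q => (A ^ (q.1 : ℕ) * B) r q.2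

/-- The smallest singular value of a matrix with at least one row, counted for row rank: it is
the `r`-th largest singular value, `r` the number of rows, so it is positive exactly when the matrix
has full row rank. -/
def sigmaMin (M : Matrix X U ℝ) : ℝ :=
  (Matrix.toEuclideanLin M).singularValues (Fintype.card X - 1)

/-- `(y_{0:ℓ}, v_{0:ℓ-1})` satisfies `y_{τ+1} = A y_τ + B v_τ + ζ_τ` for `τ < ℓ` and `y_0 = x`. -/
def IsFeasible (A : Matrix X X ℝ) (B : Matrix X U ℝ) (ℓ : ℕ) (x : EuclideanSpace ℝ X)
    (ζ : ℕ → EuclideanSpace ℝ X) (y : ℕ → EuclideanSpace ℝ X) (v : ℕ → EuclideanSpace ℝ U) :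
    Prop :=
  y 0 = x ∧ ∀ τ < ℓ, y (τ + 1) = act A (y τ) + act B (v τ) + ζ τ

/-- The cost over the window of length `ℓ` starting at time `t`, with terminal cost `F`. -/
def horizonCost (f : ℕ → EuclideanSpace ℝ X → ℝ) (c : ℕ → EuclideanSpace ℝ U → ℝ)
    (F : EuclideanSpace ℝ X → ℝ) (t ℓ : ℕ)
    (y : ℕ → EuclideanSpace ℝ X) (v : ℕ → EuclideanSpace ℝ U) : ℝ :=
  ∑ τ ∈ Finset.range ℓ, f (t + τ) (y τ) + ∑ τ ∈ Finset.Icc 1 ℓ, c (t + τ) (v (τ - 1)) + F (y ℓ)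

/-- `(y, v)` solves the optimal control problem of horizon `ℓ` posed at time `t`, with initial
state `x`, disturbances `ζ_{0:ℓ-1}` and terminal cost `F`.
Only `y_{0:ℓ}` and `v_{0:ℓ-1}` matter. -/
def IsOptimal (A : Matrix X X ℝ) (B : Matrix X U ℝ) (f : ℕ → EuclideanSpace ℝ X → ℝ)
    (c : ℕ → EuclideanSpace ℝ U → ℝ) (F : EuclideanSpace ℝ X → ℝ) (t ℓ : ℕ)
    (x : EuclideanSpace ℝ X) (ζ : ℕ → EuclideanSpace ℝ X)
    (y : ℕ → EuclideanSpace ℝ X) (v : ℕ → EuclideanSpace ℝ U) : Prop :=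
  IsFeasible A B ℓ x ζ y v ∧
    ∀ y' v', IsFeasible A B ℓ x ζ y' v' → horizonCost f c F t ℓ y v ≤ horizonCost f c F t ℓ y' v'

/-- `g` is `μ`-strongly convex, `L`-smooth and twice continuously differentiable. -/
structure WellConditioned (μ L : ℝ) (g : EuclideanSpace ℝ X → ℝ) : Prop where
  strongConvex : StrongConvexOn Set.univ μ g
  smooth : ∀ x y, ‖gradient g x - gradient g y‖ ≤ L * ‖x - y‖
  contDiff : ContDiff ℝ 2 g

/-- `F(x) = β(‖x‖)` with `β` strictly increasing on `[0, ∞)` and `β(0) = 0`. -/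
def IsKFunction (F : EuclideanSpace ℝ X → ℝ) : Prop :=
  ∃ β : ℝ → ℝ, StrictMonoOn β (Set.Ici 0) ∧ β 0 = 0 ∧ ∀ x, F x = β ‖x‖

end LinearSystems

section Assumptions

variable {V : Type*} [Fintype V] [DecidableEq V] {n m : V → ℕ}

/-- Standing assumptions on the networked system. -/
structure SystemAssumption (L γ σ : ℝ) (d κ₀ : ℕ) (G : SimpleGraph V)
    (A : BlockMatrix n n) (B : BlockMatrix n m) : Prop where
  networked_A : IsNetworked G A
  networked_B : IsNetworked G B
  norm_A : ‖A‖ ≤ L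
  norm_B : ‖B‖ ≤ L
  norm_pinv : ∃ P : BlockMatrix m n, IsMoorePenrose B P ∧ ‖P‖ ≤ L
  one_le_index : 1 ≤ d
  index_le : d ≤ Fintype.card (Idx n)
  sigmaMin_ctrb : σ ≤ sigmaMin (ctrbMatrix A B d)
  lt_diam : (κ₀ : ℕ∞) < G.ediam
  stabilizable : ∀ i : V, ∀ κ : ℕ, κ₀ ≤ κ →
    IsStabilizable L γ (truncMatrix G κ i A) (truncMatrix G κ i B)

/-- Standing assumptions on the costs over the times `0, …, T` and on the terminal cost `F`. -/
structure CostAssumption (μ L : ℝ) (T : ℕ)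
    (f : ℕ → (i : V) → EuclideanSpace ℝ (Fin (n i)) → ℝ)
    (c : ℕ → (i : V) → EuclideanSpace ℝ (Fin (m i)) → ℝ)
    (F : Stacked n → ℝ) : Prop where
  state : ∀ t ≤ T, WellConditioned μ L (aggregate (f t))
  control : ∀ t, 1 ≤ t → t ≤ T → WellConditioned μ L (aggregate (c t))
  terminal : WellConditioned μ L F
  terminal_K : IsKFunction F
  state_nonneg : ∀ t ≤ T, ∀ x, 0 ≤ aggregate (f t) x
  state_zero : ∀ t ≤ T, aggregate (f t) 0 = 0
  control_nonneg : ∀ t, 1 ≤ t → t ≤ T → ∀ u, 0 ≤ aggregate (c t) u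
  control_zero : ∀ t, 1 ≤ t → t ≤ T → aggregate (c t) 0 = 0

/-- `p` is subexponential: `log p(d) / d → 0`. -/
def IsSubexponential (p : ℕ → ℝ) : Prop :=
  Tendsto (fun d : ℕ => Real.log (p d) / d) atTop (𝓝 0)

/-- For every node and every distance `d`, at most `p d` nodes lie at distance exactly `d`. -/
def HasGrowth (G : SimpleGraph V) (p : ℕ → ℝ) : Prop :=
  ∀ (i : V) (d : ℕ), (Set.ncard {j : V | G.edist i j = (d : ℕ∞)} : ℝ) ≤ p d

/-- `x_{0:T}` is the state trajectory generated from `x̄` by distributed truncated predictive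
control with prediction horizon `k` and truncation radius `κ`: at each time `t < T` node `i` applies
the first control `v_0[i]` of a solution of the `(i, κ)`-truncated problem, which has horizon `k` and
terminal cost `F` when `t < T - k`, and horizon `T - t` and terminal cost `f_T` otherwise. -/
def IsDTPCTrajectory (G : SimpleGraph V) (A : BlockMatrix n n) (B : BlockMatrix n m)
    (f : ℕ → (i : V) → EuclideanSpace ℝ (Fin (n i)) → ℝ)
    (c : ℕ → (i : V) → EuclideanSpace ℝ (Fin (m i)) → ℝ)
    (F : Stacked n → ℝ) (w : ℕ → Stacked n) (T k κ : ℕ) (xbar : Stacked n)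
    (x : ℕ → Stacked n) : Prop :=
  x 0 = xbar ∧ ∃ u : ℕ → Stacked m, ∀ t < T,
    x (t + 1) = act A (x t) + act B (u t) + w t ∧
    ∀ i : V, ∃ (y : ℕ → Stacked n) (v : ℕ → Stacked m),
      IsOptimal (truncMatrix G κ i A) (truncMatrix G κ i B)
        (fun s => aggregate (f s)) (fun s => aggregate (c s))
        (if t + k < T then F else aggregate (f T))
        t (if t + k < T then k else T - t)
        (truncVec G κ i (x t)) (fun τ => truncVec G κ i (w (t + τ))) y v ∧
      block (u t) i = block (v 0) i

/-- `x_{0:T}` is the state trajectory of an optimal solution of the full-horizon problem. -/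
def IsOfflineOptimal (A : BlockMatrix n n) (B : BlockMatrix n m)
    (f : ℕ → (i : V) → EuclideanSpace ℝ (Fin (n i)) → ℝ)
    (c : ℕ → (i : V) → EuclideanSpace ℝ (Fin (m i)) → ℝ)
    (w : ℕ → Stacked n) (T : ℕ) (xbar : Stacked n) (x : ℕ → Stacked n) : Prop :=
  ∃ u : ℕ → Stacked m, IsOptimal A B (fun s => aggregate (f s)) (fun s => aggregate (c s))
    (aggregate (f T)) 0 T xbar w x u

end Assumptions

end DTPC

end

/-! Everything rests on one a priori estimate for the optimality system (dynamics, adjoint equation,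
stationarity) of a stabilizable pair. In the adjoint recursion, stationarity allows the feedback `K`
to be inserted, so the multipliers obey a backward recursion driven by the power-stable operator `(A
- BK)*` and are controlled in `ℓ²` by the states and controls (`ApproxKKT.dual_le`). Pairing states
with multipliers telescopes, and strong monotonicity of the gradients controls states and controls
by the data plus a small multiple of the multipliers (`ApproxKKT.energy_le`). Together these give a
bound independent of horizon and dimension, which survives relative errors of some size `η` in the
equations (`exists_stageEstimate`).

Because of this slack, increments multiplied by exponential weights satisfy the same system: a
weight `δ ^ ψ` with `ψ` changing by at most one per time step, or per graph edge, commutes with the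
system up to a relative error of order `(1 - δ) / δ`. Weights in time give exponential forgetting of
the initial state and exponentially small influence of the terminal condition
(`IsKKT.initial_decay`, `IsKKT.terminal_sensitivity`). Weights in space show that discarding rows
beyond distance `κ` changes the control at the centre by `O(δ ^ κ)` (`truncation_sensitivity`).

Spatial weights require gradients acting block by block. This holds for the stage costs but not for
the radial terminal cost `F`. However, `∇F(x) = θ x` with `θ ∈ [μ, L]`, so each node's truncated
solution also solves the problem with terminal gradient `θ_i x`, for its own `θ_i`. The untruncated
solutions form a curve in `θ` whose first control has Lipschitz constant of order `δ ^ k`, and a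
vector whose blocks sample this curve at different parameters stays close to it without a factor `N`
(`norm_sampled_sub_le`).

Finally, let `Y_s` be the optimal continuation from `x_s`. The one-step error `x_{s+1} - Y_s(1)` is
at most `L` times the control error: a truncation part `N δ ^ κ (‖x_s‖ + D)` and, if `s + k < T`, a
horizon part `δ ^ k (δ ^ k ‖x_s‖ + D)`, up to constants. The horizon part carries two decays, from
now to time `k` and back. Telescoping over `s` with the forgetting of initial states sums these
errors with weights `δ ^ (t - s)` (`norm_sub_le_sum_step_errors`). -/

noncomputable section

namespace DTPC

/-! ### A priori estimate for approximate optimality systems -/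

section StageEstimate

variable {X U : Type*} [NormedAddCommGroup X] [InnerProductSpace ℝ X] [CompleteSpace X]
  [NormedAddCommGroup U] [InnerProductSpace ℝ U] [CompleteSpace U]

omit [CompleteSpace X] in
/-- A backward recursion driven by a power-stable operator is bounded in `ℓ²`. -/
theorem sum_sq_le_of_powerStable {M : X →L[ℝ] X} {L γ : ℝ} (hγ₀ : 0 < γ) (hγ₁ : γ < 1)
    (hM : ∀ t : ℕ, ‖M ^ t‖ ≤ L * γ ^ t) (l : ℕ) (p z : ℕ → X)
    (hp : ∀ τ < l, p τ = M (p (τ + 1)) + z τ) (hl : p l = z l) :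
    ∑ τ ∈ Finset.range (l + 1), ‖p τ‖ ^ 2 ≤
      (L / (1 - γ)) ^ 2 * ∑ τ ∈ Finset.range (l + 1), ‖z τ‖ ^ 2 := by
  have h1γ : 0 < 1 - γ := by linarith
  have hL : 0 ≤ L := by have := (norm_nonneg _).trans (hM 0); simpa using this
  have hMz : ∀ (t : ℕ) (x : X), ‖(M ^ t) x‖ ≤ γ ^ t * (L * ‖x‖) := fun t x =>
    ((M ^ t).le_opNorm x).trans
      ((mul_le_mul_of_nonneg_right (hM t) (norm_nonneg x)).trans_eq (by ring))
  -- `M` itself need not be a contraction, so the induction carries a substitute for an adapted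
  -- norm: `N` dominates `γ ^ (-t) ‖M ^ t p₀‖` for all `t`, and it evolves by `N ↦ γ N + L ‖z 0‖`.
  -- The extra term in `N ^ 2` pays for the next backward step.
  suffices H : ∃ N : ℝ, 0 ≤ N ∧ (∀ t : ℕ, ‖(M ^ t) (p 0)‖ ≤ γ ^ t * N) ∧
      ∑ τ ∈ Finset.range (l + 1), ‖p τ‖ ^ 2 + γ / (1 - γ) * N ^ 2 ≤
        (L / (1 - γ)) ^ 2 * ∑ τ ∈ Finset.range (l + 1), ‖z τ‖ ^ 2 by
    obtain ⟨N, -, -, h⟩ := H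
    have : 0 ≤ γ / (1 - γ) * N ^ 2 := by positivity
    linarith
  have key : ∀ a b : ℝ, (γ * a + L * b) ^ 2 ≤ γ * a ^ 2 + (1 - γ) * (L / (1 - γ) * b) ^ 2 := by
    intro a b
    have h1 : L * b = (1 - γ) * (L / (1 - γ) * b) := by field_simp
    rw [h1]
    set c := L / (1 - γ) * b
    nlinarith [mul_nonneg (mul_nonneg hγ₀.le h1γ.le) (sq_nonneg (a - c))]
  have step : ∀ (N b P : ℝ), 0 ≤ P → P ≤ γ * N + L * b →
      P ^ 2 + γ / (1 - γ) * (γ * N + L * b) ^ 2 ≤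
        γ / (1 - γ) * N ^ 2 + (L / (1 - γ)) ^ 2 * b ^ 2 := by
    intro N b P hP h
    have h2 : P ^ 2 ≤ (γ * N + L * b) ^ 2 := by gcongr
    have h3 := key N b
    have h4 : P ^ 2 + γ / (1 - γ) * (γ * N + L * b) ^ 2 ≤
        (γ * N + L * b) ^ 2 / (1 - γ) := by
      have : (γ * N + L * b) ^ 2 / (1 - γ) =
        (γ * N + L * b) ^ 2 + γ / (1 - γ) * (γ * N + L * b) ^ 2 := by field_simp; ring
      rw [this]; linarith
    refine h4.trans ?_
    rw [div_le_iff₀ h1γ]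
    refine h3.trans (le_of_eq ?_)
    field_simp
  induction l generalizing p z with
  | zero =>
    refine ⟨L * ‖z 0‖, by positivity, fun t => hl ▸ hMz t _, ?_⟩
    have hp0 : ‖p 0‖ ≤ γ * 0 + L * ‖z 0‖ := by
      have := hMz 0 (z 0); simpa [hl] using this
    have := step 0 ‖z 0‖ ‖p 0‖ (norm_nonneg _) hp0
    simpa using this
  | succ l ih =>
    obtain ⟨N, hN, hpow, hsum⟩ := ih (fun τ => p (τ + 1)) (fun τ => z (τ + 1))
      (fun τ hτ => hp (τ + 1) (by omega)) hl
    have hpow' : ∀ t : ℕ, ‖(M ^ t) (p 0)‖ ≤ γ ^ t * (γ * N + L * ‖z 0‖) := by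
      intro t
      rw [hp 0 (by omega), map_add]
      have h1 := hpow (t + 1)
      rw [pow_succ M t] at h1
      have h2 := hMz t (z 0)
      refine (norm_add_le _ _).trans ((add_le_add h1 h2).trans_eq (by ring))
    refine ⟨γ * N + L * ‖z 0‖, by positivity, hpow', ?_⟩
    have h0 := hpow' 0
    simp only [pow_zero, one_apply_eq_self, one_mul] at h0
    have := step N ‖z 0‖ ‖p 0‖ (norm_nonneg _) h0
    rw [Finset.sum_range_succ', Finset.sum_range_succ' (fun τ => ‖z τ‖ ^ 2)]
    linarith

/-- Bounded, stabilizable pairs of operators. -/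
structure StablePair (L γ : ℝ) (A : X →L[ℝ] X) (B : U →L[ℝ] X) : Prop where
  norm_left : ‖A‖ ≤ L
  norm_right : ‖B‖ ≤ L
  gain : ∃ K : X →L[ℝ] U, ‖K‖ ≤ L ∧ ∀ t : ℕ, ‖(A - B ∘L K) ^ t‖ ≤ L * γ ^ t

open ContinuousLinearMap in
/-- The increments `(e, ν, p)` of states, controls and multipliers satisfy the optimality system,
with monotone increments `(g, h)` of the cost gradients, up to the residuals `R, S, Q` and up to
relative errors of size `η`. -/
structure ApproxKKT (μ L η : ℝ) (A : X →L[ℝ] X) (B : U →L[ℝ] X) (l : ℕ)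
    (e : ℕ → X) (ν : ℕ → U) (p g : ℕ → X) (h : ℕ → U) (R S Q : ℕ → ℝ) : Prop where
  dyn : ∀ τ < l, ‖e (τ + 1) - A (e τ) - B (ν τ)‖ ≤ η * (‖e τ‖ + ‖ν τ‖) + R τ
  adj : ∀ τ < l, ‖p τ - adjoint A (p (τ + 1)) - g τ‖ ≤ η * ‖p (τ + 1)‖ + S τ
  final : ‖p l - g l‖ ≤ S l
  stat : ∀ τ < l, ‖h τ + adjoint B (p (τ + 1))‖ ≤ η * ‖p (τ + 1)‖ + Q τ
  mono_state : ∀ τ ≤ l, μ * ‖e τ‖ ^ 2 ≤ inner ℝ (g τ) (e τ)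
  lip_state : ∀ τ ≤ l, ‖g τ‖ ≤ L * ‖e τ‖
  mono_control : ∀ τ < l, μ * ‖ν τ‖ ^ 2 ≤ inner ℝ (h τ) (ν τ)
  lip_control : ∀ τ < l, ‖h τ‖ ≤ L * ‖ν τ‖

/-- Squared size of the primal increments. -/
def primalSq (l : ℕ) (e : ℕ → X) (ν : ℕ → U) : ℝ :=
  ∑ τ ∈ Finset.range (l + 1), ‖e τ‖ ^ 2 + ∑ τ ∈ Finset.range l, ‖ν τ‖ ^ 2

/-- Squared size of the data of an approximate optimality system. -/
def residualSq (l : ℕ) (e : ℕ → X) (R S Q : ℕ → ℝ) : ℝ :=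
  ‖e 0‖ ^ 2 + ∑ τ ∈ Finset.range l, (R τ ^ 2 + Q τ ^ 2) + ∑ τ ∈ Finset.range (l + 1), S τ ^ 2

open ContinuousLinearMap in
-- Stationarity says `B* p ≈ -h`, so adding and subtracting `K* B* p` turns the adjoint recursion
-- into one driven by `(A - BK)*`, with a forcing made of `g`, `K* h` and residuals.
-- `sum_sq_le_of_powerStable` then applies. The coefficient in front of the primal size is not
-- small; smallness has to come from the energy inequality.
theorem ApproxKKT.dual_le {μ L γ η : ℝ} (hL : 1 < L) (hγ₀ : 0 < γ) (hγ₁ : γ < 1)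
    {A : X →L[ℝ] X} {B : U →L[ℝ] X} (hAB : StablePair L γ A B) {l : ℕ} {e : ℕ → X} {ν : ℕ → U}
    {p g : ℕ → X} {h : ℕ → U} {R S Q : ℕ → ℝ} (H : ApproxKKT μ L η A B l e ν p g h R S Q) :
    ∑ τ ∈ Finset.range (l + 1), ‖p τ‖ ^ 2 ≤ (L / (1 - γ)) ^ 2 * (5 * (1 + L) ^ 4) *
      (η ^ 2 * ∑ τ ∈ Finset.range (l + 1), ‖p τ‖ ^ 2 + primalSq l e ν + residualSq l e R S Q) := by
  obtain ⟨K, hK, hpow⟩ := hAB.gain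
  set M : X →L[ℝ] X := adjoint (A - B ∘L K) with hMdef
  have hM : ∀ t : ℕ, ‖M ^ t‖ ≤ L * γ ^ t := by
    intro t
    have : M ^ t = adjoint ((A - B ∘L K) ^ t) := by
      simp only [hMdef, ← star_eq_adjoint, star_pow]
    rw [this, LinearIsometryEquiv.norm_map]
    exact hpow t
  have hMx : ∀ x, M x = adjoint A x - adjoint K (adjoint B x) := by
    intro x; simp [hMdef, adjoint_comp]
  have hK' : ∀ x, ‖adjoint K x‖ ≤ L * ‖x‖ := fun x =>
    ((adjoint K).le_opNorm x).trans (by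
      rw [LinearIsometryEquiv.norm_map]; exact mul_le_mul_of_nonneg_right hK (norm_nonneg _))
  set z : ℕ → X := fun τ => if τ < l then p τ - M (p (τ + 1)) else p τ with hz
  have hz1 : ∀ τ < l, p τ = M (p (τ + 1)) + z τ := by intro τ hτ; simp [hz, hτ]
  have hz2 : p l = z l := by simp [hz]
  have h1 := sum_sq_le_of_powerStable hγ₀ hγ₁ hM l p z hz1 hz2
  refine h1.trans ?_
  rw [mul_assoc]
  refine mul_le_mul_of_nonneg_left ?_ (sq_nonneg _)
  set c := 5 * (1 + L) ^ 4 with hc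
  have hLpos : 0 < L := by linarith
  have hc1 : (1 + L) ^ 2 ≤ (1 + L) ^ 4 := pow_le_pow_right₀ (by linarith) (by norm_num)
  have hc2 : (1 : ℝ) ≤ (1 + L) ^ 4 := one_le_pow₀ (by linarith)
  have hc3 : L ^ 2 ≤ (1 + L) ^ 4 := (pow_le_pow_left₀ hLpos.le (by linarith) 2).trans hc1
  have hc4 : L ^ 4 ≤ (1 + L) ^ 4 := pow_le_pow_left₀ hLpos.le (by linarith) 4
  have hzτ : ∀ τ < l, ‖z τ‖ ^ 2 ≤
      c * (η ^ 2 * ‖p (τ + 1)‖ ^ 2 + S τ ^ 2 + Q τ ^ 2 + ‖e τ‖ ^ 2 + ‖ν τ‖ ^ 2) := by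
    intro τ hτ
    have hb : ‖z τ‖ ≤ (1 + L) * (η * ‖p (τ + 1)‖) + S τ + L * Q τ + L * ‖e τ‖ + L ^ 2 * ‖ν τ‖ := by
      have hzz : z τ = (p τ - adjoint A (p (τ + 1)) - g τ) + g τ
          + adjoint K (h τ + adjoint B (p (τ + 1))) - adjoint K (h τ) := by
        simp only [hz, hτ, if_true, hMx, map_add]; abel
      rw [hzz]
      have a1 := H.adj τ hτ
      have a2 := H.lip_state τ hτ.le
      have a3 := (hK' (h τ + adjoint B (p (τ + 1)))).trans
        (mul_le_mul_of_nonneg_left (H.stat τ hτ) hLpos.le)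
      have a4 := (hK' (h τ)).trans
        (mul_le_mul_of_nonneg_left (H.lip_control τ hτ) hLpos.le)
      have a5 := norm_sub_le ((p τ - adjoint A (p (τ + 1)) - g τ) + g τ
          + adjoint K (h τ + adjoint B (p (τ + 1)))) (adjoint K (h τ))
      have a6 := norm_add_le ((p τ - adjoint A (p (τ + 1)) - g τ) + g τ)
          (adjoint K (h τ + adjoint B (p (τ + 1))))
      have a7 := norm_add_le (p τ - adjoint A (p (τ + 1)) - g τ) (g τ)
      linarith
    have hsq : ‖z τ‖ ^ 2 ≤
        ((1 + L) * (η * ‖p (τ + 1)‖) + S τ + L * Q τ + L * ‖e τ‖ + L ^ 2 * ‖ν τ‖) ^ 2 := by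
      gcongr
    have h5 : ∀ a b c d f : ℝ, (a + b + c + d + f) ^ 2 ≤
        5 * (a ^ 2 + b ^ 2 + c ^ 2 + d ^ 2 + f ^ 2) := by
      intro a b c d f
      nlinarith [sq_nonneg (a - b), sq_nonneg (a - c), sq_nonneg (a - d), sq_nonneg (a - f),
        sq_nonneg (b - c), sq_nonneg (b - d), sq_nonneg (b - f), sq_nonneg (c - d),
        sq_nonneg (c - f), sq_nonneg (d - f)]
    refine hsq.trans ((h5 _ _ _ _ _).trans ?_)
    rw [hc, mul_assoc]
    refine mul_le_mul_of_nonneg_left ?_ (by norm_num)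
    have b1 := mul_le_mul_of_nonneg_right hc1 (sq_nonneg (η * ‖p (τ + 1)‖))
    have b2 := mul_le_mul_of_nonneg_right hc2 (sq_nonneg (S τ))
    have b3 := mul_le_mul_of_nonneg_right hc3 (sq_nonneg (Q τ))
    have b4 := mul_le_mul_of_nonneg_right hc3 (sq_nonneg ‖e τ‖)
    have b5 := mul_le_mul_of_nonneg_right hc4 (sq_nonneg ‖ν τ‖)
    generalize (1 + L) ^ 4 = k at *
    linarith
  have hzl : ‖z l‖ ^ 2 ≤ c * (S l ^ 2 + ‖e l‖ ^ 2) := by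
    rw [← hz2]
    have hb : ‖p l‖ ≤ S l + L * ‖e l‖ := by
      have a1 := H.final
      have a2 := H.lip_state l le_rfl
      have a3 := norm_add_le (p l - g l) (g l)
      rw [sub_add_cancel] at a3
      linarith
    have hsq : ‖p l‖ ^ 2 ≤ (S l + L * ‖e l‖) ^ 2 := by gcongr
    have b2 := mul_le_mul_of_nonneg_right hc2 (sq_nonneg (S l))
    have b4 := mul_le_mul_of_nonneg_right hc3 (sq_nonneg ‖e l‖)
    rw [hc]
    generalize (1 + L) ^ 4 = k at *
    nlinarith [sq_nonneg (S l - L * ‖e l‖), sq_nonneg (S l), sq_nonneg (L * ‖e l‖)]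
  have hsum := Finset.sum_le_sum (fun τ (hτ : τ ∈ Finset.range l) => hzτ τ (Finset.mem_range.1 hτ))
  rw [Finset.sum_range_succ]
  refine (add_le_add hsum hzl).trans ?_
  rw [← Finset.mul_sum, ← mul_add]
  refine mul_le_mul_of_nonneg_left ?_ (by positivity)
  simp only [Finset.sum_add_distrib, ← Finset.mul_sum, primalSq, residualSq]
  have hshift : ∑ τ ∈ Finset.range l, ‖p (τ + 1)‖ ^ 2 ≤ ∑ τ ∈ Finset.range (l + 1), ‖p τ‖ ^ 2 := by
    rw [Finset.sum_range_succ']; linarith [sq_nonneg ‖p 0‖]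
  have hshift' := mul_le_mul_of_nonneg_left hshift (sq_nonneg η)
  have hR : 0 ≤ ∑ τ ∈ Finset.range l, R τ ^ 2 := Finset.sum_nonneg fun _ _ => sq_nonneg _
  rw [Finset.sum_range_succ (fun τ => ‖e τ‖ ^ 2), Finset.sum_range_succ (fun τ => S τ ^ 2)]
  linarith [sq_nonneg ‖e 0‖]

open ContinuousLinearMap in
-- Testing the adjoint equation with `e` and stationarity with `ν` makes `⟨p, e⟩` telescope in time.
-- Young's inequality with the free parameter `ε` keeps the multipliers at a small coefficient, at
-- the price of `1 / (4 ε)` on the data.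
theorem ApproxKKT.energy_le {μ L η ε : ℝ} (hμ : 0 < μ) (hη : 0 ≤ η) (hε : 0 < ε)
    {A : X →L[ℝ] X} {B : U →L[ℝ] X} {l : ℕ} {e : ℕ → X} {ν : ℕ → U}
    {p g : ℕ → X} {h : ℕ → U} {R S Q : ℕ → ℝ} (H : ApproxKKT μ L η A B l e ν p g h R S Q) :
    μ * primalSq l e ν ≤ (ε + 2 * η) * ∑ τ ∈ Finset.range (l + 1), ‖p τ‖ ^ 2
      + (η + μ / 4) * primalSq l e ν + (1 / μ + 1 / (4 * ε)) * residualSq l e R S Q := by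
  have young : ∀ a b c : ℝ, 0 < c → a * b ≤ c * a ^ 2 + 1 / (4 * c) * b ^ 2 := by
    intro a b c hc
    have : 0 ≤ c * (a - b / (2 * c)) ^ 2 := by positivity
    have h2 : c * (a - b / (2 * c)) ^ 2 = c * a ^ 2 + 1 / (4 * c) * b ^ 2 - a * b := by
      field_simp; ring
    linarith
  have young' : ∀ a b : ℝ, b * a ≤ μ / 4 * a ^ 2 + 1 / μ * b ^ 2 := by
    intro a b
    have := young a b (μ / 4) (by positivity)
    have h3 : 1 / (4 * (μ / 4)) = 1 / μ := by field_simp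
    rw [h3] at this
    linarith
  have step : ∀ τ < l, μ * ‖e τ‖ ^ 2 + μ * ‖ν τ‖ ^ 2 ≤
      inner ℝ (p τ) (e τ) - inner ℝ (p (τ + 1)) (e (τ + 1)) + (ε + 2 * η) * ‖p (τ + 1)‖ ^ 2
      + (η + μ / 4) * ‖e τ‖ ^ 2 + (η + μ / 4) * ‖ν τ‖ ^ 2 + 1 / (4 * ε) * R τ ^ 2
      + 1 / μ * Q τ ^ 2 + 1 / μ * S τ ^ 2 := by
    intro τ hτ
    set r := e (τ + 1) - A (e τ) - B (ν τ) with hr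
    set s := p τ - adjoint A (p (τ + 1)) - g τ with hs
    set q := h τ + adjoint B (p (τ + 1)) with hq
    have hid : (inner ℝ (g τ) (e τ) : ℝ) + inner ℝ (h τ) (ν τ) =
        inner ℝ (p τ) (e τ) - inner ℝ (p (τ + 1)) (e (τ + 1)) - inner ℝ s (e τ)
          + inner ℝ q (ν τ) + inner ℝ (p (τ + 1)) r := by
      simp only [hr, hs, hq, inner_sub_left, inner_sub_right, inner_add_left,
        adjoint_inner_left]
      ring
    have c1 : -inner ℝ s (e τ) ≤ (η * ‖p (τ + 1)‖ + S τ) * ‖e τ‖ :=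
      ((neg_le_abs _).trans (abs_real_inner_le_norm _ _)).trans
        (mul_le_mul_of_nonneg_right (H.adj τ hτ) (norm_nonneg _))
    have c2 : inner ℝ q (ν τ) ≤ (η * ‖p (τ + 1)‖ + Q τ) * ‖ν τ‖ :=
      (real_inner_le_norm _ _).trans
        (mul_le_mul_of_nonneg_right (H.stat τ hτ) (norm_nonneg _))
    have c3 : inner ℝ (p (τ + 1)) r ≤ ‖p (τ + 1)‖ * (η * (‖e τ‖ + ‖ν τ‖) + R τ) :=
      (real_inner_le_norm _ _).trans
        (mul_le_mul_of_nonneg_left (H.dyn τ hτ) (norm_nonneg _))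
    have m1 := H.mono_state τ hτ.le
    have m2 := H.mono_control τ hτ
    have y1 := young' ‖e τ‖ (S τ)
    have y2 := young' ‖ν τ‖ (Q τ)
    have y3 := young ‖p (τ + 1)‖ (R τ) ε hε
    have y4 := mul_nonneg hη (sq_nonneg (‖p (τ + 1)‖ - ‖e τ‖))
    have y5 := mul_nonneg hη (sq_nonneg (‖p (τ + 1)‖ - ‖ν τ‖))
    linarith
  have hend : μ * ‖e l‖ ^ 2 ≤ inner ℝ (p l) (e l) + μ / 4 * ‖e l‖ ^ 2 + 1 / μ * S l ^ 2 := by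
    have m1 := H.mono_state l le_rfl
    have c1 : -inner ℝ (p l - g l) (e l) ≤ S l * ‖e l‖ :=
      ((neg_le_abs _).trans (abs_real_inner_le_norm _ _)).trans
        (mul_le_mul_of_nonneg_right H.final (norm_nonneg _))
    rw [inner_sub_left] at c1
    linarith [young' ‖e l‖ (S l)]
  have hstart : inner ℝ (p 0) (e 0) ≤ ε * ‖p 0‖ ^ 2 + 1 / (4 * ε) * ‖e 0‖ ^ 2 :=
    (real_inner_le_norm _ _).trans (young _ _ ε hε)
  have hsum := Finset.sum_le_sum (fun τ (hτ : τ ∈ Finset.range l) => step τ (Finset.mem_range.1 hτ))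
  simp only [Finset.sum_add_distrib, ← Finset.mul_sum] at hsum
  rw [Finset.sum_range_sub' (fun τ => (inner ℝ (p τ) (e τ) : ℝ))] at hsum
  simp only [primalSq, residualSq, Finset.sum_add_distrib]
  rw [Finset.sum_range_succ (fun τ => ‖e τ‖ ^ 2), Finset.sum_range_succ (fun τ => S τ ^ 2),
    Finset.sum_range_succ' (fun τ => ‖p τ‖ ^ 2)]
  have hR : 0 ≤ 1 / μ * ∑ τ ∈ Finset.range l, R τ ^ 2 :=
    mul_nonneg (by positivity) (Finset.sum_nonneg fun _ _ => sq_nonneg _)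
  have hQ : 0 ≤ 1 / (4 * ε) * ∑ τ ∈ Finset.range l, Q τ ^ 2 :=
    mul_nonneg (by positivity) (Finset.sum_nonneg fun _ _ => sq_nonneg _)
  have hS : 0 ≤ 1 / (4 * ε) * ∑ τ ∈ Finset.range l, S τ ^ 2 :=
    mul_nonneg (by positivity) (Finset.sum_nonneg fun _ _ => sq_nonneg _)
  have hSl : 0 ≤ 1 / (4 * ε) * S l ^ 2 := by positivity
  have he0 : 0 ≤ 1 / μ * ‖e 0‖ ^ 2 := by positivity
  have hp0 : 0 ≤ η * ‖p 0‖ ^ 2 := by positivity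
  have hel : 0 ≤ η * ‖e l‖ ^ 2 := by positivity
  linarith

end StageEstimate

/-- Every approximate optimality system for an `(L, γ)`-stabilizable pair with relative errors of
size at most `η` is bounded by `C` times its data. -/
def StageEstimate.{u} (L γ μ η C : ℝ) : Prop :=
  ∀ (X U : Type u) [NormedAddCommGroup X] [InnerProductSpace ℝ X] [CompleteSpace X]
    [NormedAddCommGroup U] [InnerProductSpace ℝ U] [CompleteSpace U]
    (A : X →L[ℝ] X) (B : U →L[ℝ] X), StablePair L γ A B →
    ∀ (l : ℕ) (e : ℕ → X) (ν : ℕ → U) (p g : ℕ → X) (h : ℕ → U) (R S Q : ℕ → ℝ),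
      ApproxKKT μ L η A B l e ν p g h R S Q →
      primalSq l e ν + ∑ τ ∈ Finset.range (l + 1), ‖p τ‖ ^ 2 ≤ C ^ 2 * residualSq l e R S Q

/-- `E` and `P` are the primal and dual sizes and `W` the data. The two bounds are circular, but `P`
enters the energy bound only with coefficient `3 η` (the choice `ε = η`), so substituting `P ≤ 2 m
(E + W)` leaves a multiple of `E` below `μ E`. -/
theorem absorb_primal_dual {μ m k η P E W : ℝ} (hμ : 0 < μ) (hm : 0 ≤ m) (hη : 0 ≤ η)
    (hη₁ : η * (2 * m + 1) ≤ μ / 16) (hη₂ : η * (2 * m + 1) ≤ 1)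
    (hP : 0 ≤ P) (hE : 0 ≤ E) (hW : 0 ≤ W) (hdual : P ≤ m * (η ^ 2 * P + E + W))
    (henergy : μ * E ≤ (η + 2 * η) * P + (η + μ / 4) * E + k * W) :
    E + P ≤ ((1 + 2 * m) * (2 / μ * (μ + k)) + 2 * m) * W := by
  have hmη : 0 ≤ m * η := mul_nonneg hm hη
  have hsmall : m * η ^ 2 ≤ 1 / 2 := by
    have h1 : m * η ^ 2 = m * η * η := by ring
    have h2 : m * η ≤ 1 / 2 := by linarith
    have h3 : η ≤ 1 := by linarith
    have h4 := mul_le_mul h2 h3 hη (by norm_num)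
    linarith
  have hPle : P ≤ 2 * m * (E + W) := by
    have := mul_le_mul_of_nonneg_right hsmall hP
    linarith
  have hEle : E ≤ 2 / μ * (μ + k) * W := by
    have h3 : (η + 2 * η) * P ≤ 6 * (m * η) * (E + W) := by
      have := mul_le_mul_of_nonneg_left hPle (by linarith : 0 ≤ 3 * η)
      linarith
    have h5 : 6 * (m * η) * (E + W) ≤ 3 * (μ / 16) * (E + W) :=
      mul_le_mul_of_nonneg_right (by linarith) (by linarith)
    have h6 : η * E ≤ μ / 16 * E := mul_le_mul_of_nonneg_right (by linarith) hE
    have h7 : E * μ ≤ 2 * (μ + k) * W := by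
      linarith [mul_nonneg hμ.le hE, mul_nonneg hμ.le hW]
    rw [div_mul_eq_mul_div, div_mul_eq_mul_div, le_div_iff₀ hμ]
    exact h7
  have := mul_le_mul_of_nonneg_left hEle (by linarith : 0 ≤ 1 + 2 * m)
  linarith

theorem exists_stageEstimate.{u} {L γ μ : ℝ} (hL : 1 < L) (hγ₀ : 0 < γ) (hγ₁ : γ < 1)
    (hμ : 0 < μ) : ∃ η C : ℝ, 0 < η ∧ 1 ≤ C ∧ StageEstimate.{u} L γ μ η C := by
  obtain ⟨m, hm⟩ : ∃ m, m = (L / (1 - γ)) ^ 2 * (5 * (1 + L) ^ 4) := ⟨_, rfl⟩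
  have hm0 : 0 ≤ m := by rw [hm]; positivity
  -- `m` depends only on `L` and `γ`; this `η` meets both smallness conditions of
  -- `absorb_primal_dual`, one of them with equality.
  obtain ⟨η, hη⟩ : ∃ η, η = min (μ / 16) 1 / (2 * m + 1) := ⟨_, rfl⟩
  have hη0 : 0 < η := by rw [hη]; positivity
  have hηZ : η * (2 * m + 1) = min (μ / 16) 1 := by rw [hη]; field_simp
  obtain ⟨k, hk⟩ : ∃ k, k = 1 / μ + 1 / (4 * η) := ⟨_, rfl⟩
  have hk0 : 0 ≤ k := by rw [hk]; positivity
  obtain ⟨D, hD⟩ : ∃ D, D = (1 + 2 * m) * (2 / μ * (μ + k)) + 2 * m := ⟨_, rfl⟩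
  have hD0 : 0 ≤ D := by rw [hD]; positivity
  refine ⟨η, 1 + D, hη0, by linarith, ?_⟩
  intro X U _ _ _ _ _ _ A B hAB l e ν p g h R S Q H
  have h1 := H.dual_le hL hγ₀ hγ₁ hAB
  have h2 := H.energy_le hμ hη0.le hη0
  rw [← hm] at h1
  rw [← hk] at h2
  have hW : 0 ≤ residualSq l e R S Q := add_nonneg (add_nonneg (sq_nonneg _)
    (Finset.sum_nonneg fun _ _ => by positivity)) (Finset.sum_nonneg fun _ _ => sq_nonneg _)
  have hfin := absorb_primal_dual hμ hm0 hη0.le (hηZ ▸ min_le_left _ _)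
    (hηZ ▸ min_le_right _ _) (Finset.sum_nonneg fun _ _ => sq_nonneg _)
    (add_nonneg (Finset.sum_nonneg fun _ _ => sq_nonneg _)
      (Finset.sum_nonneg fun _ _ => sq_nonneg _)) hW h1 h2
  rw [← hD] at hfin
  refine hfin.trans (mul_le_mul_of_nonneg_right ?_ hW)
  nlinarith

/-! ### Exponential decay in time -/

section TemporalDecay

universe u
variable {X U : Type u} [NormedAddCommGroup X] [InnerProductSpace ℝ X] [CompleteSpace X]
  [NormedAddCommGroup U] [InnerProductSpace ℝ U] [CompleteSpace U]

/-- A `μ`-strongly monotone, `L`-Lipschitz vector field vanishing at the origin. -/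
structure MonoLip (μ L : ℝ) {E : Type*} [NormedAddCommGroup E] [InnerProductSpace ℝ E]
    (g : E → E) : Prop where
  zero : g 0 = 0
  mono : ∀ x y, μ * ‖x - y‖ ^ 2 ≤ inner ℝ (g x - g y) (x - y)
  lip : ∀ x y, ‖g x - g y‖ ≤ L * ‖x - y‖

open ContinuousLinearMap in
/-- The optimality system over a window of length `l`, without initial and terminal conditions. -/
structure IsKKT (A : X →L[ℝ] X) (B : U →L[ℝ] X) (l : ℕ) (gf : ℕ → X → X) (gc : ℕ → U → U)
    (ζ : ℕ → X) (y : ℕ → X) (v : ℕ → U) (p : ℕ → X) : Prop where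
  dyn : ∀ τ < l, y (τ + 1) = A (y τ) + B (v τ) + ζ τ
  adj : ∀ τ < l, p τ = adjoint A (p (τ + 1)) + gf τ (y τ)
  stat : ∀ τ < l, gc τ (v τ) + adjoint B (p (τ + 1)) = 0

theorem IsKKT.zero {A : X →L[ℝ] X} {B : U →L[ℝ] X} {l : ℕ} {gf : ℕ → X → X} {gc : ℕ → U → U}
    (hf : ∀ τ < l, gf τ 0 = 0) (hc : ∀ τ < l, gc τ 0 = 0) :
    IsKKT A B l gf gc (fun _ => 0) (fun _ => 0) (fun _ => 0) (fun _ => 0) where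
  dyn τ _ := by simp
  adj τ hτ := by simp [hf τ hτ]
  stat τ hτ := by simp [hc τ hτ]

theorem IsKKT.mono {A : X →L[ℝ] X} {B : U →L[ℝ] X} {l l' : ℕ} {gf : ℕ → X → X}
    {gc : ℕ → U → U} {ζ y : ℕ → X} {v : ℕ → U} {p : ℕ → X} (h : IsKKT A B l gf gc ζ y v p)
    (hl : l' ≤ l) : IsKKT A B l' gf gc ζ y v p where
  dyn τ hτ := h.dyn τ (hτ.trans_le hl)
  adj τ hτ := h.adj τ (hτ.trans_le hl)
  stat τ hτ := h.stat τ (hτ.trans_le hl)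

theorem abs_sub_le_of_comparable {δ a b : ℝ} (hδ : 0 < δ) (hδ₁ : δ < 1) (ha : 0 ≤ a)
    (h₁ : δ * a ≤ b) (h₂ : δ * b ≤ a) : |b - a| * δ ≤ (1 - δ) * a := by
  rcases abs_cases (b - a) with ⟨h, _⟩ | ⟨h, _⟩ <;> rw [h]
  · linarith
  · have : (1 - δ) * (1 - δ) * a ≥ 0 := by positivity
    nlinarith

/-- Carrying a weight across one time step leaves `(b - a) M x`. Consecutive weights agree up to a
factor `δ`, so this is a relative error of at most `L (1 - δ) / δ`, which is half of what `hη`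
allows. -/
theorem norm_smul_commutator_le {E F : Type*} [NormedAddCommGroup E] [NormedSpace ℝ E]
    [NormedAddCommGroup F] [NormedSpace ℝ F] {M : E →L[ℝ] F} {L δ η a b : ℝ}
    (hL : 0 < L) (hδ : 0 < δ) (hδ₁ : δ < 1) (hη : 2 * L * (1 - δ) ≤ η * δ)
    (hM : ‖M‖ ≤ L) (ha : 0 ≤ a) (h₁ : δ * a ≤ b) (h₂ : δ * b ≤ a) (x : E) :
    ‖(b - a) • M x‖ ≤ η * ‖a • x‖ := by
  rw [norm_smul, norm_smul, Real.norm_eq_abs, Real.norm_eq_abs, abs_of_nonneg ha]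
  have h3 := abs_sub_le_of_comparable hδ hδ₁ ha h₁ h₂
  have h4 : ‖M x‖ ≤ L * ‖x‖ := (M.le_opNorm x).trans
    (mul_le_mul_of_nonneg_right hM (norm_nonneg _))
  have h5 : |b - a| * L ≤ η * a := by
    have h6 : |b - a| * δ * L ≤ (1 - δ) * a * L := mul_le_mul_of_nonneg_right h3 hL.le
    have h7 : 2 * L * (1 - δ) * a ≤ η * δ * a := mul_le_mul_of_nonneg_right hη ha
    have h8 : 0 ≤ (1 - δ) * a * L := by
      have := sub_pos.2 hδ₁
      positivity
    refine le_of_mul_le_mul_right (a := δ) ?_ hδ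
    linarith
  calc |b - a| * ‖M x‖ ≤ |b - a| * (L * ‖x‖) := mul_le_mul_of_nonneg_left h4 (abs_nonneg _)
    _ = |b - a| * L * ‖x‖ := by ring
    _ ≤ η * a * ‖x‖ := mul_le_mul_of_nonneg_right h5 (norm_nonneg _)
    _ = _ := by ring

open ContinuousLinearMap in
-- The increments multiplied by `δ ^ ψ τ` solve the system up to commutators, which the slack `η` of
-- the stage estimate absorbs. Any profile `ψ` with steps at most one is allowed, and choosing it
-- gives the various decay statements. The terminal gradients need not coincide: `gl` is a monotone
-- reference increment and `H` measures the mismatch with it.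
theorem IsKKT.temporal_estimate {L γ μ η C δ : ℝ} (hL : 1 < L) (hδ : 0 < δ)
    (hδ₁ : δ < 1) (hη : 2 * L * (1 - δ) ≤ η * δ) (hest : StageEstimate.{u} L γ μ η C)
    {A : X →L[ℝ] X} {B : U →L[ℝ] X} (hAB : StablePair L γ A B) {l : ℕ} {gf : ℕ → X → X}
    {gc : ℕ → U → U} (hgf : ∀ τ < l, MonoLip μ L (gf τ)) (hgc : ∀ τ < l, MonoLip μ L (gc τ))
    {ζ ζ' y y' : ℕ → X} {v v' : ℕ → U} {p p' : ℕ → X} (h : IsKKT A B l gf gc ζ y v p)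
    (h' : IsKKT A B l gf gc ζ' y' v' p') {gl : X} {H : ℝ}
    (hmono : μ * ‖y l - y' l‖ ^ 2 ≤ inner ℝ gl (y l - y' l)) (hlip : ‖gl‖ ≤ L * ‖y l - y' l‖)
    (hH : ‖p l - p' l - gl‖ ≤ H)
    (ψ : ℕ → ℕ) (hψ₁ : ∀ τ, ψ (τ + 1) ≤ ψ τ + 1) (hψ₂ : ∀ τ, ψ τ ≤ ψ (τ + 1) + 1) :
    ∑ τ ∈ Finset.range (l + 1), (δ ^ ψ τ * ‖y τ - y' τ‖) ^ 2
      + ∑ τ ∈ Finset.range l, (δ ^ ψ τ * ‖v τ - v' τ‖) ^ 2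
      + ∑ τ ∈ Finset.range (l + 1), (δ ^ ψ τ * ‖p τ - p' τ‖) ^ 2 ≤
      C ^ 2 * ((δ ^ ψ 0 * ‖y 0 - y' 0‖) ^ 2
        + ∑ τ ∈ Finset.range l, (δ ^ ψ (τ + 1) * ‖ζ τ - ζ' τ‖) ^ 2 + (δ ^ ψ l * H) ^ 2) := by
  have hpos : ∀ n : ℕ, 0 < δ ^ n := fun n => pow_pos hδ n
  have ratio : ∀ m n : ℕ, m ≤ n + 1 → δ * δ ^ n ≤ δ ^ m := by
    intro m n hmn
    rw [← pow_succ']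
    exact pow_le_pow_of_le_one hδ.le hδ₁.le hmn
  have hL0 : 0 < L := by linarith
  have hA' : ‖adjoint A‖ ≤ L := by rw [LinearIsometryEquiv.norm_map]; exact hAB.norm_left
  have hB' : ‖adjoint B‖ ≤ L := by rw [LinearIsometryEquiv.norm_map]; exact hAB.norm_right
  set a : ℕ → ℝ := fun τ => δ ^ ψ τ with ha
  have ha0 : ∀ τ, 0 < a τ := fun τ => hpos _
  have r1 : ∀ τ, δ * a τ ≤ a (τ + 1) := fun τ => ratio _ _ (hψ₁ τ)
  have r2 : ∀ τ, δ * a (τ + 1) ≤ a τ := fun τ => ratio _ _ (hψ₂ τ)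
  have hn : ∀ τ {E : Type u} [NormedAddCommGroup E] [NormedSpace ℝ E] (x : E),
      ‖a τ • x‖ = a τ * ‖x‖ := by
    intro τ E _ _ x
    rw [norm_smul, Real.norm_of_nonneg (ha0 τ).le]
  have mono_smul : ∀ τ {E : Type u} [NormedAddCommGroup E] [InnerProductSpace ℝ E] (g x : E),
      μ * ‖x‖ ^ 2 ≤ inner ℝ g x → μ * ‖a τ • x‖ ^ 2 ≤ inner ℝ (a τ • g) (a τ • x) := by
    intro τ E _ _ g x hx
    rw [hn, real_inner_smul_left, real_inner_smul_right]
    have := mul_le_mul_of_nonneg_left hx (sq_nonneg (a τ))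
    linarith
  have lip_smul : ∀ τ {E : Type u} [NormedAddCommGroup E] [NormedSpace ℝ E] (g x : E),
      ‖g‖ ≤ L * ‖x‖ → ‖a τ • g‖ ≤ L * ‖a τ • x‖ := by
    intro τ E _ _ g x hx
    rw [hn, hn]
    have := mul_le_mul_of_nonneg_left hx (ha0 τ).le
    linarith
  have key := hest X U A B hAB l (fun τ => a τ • (y τ - y' τ)) (fun τ => a τ • (v τ - v' τ))
    (fun τ => a τ • (p τ - p' τ))
    (fun τ => a τ • (if τ < l then gf τ (y τ) - gf τ (y' τ) else gl))
    (fun τ => a τ • (gc τ (v τ) - gc τ (v' τ)))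
    (fun τ => a (τ + 1) * ‖ζ τ - ζ' τ‖) (fun τ => if τ < l then 0 else a l * H) (fun _ => 0)
    { dyn := by
        intro τ hτ
        have : a (τ + 1) • (y (τ + 1) - y' (τ + 1)) - A (a τ • (y τ - y' τ))
            - B (a τ • (v τ - v' τ)) = (a (τ + 1) - a τ) • A (y τ - y' τ)
            + (a (τ + 1) - a τ) • B (v τ - v' τ) + a (τ + 1) • (ζ τ - ζ' τ) := by
          rw [h.dyn τ hτ, h'.dyn τ hτ]
          simp only [map_smul, map_sub]
          module
        rw [this]
        have c1 := norm_smul_commutator_le hL0 hδ hδ₁ hη hAB.norm_left (ha0 τ).le (r1 τ) (r2 τ)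
          (y τ - y' τ)
        have c2 := norm_smul_commutator_le hL0 hδ hδ₁ hη hAB.norm_right (ha0 τ).le (r1 τ) (r2 τ)
          (v τ - v' τ)
        have c3 := norm_add₃_le (a := (a (τ + 1) - a τ) • A (y τ - y' τ))
          (b := (a (τ + 1) - a τ) • B (v τ - v' τ)) (c := a (τ + 1) • (ζ τ - ζ' τ))
        rw [hn (τ + 1)] at c3
        linarith
      adj := by
        intro τ hτ
        have : a τ • (p τ - p' τ) - adjoint A (a (τ + 1) • (p (τ + 1) - p' (τ + 1)))
            - a τ • (if τ < l then gf τ (y τ) - gf τ (y' τ) else gl)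
            = (a τ - a (τ + 1)) • adjoint A (p (τ + 1) - p' (τ + 1)) := by
          rw [h.adj τ hτ, h'.adj τ hτ, if_pos hτ]
          simp only [map_smul, map_sub]
          module
        rw [this, if_pos hτ, add_zero]
        exact norm_smul_commutator_le hL0 hδ hδ₁ hη hA' (ha0 _).le (r2 τ) (r1 τ) _
      final := by
        simp only [lt_irrefl, if_false]
        rw [← smul_sub, hn]
        exact mul_le_mul_of_nonneg_left hH (ha0 l).le
      stat := by
        intro τ hτ
        have : a τ • (gc τ (v τ) - gc τ (v' τ)) + adjoint B (a (τ + 1) • (p (τ + 1) - p' (τ + 1)))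
            = (a τ - a (τ + 1)) • adjoint B (-(p (τ + 1) - p' (τ + 1))) := by
          rw [eq_neg_of_add_eq_zero_left (h.stat τ hτ), eq_neg_of_add_eq_zero_left (h'.stat τ hτ)]
          simp only [map_smul, map_sub, map_neg]
          module
        rw [this, add_zero, ← norm_neg (a (τ + 1) • (p (τ + 1) - p' (τ + 1))), ← smul_neg]
        exact norm_smul_commutator_le hL0 hδ hδ₁ hη hB' (ha0 _).le (r2 τ) (r1 τ) _
      mono_state := by
        intro τ hτ
        refine mono_smul τ _ _ ?_
        split_ifs with h0
        · exact (hgf τ h0).mono _ _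
        · obtain rfl : τ = l := by omega
          exact hmono
      lip_state := by
        intro τ hτ
        refine lip_smul τ _ _ ?_
        split_ifs with h0
        · exact (hgf τ h0).lip _ _
        · obtain rfl : τ = l := by omega
          exact hlip
      mono_control := fun τ hτ => mono_smul τ _ _ ((hgc τ hτ).mono _ _)
      lip_control := fun τ hτ => lip_smul τ _ _ ((hgc τ hτ).lip _ _) }
  simp only [primalSq, residualSq, hn] at key
  refine key.trans (le_of_eq ?_)
  rw [Finset.sum_range_succ (fun τ => (if τ < l then (0 : ℝ) else a l * H) ^ 2),
    Finset.sum_eq_zero (s := Finset.range l) (f := fun τ => (if τ < l then (0 : ℝ) else a l * H) ^ 2)]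
  · simp [ha]
  · intro τ hτ
    simp [Finset.mem_range.1 hτ]

/-- The common data of the decay estimates. -/
structure DecayData (L γ μ η C δ : ℝ) : Prop where
  one_lt : 1 < L
  decay_pos : 0 < δ
  decay_lt_one : δ < 1
  small : 2 * L * (1 - δ) ≤ η * δ
  one_le : 1 ≤ C
  estimate : StageEstimate.{u} L γ μ η C

theorem exists_decayData {L γ μ : ℝ} (hL : 1 < L) (hγ₀ : 0 < γ) (hγ₁ : γ < 1) (hμ : 0 < μ) :
    ∃ η C δ : ℝ, DecayData.{u} L γ μ η C δ := by
  obtain ⟨η, C, hη, hC, hest⟩ := exists_stageEstimate.{u} hL hγ₀ hγ₁ hμ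
  -- This `δ` solves `2 L (1 - δ) = η δ`.
  refine ⟨η, C, 2 * L / (2 * L + η), hL, by positivity, ?_, ?_, hC, hest⟩
  · rw [div_lt_one (by positivity)]; linarith
  · apply le_of_eq; field_simp; ring

variable {L γ μ η C δ : ℝ} {A : X →L[ℝ] X} {B : U →L[ℝ] X} {l : ℕ} {gf : ℕ → X → X}
  {gc : ℕ → U → U} {ζ ζ' y y' : ℕ → X} {v v' : ℕ → U} {p p' : ℕ → X}

/-- Solutions of the same problem with different initial states approach each other
exponentially fast. -/
theorem IsKKT.initial_decay (hd : DecayData.{u} L γ μ η C δ) (hAB : StablePair L γ A B)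
    (hgf : ∀ τ < l, MonoLip μ L (gf τ)) (hgc : ∀ τ < l, MonoLip μ L (gc τ))
    (h : IsKKT A B l gf gc ζ y v p) (h' : IsKKT A B l gf gc ζ y' v' p') {gF : X → X}
    (hgF : MonoLip μ L gF) (hp : p l = gF (y l)) (hp' : p' l = gF (y' l)) {τ : ℕ} (hτ : τ ≤ l) :
    ‖y τ - y' τ‖ ≤ C * δ ^ τ * ‖y 0 - y' 0‖ := by
  -- The profile is `τ - j` in truncated subtraction: weight `δ ^ τ` at the initial time, rising to
  -- `1` at `τ` and staying there.
  have key := IsKKT.temporal_estimate hd.one_lt hd.decay_pos hd.decay_lt_one hd.small hd.estimate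
    hAB hgf hgc h h' (gl := gF (y l) - gF (y' l)) (H := 0) (hgF.mono _ _) (hgF.lip _ _)
    (by simp [hp, hp']) (fun j => τ - j) (fun j => by omega) (fun j => by omega)
  have hC := hd.one_le
  have hδ := hd.decay_pos
  have h1 := Finset.single_le_sum (f := fun j => (δ ^ (τ - j) * ‖y j - y' j‖) ^ 2)
    (fun _ _ => sq_nonneg _) (Finset.mem_range.2 (Nat.lt_succ_of_le hτ))
  have h2 : 0 ≤ ∑ j ∈ Finset.range l, (δ ^ (τ - j) * ‖v j - v' j‖) ^ 2 :=
    Finset.sum_nonneg fun _ _ => sq_nonneg _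
  have h3 : 0 ≤ ∑ j ∈ Finset.range (l + 1), (δ ^ (τ - j) * ‖p j - p' j‖) ^ 2 :=
    Finset.sum_nonneg fun _ _ => sq_nonneg _
  simp only [sub_self, norm_zero, mul_zero, ne_eq, OfNat.ofNat_ne_zero, not_false_eq_true,
    zero_pow, Finset.sum_const_zero, add_zero, tsub_zero] at key
  simp only [tsub_self, pow_zero, one_mul] at h1
  refine abs_le_of_sq_le_sq' ?_ (by positivity) |>.2
  linarith [mul_pow C (δ ^ τ * ‖y 0 - y' 0‖) 2, mul_assoc C (δ ^ τ) ‖y 0 - y' 0‖,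
    congrArg (· ^ 2) (mul_assoc C (δ ^ τ) ‖y 0 - y' 0‖)]

/-- The first control depends on the terminal condition only through exponentially small terms. -/
theorem IsKKT.terminal_sensitivity (hd : DecayData.{u} L γ μ η C δ) (hAB : StablePair L γ A B)
    (hgf : ∀ τ < l, MonoLip μ L (gf τ)) (hgc : ∀ τ < l, MonoLip μ L (gc τ))
    (h : IsKKT A B l gf gc ζ y v p) (h' : IsKKT A B l gf gc ζ y' v' p') (h0 : y 0 = y' 0)
    (hl : 1 ≤ l) {gl : X} {H : ℝ} (hH0 : 0 ≤ H)
    (hmono : μ * ‖y l - y' l‖ ^ 2 ≤ inner ℝ gl (y l - y' l)) (hlip : ‖gl‖ ≤ L * ‖y l - y' l‖)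
    (hH : ‖p l - p' l - gl‖ ≤ H) :
    ‖v 0 - v' 0‖ ≤ C * δ ^ l * H := by
  -- The profile `j` gives weight `1` to the first control and `δ ^ l` to the terminal mismatch, the
  -- only remaining datum.
  have key := IsKKT.temporal_estimate hd.one_lt hd.decay_pos hd.decay_lt_one hd.small hd.estimate
    hAB hgf hgc h h' hmono hlip hH (fun j => j) (fun j => by omega) (fun j => by omega)
  have hC := hd.one_le
  have hδ := hd.decay_pos
  have h1 := Finset.single_le_sum (f := fun j => (δ ^ j * ‖v j - v' j‖) ^ 2)
    (fun _ _ => sq_nonneg _) (Finset.mem_range.2 hl)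
  have h2 : 0 ≤ ∑ j ∈ Finset.range (l + 1), (δ ^ j * ‖y j - y' j‖) ^ 2 :=
    Finset.sum_nonneg fun _ _ => sq_nonneg _
  have h3 : 0 ≤ ∑ j ∈ Finset.range (l + 1), (δ ^ j * ‖p j - p' j‖) ^ 2 :=
    Finset.sum_nonneg fun _ _ => sq_nonneg _
  simp only [h0, sub_self, norm_zero, mul_zero, ne_eq, OfNat.ofNat_ne_zero, not_false_eq_true,
    zero_pow, Finset.sum_const_zero, zero_add] at key
  simp only [pow_zero, one_mul] at h1
  refine abs_le_of_sq_le_sq' ?_ (by positivity) |>.2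
  linarith [mul_pow C (δ ^ l * H) 2, congrArg (· ^ 2) (mul_assoc C (δ ^ l) H)]

theorem sum_sq_le_sq_sum_of_nonneg {ι : Type*} (s : Finset ι) (a : ι → ℝ)
    (ha : ∀ i ∈ s, 0 ≤ a i) : ∑ i ∈ s, a i ^ 2 ≤ (∑ i ∈ s, a i) ^ 2 := by
  classical
  induction s using Finset.induction_on with
  | empty => simp
  | insert i s hi ih =>
    rw [Finset.sum_insert hi, Finset.sum_insert hi]
    have h1 := ha i (Finset.mem_insert_self i s)
    have h2 : ∀ j ∈ s, 0 ≤ a j := fun j hj => ha j (Finset.mem_insert_of_mem hj)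
    have h3 := ih h2
    have h4 : 0 ≤ a i * ∑ j ∈ s, a j := mul_nonneg h1 (Finset.sum_nonneg h2)
    linarith [add_sq (a i) (∑ j ∈ s, a j)]

/-- The exponent is `|τ + 1 - k|`. Up to time `k` the total of the disturbances is bounded by `D`;
later only each single one is, and the geometric weights make up for it. -/
theorem sum_pow_weight_le {δ D : ℝ} (hδ : 0 < δ) (hδ₁ : δ < 1) {k l : ℕ} (hkl : k ≤ l)
    {b : ℕ → ℝ} (hb : ∀ τ, 0 ≤ b τ) (hsum : ∑ τ ∈ Finset.range k, b τ ≤ D)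
    (hbD : ∀ τ < l, b τ ≤ D) (hD : 0 ≤ D) :
    ∑ τ ∈ Finset.range l, δ ^ ((k - (τ + 1)) + ((τ + 1) - k)) * b τ ≤ 2 / (1 - δ) * D := by
  have h1 : 0 < 1 - δ := by linarith
  obtain ⟨j, rfl⟩ := Nat.exists_eq_add_of_le hkl
  rw [Finset.sum_range_add]
  have s1 : ∑ τ ∈ Finset.range k, δ ^ ((k - (τ + 1)) + ((τ + 1) - k)) * b τ ≤ D := by
    refine (Finset.sum_le_sum fun τ _ => ?_).trans hsum
    exact mul_le_of_le_one_left (hb τ) (pow_le_one₀ hδ.le hδ₁.le)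
  have s2 : ∑ τ ∈ Finset.range j, δ ^ ((k - (k + τ + 1)) + ((k + τ + 1) - k)) * b (k + τ) ≤
      1 / (1 - δ) * D := by
    have : ∑ τ ∈ Finset.range j, δ ^ ((k - (k + τ + 1)) + ((k + τ + 1) - k)) * b (k + τ) ≤
        ∑ τ ∈ Finset.range j, δ ^ τ * D := by
      refine Finset.sum_le_sum fun τ hτ => ?_
      have hτ' := Finset.mem_range.1 hτ
      exact mul_le_mul (pow_le_pow_of_le_one hδ.le hδ₁.le (by omega))
        (hbD _ (by omega)) (hb _) (by positivity)
    refine this.trans ?_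
    rw [← Finset.sum_mul]
    refine mul_le_mul_of_nonneg_right ?_ hD
    have := (summable_geometric_of_lt_one hδ.le hδ₁).sum_le_tsum (Finset.range j)
      (fun i _ => by positivity)
    rw [tsum_geometric_of_lt_one hδ.le hδ₁] at this
    simpa using this
  have s3 : D ≤ 1 / (1 - δ) * D := by
    refine le_mul_of_one_le_left hD ?_
    rw [le_div_iff₀ h1]; linarith
  have : 2 / (1 - δ) * D = 1 / (1 - δ) * D + 1 / (1 - δ) * D := by ring
  linarith

/-- Size of the state and of the multiplier of a solution at time `k`. -/
theorem IsKKT.size_at (hd : DecayData.{u} L γ μ η C δ) (hAB : StablePair L γ A B)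
    (hgf : ∀ τ < l, MonoLip μ L (gf τ)) (hgc : ∀ τ < l, MonoLip μ L (gc τ))
    (h : IsKKT A B l gf gc ζ y v p) {gF : X → X} (hgF : MonoLip μ L gF) (hp : p l = gF (y l))
    {k : ℕ} (hk : k ≤ l) {D : ℝ} (hD : 0 ≤ D) (hsum : ∑ τ ∈ Finset.range k, ‖ζ τ‖ ≤ D)
    (hζ : ∀ τ < l, ‖ζ τ‖ ≤ D) :
    ‖y k‖ ≤ C * (δ ^ k * ‖y 0‖ + 2 / (1 - δ) * D) ∧
      ‖p k‖ ≤ C * (δ ^ k * ‖y 0‖ + 2 / (1 - δ) * D) := by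
  -- Comparison with the zero solution, under the profile `|j - k|` centred at the time of interest.
  have key := IsKKT.temporal_estimate hd.one_lt hd.decay_pos hd.decay_lt_one hd.small hd.estimate
    hAB hgf hgc h (IsKKT.zero (fun τ hτ => (hgf τ hτ).zero) (fun τ hτ => (hgc τ hτ).zero))
    (gl := gF (y l) - gF 0) (H := 0) (hgF.mono _ _) (hgF.lip _ _)
    (by simp [hp, hgF.zero]) (fun j => (k - j) + (j - k)) (fun j => by omega) (fun j => by omega)
  have hC := hd.one_le
  have hδ := hd.decay_pos
  have hδ' : 0 < 1 - δ := by have := hd.decay_lt_one; linarith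
  have h1 := Finset.single_le_sum (f := fun j => (δ ^ ((k - j) + (j - k)) * ‖y j‖) ^ 2)
    (fun _ _ => sq_nonneg _) (Finset.mem_range.2 (Nat.lt_succ_of_le hk))
  have h1' := Finset.single_le_sum (f := fun j => (δ ^ ((k - j) + (j - k)) * ‖p j‖) ^ 2)
    (fun _ _ => sq_nonneg _) (Finset.mem_range.2 (Nat.lt_succ_of_le hk))
  have h2 : 0 ≤ ∑ j ∈ Finset.range l, (δ ^ ((k - j) + (j - k)) * ‖v j‖) ^ 2 :=
    Finset.sum_nonneg fun _ _ => sq_nonneg _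
  have h3 : ∑ τ ∈ Finset.range l, (δ ^ ((k - (τ + 1)) + ((τ + 1) - k)) * ‖ζ τ‖) ^ 2 ≤
      (2 / (1 - δ) * D) ^ 2 := by
    refine (sum_sq_le_sq_sum_of_nonneg _ _ fun _ _ => by positivity).trans ?_
    have := sum_pow_weight_le hδ hd.decay_lt_one hk (fun τ => norm_nonneg (ζ τ)) hsum hζ hD
    gcongr
  simp only [sub_zero, mul_zero, ne_eq, OfNat.ofNat_ne_zero, not_false_eq_true,
    zero_pow, add_zero, zero_tsub] at key
  simp only [tsub_self, pow_zero, one_mul, add_zero] at h1 h1'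
  have h4 : (δ ^ k * ‖y 0‖) ^ 2 + ∑ τ ∈ Finset.range l,
      (δ ^ ((k - (τ + 1)) + ((τ + 1) - k)) * ‖ζ τ‖) ^ 2 ≤
      (δ ^ k * ‖y 0‖ + 2 / (1 - δ) * D) ^ 2 := by
    have : 0 ≤ δ ^ k * ‖y 0‖ * (2 / (1 - δ) * D) := by positivity
    linarith [add_sq (δ ^ k * ‖y 0‖) (2 / (1 - δ) * D)]
  have h5 := mul_le_mul_of_nonneg_left h4 (sq_nonneg C)
  simp only [tsub_zero] at key
  rw [← mul_pow] at h5
  constructor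
  · exact abs_le_of_sq_le_sq' (by linarith [sq_nonneg ‖p k‖]) (by positivity) |>.2
  · exact abs_le_of_sq_le_sq' (by linarith [sq_nonneg ‖y k‖]) (by positivity) |>.2

/-- The `ℓ²`-size of a solution. -/
theorem IsKKT.size_le (hd : DecayData.{u} L γ μ η C δ) (hAB : StablePair L γ A B)
    (hgf : ∀ τ < l, MonoLip μ L (gf τ)) (hgc : ∀ τ < l, MonoLip μ L (gc τ))
    (h : IsKKT A B l gf gc ζ y v p) {gF : X → X} (hgF : MonoLip μ L gF) (hp : p l = gF (y l)) :
    ∑ τ ∈ Finset.range (l + 1), ‖y τ‖ ^ 2 + ∑ τ ∈ Finset.range l, ‖v τ‖ ^ 2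
      + ∑ τ ∈ Finset.range (l + 1), ‖p τ‖ ^ 2 ≤
      C ^ 2 * (‖y 0‖ ^ 2 + ∑ τ ∈ Finset.range l, ‖ζ τ‖ ^ 2) := by
  have key := IsKKT.temporal_estimate hd.one_lt hd.decay_pos hd.decay_lt_one hd.small hd.estimate
    hAB hgf hgc h (IsKKT.zero (fun τ hτ => (hgf τ hτ).zero) (fun τ hτ => (hgc τ hτ).zero))
    (gl := gF (y l) - gF 0) (H := 0) (hgF.mono _ _) (hgF.lip _ _)
    (by simp [hp, hgF.zero]) (fun _ => 0) (fun j => by omega) (fun j => by omega)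
  simpa using key

end TemporalDecay

/-! ### Matrices as operators, and spatial weights -/

section MatrixOperators

variable {X U Y : Type*} [Fintype X] [DecidableEq X] [Fintype U] [DecidableEq U]
  [Fintype Y] [DecidableEq Y]

/-- The continuous linear map given by a matrix. -/
def actL (M : Matrix X U ℝ) : EuclideanSpace ℝ U →L[ℝ] EuclideanSpace ℝ X :=
  LinearMap.toContinuousLinearMap (Matrix.toEuclideanLin M)

omit [DecidableEq X] in
theorem actL_eq_act (M : Matrix X U ℝ) (v : EuclideanSpace ℝ U) : actL M v = act M v := rfl

omit [DecidableEq X] in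
theorem actL_apply (M : Matrix X U ℝ) (v : EuclideanSpace ℝ U) (i : X) :
    actL M v i = ∑ j, M i j * v j := rfl

omit [DecidableEq X] in
theorem norm_actL (M : Matrix X U ℝ) : ‖actL M‖ = ‖M‖ := by
  rw [Matrix.l2_opNorm_def]; rfl

theorem adjoint_actL (M : Matrix X U ℝ) :
    ContinuousLinearMap.adjoint (actL M) = actL M.transpose := by
  refine (ContinuousLinearMap.eq_adjoint_iff _ _).2 ?_ |>.symm
  intro x y
  simp only [PiLp.inner_apply, actL_apply, RCLike.inner_apply, conj_trivial, Finset.mul_sum,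
    Finset.sum_mul, Matrix.transpose_apply]
  rw [Finset.sum_comm]
  refine Finset.sum_congr rfl fun i _ => Finset.sum_congr rfl fun j _ => by ring

omit [DecidableEq X] in
theorem actL_mul (M : Matrix X U ℝ) (N : Matrix U Y ℝ) : actL (M * N) = actL M ∘L actL N := by
  ext v i
  simp only [actL_apply, ContinuousLinearMap.comp_apply, Matrix.mul_apply, Finset.sum_mul,
    Finset.mul_sum]
  rw [Finset.sum_comm]
  refine Finset.sum_congr rfl fun i _ => Finset.sum_congr rfl fun j _ => by ring

omit [DecidableEq X] in
theorem actL_sub (M N : Matrix X U ℝ) : actL (M - N) = actL M - actL N := by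
  ext v i
  simp [actL_apply, sub_mul, Finset.sum_sub_distrib]

theorem actL_pow (M : Matrix X X ℝ) (t : ℕ) : actL (M ^ t) = actL M ^ t := by
  induction t with
  | zero => ext v i; simp [actL_apply, Matrix.one_apply]
  | succ t ih => rw [pow_succ, pow_succ, actL_mul, ih]; rfl

theorem stablePair_actL {L γ : ℝ} {A : Matrix X X ℝ} {B : Matrix X U ℝ} (hA : ‖A‖ ≤ L)
    (hB : ‖B‖ ≤ L) (h : IsStabilizable L γ A B) : StablePair L γ (actL A) (actL B) where
  norm_left := (norm_actL A).trans_le hA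
  norm_right := (norm_actL B).trans_le hB
  gain := by
    obtain ⟨K, hK, hpow⟩ := h
    refine ⟨actL K, (norm_actL K).trans_le hK, fun t => ?_⟩
    rw [← actL_mul, ← actL_sub, ← actL_pow, norm_actL]
    exact hpow t

theorem norm_transpose (M : Matrix X U ℝ) : ‖M.transpose‖ = ‖M‖ := by
  rw [← Matrix.l2_opNorm_conjTranspose M, Matrix.conjTranspose_eq_transpose_of_trivial]

omit [DecidableEq X] in
/-- Pinching: keeping only the entries at which two labellings agree does not increase the
operator norm. -/
theorem norm_mask_apply_le {ι : Type*} [DecidableEq ι] (M : Matrix X U ℝ) (α : X → ι) (β : U → ι)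
    (x : EuclideanSpace ℝ U) :
    ‖actL (Matrix.of fun p q => if α p = β q then M p q else 0) x‖ ≤ ‖M‖ * ‖x‖ := by
  -- The masked matrix sends the part of `x` with label `r` into the coordinates with label `r`, so
  -- squared norms add over labels on both sides.
  set P : ι → EuclideanSpace ℝ U := fun r => WithLp.toLp 2 fun q => if β q = r then x q else 0
    with hP
  have hentry : ∀ p, actL (Matrix.of fun p q => if α p = β q then M p q else 0) x p
      = actL M (P (α p)) p := by
    intro p
    simp only [actL_apply, hP, Matrix.of_apply]
    refine Finset.sum_congr rfl fun q _ => ?_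
    by_cases h : α p = β q
    · simp [h]
    · simp [h, Ne.symm h]
  refine abs_le_of_sq_le_sq' ?_ (by positivity) |>.2
  rw [EuclideanSpace.norm_sq_eq, mul_pow]
  simp only [hentry, Real.norm_eq_abs, sq_abs]
  rw [← Finset.sum_fiberwise_of_maps_to (s := Finset.univ) (t := Finset.univ.image α)
    (g := α) (fun p hp => Finset.mem_image_of_mem α hp)]
  have h1 : ∀ r ∈ Finset.univ.image α, ∑ p ∈ Finset.univ.filter (fun p => α p = r),
      actL M (P (α p)) p ^ 2 ≤ ‖M‖ ^ 2 * ‖P r‖ ^ 2 := by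
    intro r _
    calc _ = ∑ p ∈ Finset.univ.filter (fun p => α p = r), actL M (P r) p ^ 2 := by
          refine Finset.sum_congr rfl fun p hp => ?_
          rw [(Finset.mem_filter.1 hp).2]
      _ ≤ ∑ p, actL M (P r) p ^ 2 :=
          Finset.sum_le_sum_of_subset_of_nonneg (Finset.filter_subset _ _)
            fun _ _ _ => sq_nonneg _
      _ = ‖actL M (P r)‖ ^ 2 := by
          rw [EuclideanSpace.norm_sq_eq]; simp
      _ ≤ (‖M‖ * ‖P r‖) ^ 2 := by
          have := (actL M).le_opNorm (P r)
          rw [norm_actL] at this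
          gcongr
      _ = _ := mul_pow _ _ _
  refine (Finset.sum_le_sum h1).trans ?_
  rw [← Finset.mul_sum]
  refine mul_le_mul_of_nonneg_left ?_ (sq_nonneg _)
  simp only [EuclideanSpace.norm_sq_eq, hP, Real.norm_eq_abs, sq_abs]
  rw [Finset.sum_comm]
  refine Finset.sum_le_sum fun q _ => ?_
  calc _ = ∑ r ∈ Finset.univ.image α, if β q = r then x q ^ 2 else 0 := by
        refine Finset.sum_congr rfl fun r _ => ?_
        split_ifs <;> simp
    _ ≤ x q ^ 2 := by
        rw [Finset.sum_ite_eq]; split_ifs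
        · exact le_rfl
        · positivity

/-- Coordinatewise rescaling. -/
def scale {ι : Type*} (b : ι → ℝ) (x : EuclideanSpace ℝ ι) : EuclideanSpace ℝ ι :=
  WithLp.toLp 2 fun i => b i * x i

/-- Zeroing the coordinates in a set. -/
def erase {ι : Type*} (s : ι → Prop) [DecidablePred s] (x : EuclideanSpace ℝ ι) :
    EuclideanSpace ℝ ι :=
  WithLp.toLp 2 fun i => if s i then 0 else x i

omit [Fintype X] [DecidableEq X] in
@[simp] theorem scale_apply (b : X → ℝ) (x : EuclideanSpace ℝ X) (i : X) :
    scale b x i = b i * x i := rfl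

omit [Fintype X] [DecidableEq X] in
@[simp] theorem erase_apply (s : X → Prop) [DecidablePred s] (x : EuclideanSpace ℝ X) (i : X) :
    erase s x i = if s i then 0 else x i := rfl

omit [DecidableEq X] in
theorem norm_scale_le {b : X → ℝ} {c : ℝ} (hb : ∀ i, |b i| ≤ c)
    (x : EuclideanSpace ℝ X) : ‖scale b x‖ ≤ c * ‖x‖ := by
  rcases isEmpty_or_nonempty X with h | ⟨⟨i⟩⟩
  · have : ∀ z : EuclideanSpace ℝ X, ‖z‖ = 0 := fun z => by simp [EuclideanSpace.norm_eq]
    simp [this]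
  have hc : 0 ≤ c := (abs_nonneg _).trans (hb i)
  refine abs_le_of_sq_le_sq' ?_ (by positivity) |>.2
  rw [mul_pow, EuclideanSpace.norm_sq_eq, EuclideanSpace.norm_sq_eq, Finset.mul_sum]
  refine Finset.sum_le_sum fun i _ => ?_
  rw [scale_apply, norm_mul, mul_pow]
  refine mul_le_mul_of_nonneg_right ?_ (sq_nonneg _)
  have := hb i
  rw [Real.norm_eq_abs]
  gcongr

omit [DecidableEq X] in
-- The origin of the factor `δ ^ κ`: what a truncation discards lives at levels at least `κ`.
theorem norm_scale_erase_le {δ : ℝ} (hδ : 0 < δ) (hδ₁ : δ < 1) {α : X → ℕ} {κ : ℕ}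
    (s : X → Prop) [DecidablePred s] (hs : ∀ i, ¬ s i → κ ≤ α i) (x : EuclideanSpace ℝ X) :
    ‖scale (fun i => δ ^ α i) (erase s x)‖ ≤ δ ^ κ * ‖x‖ := by
  have : scale (fun i => δ ^ α i) (erase s x) =
      scale (fun i => if s i then 0 else δ ^ α i) x := by
    ext i
    by_cases h : s i <;> simp [h]
  rw [this]
  refine norm_scale_le (fun i => ?_) x
  split_ifs with h
  · simp; positivity
  · rw [abs_of_nonneg (by positivity)]
    exact pow_le_pow_of_le_one hδ.le hδ₁.le (hs i h)

omit [DecidableEq X] in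
theorem norm_erase_le (s : X → Prop) [DecidablePred s] (x : EuclideanSpace ℝ X) :
    ‖erase s x‖ ≤ ‖x‖ := by
  have : erase s x = scale (fun i => if s i then 0 else 1) x := by
    ext i
    by_cases h : s i <;> simp [h]
  rw [this, ← one_mul ‖x‖]
  refine norm_scale_le (fun i => ?_) x
  split_ifs <;> simp

/-- The matrix couples only indices whose levels differ by at most one. -/
def Banded (M : Matrix X U ℝ) (α : X → ℕ) (β : U → ℕ) : Prop :=
  ∀ p q, M p q ≠ 0 → α p ≤ β q + 1 ∧ β q ≤ α p + 1

omit [Fintype X] [DecidableEq X] [Fintype U] [DecidableEq U] in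
theorem Banded.transpose {M : Matrix X U ℝ} {α : X → ℕ} {β : U → ℕ} (h : Banded M α β) :
    Banded M.transpose β α := fun p q hpq => (h q p hpq).symm

omit [DecidableEq X] in
/-- Exponential weights almost commute with banded matrices. -/
theorem Banded.norm_commutator_le {M : Matrix X U ℝ} {α : X → ℕ} {β : U → ℕ}
    (h : Banded M α β) {L δ η : ℝ} (hδ : 0 < δ) (hδ₁ : δ < 1)
    (hη : 2 * L * (1 - δ) ≤ η * δ) (hM : ‖M‖ ≤ L) (x : EuclideanSpace ℝ U) :
    ‖scale (fun i => δ ^ α i) (actL M x) - actL M (scale (fun i => δ ^ β i) x)‖ ≤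
      η * ‖scale (fun i => δ ^ β i) x‖ := by
  set y := scale (fun i => δ ^ β i) x with hy
  -- Entries between equal levels commute with the weights. The two neighbouring diagonals
  -- contribute the factors `δ - 1` and `δ⁻¹ - 1`, and each is a mask by agreeing labels once one
  -- labelling is shifted, so pinching bounds it by `‖M‖`.
  have hid : scale (fun i => δ ^ α i) (actL M x) - actL M y =
      (δ - 1) • actL (Matrix.of fun p q => if α p = β q + 1 then M p q else 0) y +
      (δ⁻¹ - 1) • actL (Matrix.of fun p q => if α p + 1 = β q then M p q else 0) y := by
    ext p
    simp only [PiLp.sub_apply, PiLp.add_apply, PiLp.smul_apply, scale_apply, actL_apply, hy,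
      Matrix.of_apply,       smul_eq_mul, Finset.mul_sum]
    rw [← Finset.sum_sub_distrib, ← Finset.sum_add_distrib]
    refine Finset.sum_congr rfl fun q _ => ?_
    by_cases h0 : M p q = 0
    · simp [h0]
    obtain ⟨b1, b2⟩ := h p q h0
    rcases (by omega : α p = β q ∨ α p = β q + 1 ∨ α p + 1 = β q) with h1 | h1 | h1
    · rw [if_neg (by omega), if_neg (by omega), h1]; ring
    · rw [if_pos h1, if_neg (by omega), h1]; ring
    · rw [if_neg (by omega), if_pos h1, ← h1]; field_simp; ring
  rw [hid]
  have h1 := norm_mask_apply_le M α (fun q => β q + 1) y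
  have h2 := norm_mask_apply_le M (fun p => α p + 1) β y
  have hinv : 1 < δ⁻¹ := (one_lt_inv₀ hδ).2 hδ₁
  refine (norm_add_le _ _).trans ?_
  rw [norm_smul, norm_smul, Real.norm_of_nonpos (by linarith), Real.norm_of_nonneg (by linarith)]
  have h3 : -(δ - 1) * ‖actL (Matrix.of fun p q => if α p = β q + 1 then M p q else 0) y‖ ≤
      -(δ - 1) * (‖M‖ * ‖y‖) := mul_le_mul_of_nonneg_left h1 (by linarith)
  have h4 : (δ⁻¹ - 1) * ‖actL (Matrix.of fun p q => if α p + 1 = β q then M p q else 0) y‖ ≤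
      (δ⁻¹ - 1) * (‖M‖ * ‖y‖) := mul_le_mul_of_nonneg_left h2 (by linarith)
  -- The factor `2` in `hη` is needed here: `δ⁻¹ - δ = (1 - δ)(1 + δ) / δ` with `1 + δ ≤ 2`.
  have h5 : (δ⁻¹ - δ) * L ≤ η := by
    refine le_of_mul_le_mul_right (a := δ) ?_ hδ
    have e1 : (δ⁻¹ - δ) * L * δ = (1 - δ) * (1 + δ) * L := by field_simp; ring
    have e2 : 0 ≤ L := (norm_nonneg _).trans hM
    have e3 : 0 ≤ (1 - δ) * (1 - δ) * L := by have := sub_pos.2 hδ₁; positivity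
    rw [e1]; linarith
  have h6 : (δ⁻¹ - δ) * (‖M‖ * ‖y‖) ≤ (δ⁻¹ - δ) * (L * ‖y‖) :=
    mul_le_mul_of_nonneg_left (mul_le_mul_of_nonneg_right hM (norm_nonneg _)) (by linarith)
  have h7 := mul_le_mul_of_nonneg_right h5 (norm_nonneg y)
  linarith

omit [DecidableEq X] in
theorem Banded.norm_scale_apply_le {M : Matrix X U ℝ} {α : X → ℕ} {β : U → ℕ}
    (h : Banded M α β) {L δ η : ℝ} (hδ : 0 < δ) (hδ₁ : δ < 1)
    (hη : 2 * L * (1 - δ) ≤ η * δ) (hM : ‖M‖ ≤ L) (x : EuclideanSpace ℝ U) :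
    ‖scale (fun i => δ ^ α i) (actL M x)‖ ≤ (L + η) * ‖scale (fun i => δ ^ β i) x‖ := by
  have h1 := h.norm_commutator_le hδ hδ₁ hη hM x
  have h2 := (actL M).le_opNorm (scale (fun i => δ ^ β i) x)
  rw [norm_actL] at h2
  have h3 := mul_le_mul_of_nonneg_right hM (norm_nonneg (scale (fun i => δ ^ β i) x))
  have h4 := norm_add_le (scale (fun i => δ ^ α i) (actL M x)
    - actL M (scale (fun i => δ ^ β i) x)) (actL M (scale (fun i => δ ^ β i) x))
  rw [sub_add_cancel] at h4
  linarith

end MatrixOperators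

/-! ### Exponential decay in space -/

section SpatialDecay

/-- A vector field on stacked vectors that is strongly monotone and Lipschitz block by block, the
blocks being the fibres of `π`. -/
structure LocalField (μ L : ℝ) {ι V : Type*} [Fintype ι] (π : ι → V)
    (g : EuclideanSpace ℝ ι → EuclideanSpace ℝ ι) : Prop where
  zero : g 0 = 0
  mono : ∀ (b : V → ℝ) (x y), μ * ‖scale (fun i => b (π i)) (x - y)‖ ^ 2 ≤
    inner ℝ (scale (fun i => b (π i)) (g x - g y)) (scale (fun i => b (π i)) (x - y))
  lip : ∀ (b : V → ℝ) (x y), ‖scale (fun i => b (π i)) (g x - g y)‖ ≤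
    L * ‖scale (fun i => b (π i)) (x - y)‖

theorem LocalField.monoLip {μ L : ℝ} {ι V : Type*} [Fintype ι] {π : ι → V}
    {g : EuclideanSpace ℝ ι → EuclideanSpace ℝ ι} (h : LocalField μ L π g) : MonoLip μ L g := by
  have h1 : ∀ x : EuclideanSpace ℝ ι, scale (fun i => (fun _ : V => (1 : ℝ)) (π i)) x = x := by
    intro x; ext i; simp
  refine ⟨h.zero, fun x y => ?_, fun x y => ?_⟩
  · simpa only [h1] using h.mono (fun _ => 1) x y
  · simpa only [h1] using h.lip (fun _ => 1) x y

universe u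
variable {V X U : Type u} [Fintype X] [DecidableEq X] [Fintype U] [DecidableEq U]

/-- Truncation of the rows of the system outside a neighbourhood perturbs the first control
near the centre of the neighbourhood only by exponentially small terms. -/
theorem truncation_sensitivity {L γ μ η C δ : ℝ} (hd : DecayData.{u} L γ μ η C δ) (hη0 : 0 ≤ η)
    {A A' : Matrix X X ℝ} {B B' : Matrix X U ℝ}
    (hAB : StablePair L γ (actL A) (actL B)) (hAB' : StablePair L γ (actL A') (actL B'))
    {πX : X → V} {πU : U → V} {φ : V → ℕ}
    (hbA : Banded A (fun i => φ (πX i)) (fun i => φ (πX i)))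
    (hbB : Banded B (fun i => φ (πX i)) (fun i => φ (πU i)))
    (s : X → Prop) [DecidablePred s] {κ : ℕ} (hs : ∀ i, ¬ s i → κ ≤ φ (πX i))
    (hA' : ∀ i j, A' i j = if s i then A i j else 0)
    (hB' : ∀ i j, B' i j = if s i then B i j else 0)
    {l : ℕ} (hl : 1 ≤ l)
    {gf : ℕ → EuclideanSpace ℝ X → EuclideanSpace ℝ X}
    {gc : ℕ → EuclideanSpace ℝ U → EuclideanSpace ℝ U}
    {gF : EuclideanSpace ℝ X → EuclideanSpace ℝ X}
    (hgf : ∀ τ < l, LocalField μ L πX (gf τ)) (hgc : ∀ τ < l, LocalField μ L πU (gc τ))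
    (hgF : LocalField μ L πX gF)
    {ζ ζ' y y' p p' : ℕ → EuclideanSpace ℝ X} {v v' : ℕ → EuclideanSpace ℝ U}
    (h : IsKKT (actL A) (actL B) l gf gc ζ y v p) (hp : p l = gF (y l))
    (h' : IsKKT (actL A') (actL B') l gf gc ζ' y' v' p') (hp' : p' l = gF (y' l))
    (hζ : ∀ τ < l, ζ τ - ζ' τ = erase s (ζ τ)) (h0 : y 0 - y' 0 = erase s (y 0))
    {D : ℝ} (hD : ∑ τ ∈ Finset.range l, ‖ζ τ‖ ≤ D) :
    ‖scale (fun i => δ ^ φ (πU i)) (v 0 - v' 0)‖ ≤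
      C * (3 + (3 * L ^ 2 + 2 * (L + η) ^ 2) * (4 * C ^ 2)) * δ ^ κ * (‖y 0‖ + D) := by
  have hδ := hd.decay_pos
  have hδ₁ := hd.decay_lt_one
  have hL : 0 < L := by linarith [hd.one_lt]
  have hC := hd.one_le
  have hMA : ‖A‖ ≤ L := (norm_actL A).symm.trans_le hAB.norm_left
  have hMB : ‖B‖ ≤ L := (norm_actL B).symm.trans_le hAB.norm_right
  have hMAt : ‖A.transpose‖ ≤ L := (norm_transpose A).trans_le hMA
  have hMBt : ‖B.transpose‖ ≤ L := (norm_transpose B).trans_le hMB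
  set wX : EuclideanSpace ℝ X → EuclideanSpace ℝ X := scale fun i => δ ^ φ (πX i) with hwX
  set wU : EuclideanSpace ℝ U → EuclideanSpace ℝ U := scale fun i => δ ^ φ (πU i) with hwU
  have wXadd : ∀ a b, wX (a + b) = wX a + wX b := by intro a b; ext i; simp [hwX, mul_add]
  have wUneg : ∀ a, wU (-a) = -wU a := by intro a; ext i; simp [hwU]
  have eadd : ∀ a b : EuclideanSpace ℝ X, erase s (a + b) = erase s a + erase s b := by
    intro a b; ext i; by_cases hi : s i <;> simp [hi]
  have wXe : ∀ a, ‖wX (erase s a)‖ ≤ δ ^ κ * ‖a‖ := fun a => norm_scale_erase_le hδ hδ₁ s hs a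
  have eA : ∀ x, actL A' x = actL A x - erase s (actL A x) := by
    intro x; ext i; by_cases hi : s i <;> simp [hi, actL_apply, hA']
  have eB : ∀ x, actL B' x = actL B x - erase s (actL B x) := by
    intro x; ext i; by_cases hi : s i <;> simp [hi, actL_apply, hB']
  -- Deleting rows of a matrix deletes coordinates of the argument of its transpose.
  have eAt : ∀ x, actL A'.transpose x = actL A.transpose x - actL A.transpose (erase s x) := by
    intro x; rw [← map_sub]; ext i
    simp only [actL_apply, Matrix.transpose_apply, hA']
    refine Finset.sum_congr rfl fun j _ => ?_
    by_cases hj : s j <;> simp [hj]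
  have eBt : ∀ x, actL B'.transpose x = actL B.transpose x - actL B.transpose (erase s x) := by
    intro x; rw [← map_sub]; ext i
    simp only [actL_apply, Matrix.transpose_apply, hB']
    refine Finset.sum_congr rfl fun j _ => ?_
    by_cases hj : s j <;> simp [hj]
  have nA : ∀ x, ‖actL A x‖ ≤ L * ‖x‖ := fun x => ((actL A).le_opNorm x).trans
    (mul_le_mul_of_nonneg_right hAB.norm_left (norm_nonneg _))
  have nB : ∀ x, ‖actL B x‖ ≤ L * ‖x‖ := fun x => ((actL B).le_opNorm x).trans
    (mul_le_mul_of_nonneg_right hAB.norm_right (norm_nonneg _))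
  have hδκ : 0 < δ ^ κ := pow_pos hδ κ
  -- The truncated solution is read as a solution for the untruncated pair with residuals supported
  -- off the neighbourhood, whence `δ ^ κ`. For the multipliers a further application of the
  -- transposed matrix costs `L + η`. At the final time both solutions use the same `gF`, so `S l =
  -- 0`.
  set R : ℕ → ℝ := fun τ => δ ^ κ * (L * ‖y' τ‖ + L * ‖v' τ‖ + ‖ζ τ‖) with hR
  set S : ℕ → ℝ := fun τ => if τ < l then (L + η) * (δ ^ κ * ‖p' (τ + 1)‖) else 0 with hS
  set Q : ℕ → ℝ := fun τ => (L + η) * (δ ^ κ * ‖p' (τ + 1)‖) with hQ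
  have hLη : 0 ≤ L + η := by linarith
  have key := hd.estimate _ _ (actL A) (actL B) hAB l (fun τ => wX (y τ - y' τ))
    (fun τ => wU (v τ - v' τ)) (fun τ => wX (p τ - p' τ))
    (fun τ => wX (if τ < l then gf τ (y τ) - gf τ (y' τ) else gF (y τ) - gF (y' τ)))
    (fun τ => wU (gc τ (v τ) - gc τ (v' τ))) R S Q
    { dyn := by
        intro τ hτ
        have hid : y (τ + 1) - y' (τ + 1) = actL A (y τ - y' τ) + actL B (v τ - v' τ)
            + erase s (actL A (y' τ) + actL B (v' τ) + ζ τ) := by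
          rw [h.dyn τ hτ, h'.dyn τ hτ, eA, eB, eadd, eadd, ← hζ τ hτ, map_sub, map_sub]
          abel
        have hid2 : wX (y (τ + 1) - y' (τ + 1)) - actL A (wX (y τ - y' τ))
            - actL B (wU (v τ - v' τ)) = (wX (actL A (y τ - y' τ)) - actL A (wX (y τ - y' τ)))
            + (wX (actL B (v τ - v' τ)) - actL B (wU (v τ - v' τ)))
            + wX (erase s (actL A (y' τ) + actL B (v' τ) + ζ τ)) := by
          rw [hid, wXadd, wXadd]; abel
        rw [hid2]
        have c1 := hbA.norm_commutator_le hδ hδ₁ hd.small hMA (y τ - y' τ)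
        have c2 := hbB.norm_commutator_le hδ hδ₁ hd.small hMB (v τ - v' τ)
        have c3 := wXe (actL A (y' τ) + actL B (v' τ) + ζ τ)
        have c4 : ‖actL A (y' τ) + actL B (v' τ) + ζ τ‖ ≤ L * ‖y' τ‖ + L * ‖v' τ‖ + ‖ζ τ‖ :=
          norm_add₃_le.trans (add_le_add_left (add_le_add (nA _) (nB _)) _)
        have c5 := mul_le_mul_of_nonneg_left c4 hδκ.le
        refine norm_add₃_le.trans ?_
        rw [mul_add η]
        exact add_le_add (add_le_add c1 c2) (c3.trans c5)
      adj := by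
        intro τ hτ
        have hid : p τ - p' τ = actL A.transpose (p (τ + 1) - p' (τ + 1))
            + (gf τ (y τ) - gf τ (y' τ)) + actL A.transpose (erase s (p' (τ + 1))) := by
          rw [h.adj τ hτ, h'.adj τ hτ, adjoint_actL, adjoint_actL, eAt, map_sub]
          abel
        have hid2 : wX (p τ - p' τ) - (actL A).adjoint (wX (p (τ + 1) - p' (τ + 1)))
            - wX (gf τ (y τ) - gf τ (y' τ))
            = (wX (actL A.transpose (p (τ + 1) - p' (τ + 1)))
              - actL A.transpose (wX (p (τ + 1) - p' (τ + 1))))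
            + wX (actL A.transpose (erase s (p' (τ + 1)))) := by
          rw [hid, wXadd, wXadd, adjoint_actL]; abel
        simp only [hS, if_pos hτ]
        rw [hid2]
        have c1 := hbA.transpose.norm_commutator_le hδ hδ₁ hd.small hMAt (p (τ + 1) - p' (τ + 1))
        have c2 := hbA.transpose.norm_scale_apply_le hδ hδ₁ hd.small hMAt (erase s (p' (τ + 1)))
        have c3 := mul_le_mul_of_nonneg_left (wXe (p' (τ + 1))) hLη
        exact (norm_add_le _ _).trans (add_le_add c1 (c2.trans c3))
      final := by simp [hS, hp, hp']
      stat := by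
        intro τ hτ
        have hid : gc τ (v τ) - gc τ (v' τ) = -(actL B.transpose (p (τ + 1) - p' (τ + 1))
            + actL B.transpose (erase s (p' (τ + 1)))) := by
          rw [eq_neg_of_add_eq_zero_left (h.stat τ hτ), eq_neg_of_add_eq_zero_left (h'.stat τ hτ),
            adjoint_actL, adjoint_actL, eBt, map_sub]
          abel
        have hid2 : wU (gc τ (v τ) - gc τ (v' τ)) + (actL B).adjoint (wX (p (τ + 1) - p' (τ + 1)))
            = -((wU (actL B.transpose (p (τ + 1) - p' (τ + 1)))
              - actL B.transpose (wX (p (τ + 1) - p' (τ + 1))))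
            + wU (actL B.transpose (erase s (p' (τ + 1))))) := by
          rw [hid, wUneg, adjoint_actL]
          have : ∀ a b, wU (a + b) = wU a + wU b := by intro a b; ext i; simp [hwU, mul_add]
          rw [this]; abel
        rw [hid2, norm_neg]
        have c1 := hbB.transpose.norm_commutator_le hδ hδ₁ hd.small hMBt (p (τ + 1) - p' (τ + 1))
        have c2 := hbB.transpose.norm_scale_apply_le hδ hδ₁ hd.small hMBt (erase s (p' (τ + 1)))
        have c3 := mul_le_mul_of_nonneg_left (wXe (p' (τ + 1))) hLη
        exact (norm_add_le _ _).trans (add_le_add c1 (c2.trans c3))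
      mono_state := by
        intro τ hτ
        by_cases h0 : τ < l
        · simp only [if_pos h0]
          exact (hgf τ h0).mono (fun i => δ ^ φ i) _ _
        · simp only [if_neg h0]
          exact hgF.mono (fun i => δ ^ φ i) _ _
      lip_state := by
        intro τ hτ
        by_cases h0 : τ < l
        · simp only [if_pos h0]
          exact (hgf τ h0).lip (fun i => δ ^ φ i) _ _
        · simp only [if_neg h0]
          exact hgF.lip (fun i => δ ^ φ i) _ _
      mono_control := fun τ hτ => (hgc τ hτ).mono (fun i => δ ^ φ i) _ _
      lip_control := fun τ hτ => (hgc τ hτ).lip (fun i => δ ^ φ i) _ _ }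
  -- The residuals involve only the truncated solution, whose size is controlled by stabilizability
  -- of the truncated pair.
  have hsize := IsKKT.size_le hd hAB' (fun τ hτ => (hgf τ hτ).monoLip)
    (fun τ hτ => (hgc τ hτ).monoLip) h' hgF.monoLip hp'
  have hD0 : 0 ≤ D := (Finset.sum_nonneg fun _ _ => norm_nonneg _).trans hD
  have hζsq : ∑ τ ∈ Finset.range l, ‖ζ τ‖ ^ 2 ≤ D ^ 2 :=
    (sum_sq_le_sq_sum_of_nonneg _ _ fun _ _ => norm_nonneg _).trans
      (pow_le_pow_left₀ (Finset.sum_nonneg fun _ _ => norm_nonneg _) hD 2)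
  have two : ∀ a : EuclideanSpace ℝ X, ‖a - erase s a‖ ^ 2 ≤ 4 * ‖a‖ ^ 2 := by
    intro a
    have h1 := norm_sub_le a (erase s a)
    have h2 := norm_erase_le s a
    have h3 : ‖a - erase s a‖ ≤ 2 * ‖a‖ := by linarith
    calc _ ≤ (2 * ‖a‖) ^ 2 := by gcongr
      _ = _ := by ring
  have hζ'sq : ∑ τ ∈ Finset.range l, ‖ζ' τ‖ ^ 2 ≤ 4 * D ^ 2 := by
    refine le_trans ?_ (mul_le_mul_of_nonneg_left hζsq (by norm_num : (0 : ℝ) ≤ 4))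
    rw [Finset.mul_sum]
    refine Finset.sum_le_sum fun τ hτ => ?_
    have : ζ' τ = ζ τ - erase s (ζ τ) := by rw [← hζ τ (Finset.mem_range.1 hτ)]; abel
    rw [this]; exact two _
  have hy'0 : ‖y' 0‖ ^ 2 ≤ 4 * ‖y 0‖ ^ 2 := by
    have : y' 0 = y 0 - erase s (y 0) := by rw [← h0]; abel
    rw [this]; exact two _
  have hsize2 : ∑ τ ∈ Finset.range (l + 1), ‖y' τ‖ ^ 2 + ∑ τ ∈ Finset.range l, ‖v' τ‖ ^ 2
      + ∑ τ ∈ Finset.range (l + 1), ‖p' τ‖ ^ 2 ≤ 4 * C ^ 2 * (‖y 0‖ ^ 2 + D ^ 2) := by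
    refine hsize.trans ?_
    have := mul_le_mul_of_nonneg_left (add_le_add hy'0 hζ'sq) (sq_nonneg C)
    linarith
  have hsum0 : ∑ τ ∈ Finset.range l, ‖y' τ‖ ^ 2 ≤ ∑ τ ∈ Finset.range (l + 1), ‖y' τ‖ ^ 2 := by
    rw [Finset.sum_range_succ]; linarith [sq_nonneg ‖y' l‖]
  have hsum1 : ∑ τ ∈ Finset.range l, ‖p' (τ + 1)‖ ^ 2 ≤
      ∑ τ ∈ Finset.range (l + 1), ‖p' τ‖ ^ 2 := by
    rw [Finset.sum_range_succ' (fun τ => ‖p' τ‖ ^ 2)]; linarith [sq_nonneg ‖p' 0‖]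
  have hresid : residualSq l (fun τ => wX (y τ - y' τ)) R S Q ≤
      (δ ^ κ) ^ 2 * ((3 + (3 * L ^ 2 + 2 * (L + η) ^ 2) * (4 * C ^ 2)) * (‖y 0‖ ^ 2 + D ^ 2)) := by
    have r0 : ‖wX (y 0 - y' 0)‖ ^ 2 ≤ (δ ^ κ) ^ 2 * ‖y 0‖ ^ 2 := by
      rw [h0, ← mul_pow]
      have := wXe (y 0)
      gcongr
    have rR : ∑ τ ∈ Finset.range l, R τ ^ 2 ≤ (δ ^ κ) ^ 2 * (3 * L ^ 2 *
        ∑ τ ∈ Finset.range l, ‖y' τ‖ ^ 2 + 3 * L ^ 2 * ∑ τ ∈ Finset.range l, ‖v' τ‖ ^ 2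
        + 3 * ∑ τ ∈ Finset.range l, ‖ζ τ‖ ^ 2) := by
      simp only [Finset.mul_sum, ← Finset.sum_add_distrib]
      refine Finset.sum_le_sum fun τ _ => ?_
      simp only [hR, mul_pow]
      refine mul_le_mul_of_nonneg_left ?_ (sq_nonneg _)
      linarith [sq_nonneg (L * ‖y' τ‖ - L * ‖v' τ‖), sq_nonneg (L * ‖y' τ‖ - ‖ζ τ‖),
        sq_nonneg (L * ‖v' τ‖ - ‖ζ τ‖)]
    have rQ : ∑ τ ∈ Finset.range l, Q τ ^ 2 = (δ ^ κ) ^ 2 * ((L + η) ^ 2 *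
        ∑ τ ∈ Finset.range l, ‖p' (τ + 1)‖ ^ 2) := by
      simp only [Finset.mul_sum, hQ]
      exact Finset.sum_congr rfl fun τ _ => by ring
    have rS : ∑ τ ∈ Finset.range (l + 1), S τ ^ 2 = (δ ^ κ) ^ 2 * ((L + η) ^ 2 *
        ∑ τ ∈ Finset.range l, ‖p' (τ + 1)‖ ^ 2) := by
      rw [← rQ, Finset.sum_range_succ]
      have : S l = 0 := by simp [hS]
      rw [this]
      simp only [ne_eq, OfNat.ofNat_ne_zero, not_false_eq_true, zero_pow, add_zero]
      refine Finset.sum_congr rfl fun τ hτ => ?_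
      simp only [hS, hQ, if_pos (Finset.mem_range.1 hτ)]
    simp only [residualSq, Finset.sum_add_distrib]
    rw [rQ, rS]
    have hv0 : 0 ≤ ∑ τ ∈ Finset.range l, ‖v' τ‖ ^ 2 := Finset.sum_nonneg fun _ _ => sq_nonneg _
    have hy0 : 0 ≤ ∑ τ ∈ Finset.range l, ‖y' τ‖ ^ 2 := Finset.sum_nonneg fun _ _ => sq_nonneg _
    have hp0 : 0 ≤ ∑ τ ∈ Finset.range l, ‖p' (τ + 1)‖ ^ 2 :=
      Finset.sum_nonneg fun _ _ => sq_nonneg _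
    have m1 : 3 * L ^ 2 * (∑ τ ∈ Finset.range l, ‖y' τ‖ ^ 2 + ∑ τ ∈ Finset.range l, ‖v' τ‖ ^ 2)
        ≤ 3 * L ^ 2 * (4 * C ^ 2 * (‖y 0‖ ^ 2 + D ^ 2)) :=
      mul_le_mul_of_nonneg_left (by linarith) (by positivity)
    have m2 : 2 * (L + η) ^ 2 * ∑ τ ∈ Finset.range l, ‖p' (τ + 1)‖ ^ 2
        ≤ 2 * (L + η) ^ 2 * (4 * C ^ 2 * (‖y 0‖ ^ 2 + D ^ 2)) :=
      mul_le_mul_of_nonneg_left (by linarith) (by positivity)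
    have m3 : ‖y 0‖ ^ 2 + (3 * L ^ 2 * ∑ τ ∈ Finset.range l, ‖y' τ‖ ^ 2
        + 3 * L ^ 2 * ∑ τ ∈ Finset.range l, ‖v' τ‖ ^ 2 + 3 * ∑ τ ∈ Finset.range l, ‖ζ τ‖ ^ 2)
        + (L + η) ^ 2 * ∑ τ ∈ Finset.range l, ‖p' (τ + 1)‖ ^ 2
        + (L + η) ^ 2 * ∑ τ ∈ Finset.range l, ‖p' (τ + 1)‖ ^ 2 ≤
        (3 + (3 * L ^ 2 + 2 * (L + η) ^ 2) * (4 * C ^ 2)) * (‖y 0‖ ^ 2 + D ^ 2) := by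
      linarith [sq_nonneg ‖y 0‖]
    have m4 := mul_le_mul_of_nonneg_left m3 (sq_nonneg (δ ^ κ))
    linarith
  set c := 3 + (3 * L ^ 2 + 2 * (L + η) ^ 2) * (4 * C ^ 2) with hc
  have hc1 : 1 ≤ c := by
    have : 0 ≤ (3 * L ^ 2 + 2 * (L + η) ^ 2) * (4 * C ^ 2) := by positivity
    linarith
  have hv : ‖wU (v 0 - v' 0)‖ ^ 2 ≤ C ^ 2 * residualSq l (fun τ => wX (y τ - y' τ)) R S Q := by
    have e1 : 0 ≤ ∑ τ ∈ Finset.range (l + 1), ‖wX (y τ - y' τ)‖ ^ 2 :=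
      Finset.sum_nonneg fun _ _ => sq_nonneg _
    have e2 : 0 ≤ ∑ τ ∈ Finset.range (l + 1), ‖wX (p τ - p' τ)‖ ^ 2 :=
      Finset.sum_nonneg fun _ _ => sq_nonneg _
    have e3 := Finset.single_le_sum (f := fun j => ‖wU (v j - v' j)‖ ^ 2)
      (fun _ _ => sq_nonneg _) (Finset.mem_range.2 hl)
    simp only [primalSq] at key
    linarith
  refine abs_le_of_sq_le_sq' ?_ (by positivity) |>.2
  refine hv.trans ((mul_le_mul_of_nonneg_left hresid (sq_nonneg C)).trans ?_)
  -- Using `c ≤ c ^ 2`, valid as `1 ≤ c`, avoids a square root in the final constant.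
  have e1 : c * (‖y 0‖ ^ 2 + D ^ 2) ≤ c ^ 2 * (‖y 0‖ + D) ^ 2 := by
    refine mul_le_mul (by nlinarith) ?_ (by positivity) (by positivity)
    have : 0 ≤ ‖y 0‖ * D := by positivity
    linarith [add_sq ‖y 0‖ D]
  have e2 := mul_le_mul_of_nonneg_left e1 (mul_nonneg (sq_nonneg C) (sq_nonneg (δ ^ κ)))
  refine le_trans (le_of_eq ?_) (e2.trans (le_of_eq ?_)) <;> ring

end SpatialDecay

/-! ### Gradients of strongly convex functions -/

section Gradients

variable {E : Type*} [NormedAddCommGroup E] [InnerProductSpace ℝ E] [CompleteSpace E]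

theorem hasDerivAt_comp_line {g : E → ℝ} (hg : Differentiable ℝ g) (x u : E) (t : ℝ) :
    HasDerivAt (fun s : ℝ => g (x + s • u)) (inner ℝ (gradient g (x + t • u)) u) t := by
  have h1 : HasDerivAt (fun s : ℝ => x + s • u) u t := by
    simpa using ((hasDerivAt_id t).smul_const u).const_add x
  have h2 := (hg (x + t • u)).hasFDerivAt.comp_hasDerivAt t h1
  rwa [← inner_gradient_left] at h2

theorem gradient_eq_zero_of_isMin {g : E → ℝ} {x : E} (h : ∀ y, g x ≤ g y) :
    gradient g x = 0 := by
  have : IsLocalMin g x := Filter.Eventually.of_forall h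
  rw [gradient, this.fderiv_eq_zero, map_zero]

/-- On the segment from `y` to `x`, the convex function `g - μ/2 ‖·‖²` has a monotone derivative;
compare its endpoints. -/
theorem gradient_mono_of_strongConvexOn {g : E → ℝ} {μ : ℝ} (hg : StrongConvexOn Set.univ μ g)
    (hd : Differentiable ℝ g) (x y : E) :
    μ * ‖x - y‖ ^ 2 ≤ inner ℝ (gradient g x - gradient g y) (x - y) := by
  have h1 := (strongConvexOn_iff_convex.1 hg).comp_affineMap (AffineMap.lineMap y x)
  have hfun : (fun x => g x - μ / 2 * ‖x‖ ^ 2) ∘ (AffineMap.lineMap y x : ℝ →ᵃ[ℝ] E) =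
      fun s : ℝ => g (y + s • (x - y)) - μ / 2 * ‖y + s • (x - y)‖ ^ 2 := by
    funext s
    simp [AffineMap.lineMap_apply, add_comm]
  rw [hfun, Set.preimage_univ] at h1
  have hder : ∀ t : ℝ, HasDerivAt
      (fun s : ℝ => g (y + s • (x - y)) - μ / 2 * ‖y + s • (x - y)‖ ^ 2)
      (inner ℝ (gradient g (y + t • (x - y))) (x - y)
        - μ / 2 * (2 * inner ℝ (y + t • (x - y)) (x - y))) t := by
    intro t
    have h2 : HasDerivAt (fun s : ℝ => y + s • (x - y)) (x - y) t := by
      simpa using ((hasDerivAt_id t).smul_const (x - y)).const_add y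
    exact (hasDerivAt_comp_line hd y (x - y) t).sub (h2.norm_sq.const_mul _)
  have h3 := h1.monotoneOn_deriv (fun t _ => (hder t).differentiableAt)
    (Set.mem_univ (0 : ℝ)) (Set.mem_univ (1 : ℝ)) zero_le_one
  rw [(hder 0).deriv, (hder 1).deriv] at h3
  simp only [zero_smul, add_zero, one_smul, add_sub_cancel] at h3
  rw [inner_sub_left]
  have h4 : ‖x - y‖ ^ 2 = inner ℝ x (x - y) - inner ℝ y (x - y) := by
    rw [← inner_sub_left, real_inner_self_eq_norm_sq]
  rw [h4]
  linarith

omit [CompleteSpace E] in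
-- Strong convexity at the midpoint of `x` and `0` suffices for coercivity and needs no derivative;
-- hence `μ / 4` instead of `μ / 2`.
theorem quadratic_le_of_strongConvexOn {g : E → ℝ} {μ : ℝ}
    (hg : StrongConvexOn Set.univ μ g) (h0 : g 0 = 0) (hnn : ∀ x, 0 ≤ g x) (x : E) :
    μ / 4 * ‖x‖ ^ 2 ≤ g x := by
  obtain ⟨-, hg⟩ := hg
  have h1 := hg (Set.mem_univ x) (Set.mem_univ (0 : E)) (a := 1 / 2) (b := 1 / 2)
    (by norm_num) (by norm_num) (by norm_num)
  have h2 := hnn ((1 / 2 : ℝ) • x + (1 / 2 : ℝ) • (0 : E))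
  simp only [h0, sub_zero, smul_eq_mul, mul_zero, add_zero] at h1 h2
  linarith

end Gradients

/-! ### Gradients of the costs: radial and decentralized -/

section CostFields

variable {X : Type*} [Fintype X] [DecidableEq X]

omit [DecidableEq X] in
theorem WellConditioned.differentiable {μ L : ℝ} {g : EuclideanSpace ℝ X → ℝ}
    (h : WellConditioned μ L g) : Differentiable ℝ g := h.contDiff.differentiable (by norm_num)

omit [DecidableEq X] in
theorem WellConditioned.monoLip {μ L : ℝ} {g : EuclideanSpace ℝ X → ℝ}
    (h : WellConditioned μ L g) (h0 : g 0 = 0) (hnn : ∀ x, 0 ≤ g x) :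
    MonoLip μ L (gradient g) where
  zero := gradient_eq_zero_of_isMin fun y => h0 ▸ hnn y
  mono := gradient_mono_of_strongConvexOn h.strongConvex h.differentiable
  lip := h.smooth

omit [DecidableEq X] in
theorem WellConditioned.le {μ L : ℝ} {g : EuclideanSpace ℝ X → ℝ} [Nonempty X]
    (h : WellConditioned μ L g) : μ ≤ L := by
  obtain ⟨x, hx⟩ := exists_ne (0 : EuclideanSpace ℝ X)
  have h1 := gradient_mono_of_strongConvexOn h.strongConvex h.differentiable x 0
  have h2 := h.smooth x 0
  have h3 := real_inner_le_norm (gradient g x - gradient g 0) (x - 0)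
  rw [sub_zero] at h1 h2 h3
  have h4 := mul_le_mul_of_nonneg_right h2 (norm_nonneg x)
  have h5 : 0 < ‖x‖ ^ 2 := by have := norm_pos_iff.2 hx; positivity
  refine le_of_mul_le_mul_right (a := ‖x‖ ^ 2) ?_ h5
  linarith

omit [DecidableEq X] in
theorem IsKFunction.nonneg {F : EuclideanSpace ℝ X → ℝ} (h : IsKFunction F) (x) : 0 ≤ F x := by
  obtain ⟨β, hβ, h0, hF⟩ := h
  rw [hF, ← h0]
  exact hβ.monotoneOn Set.self_mem_Ici (norm_nonneg x) (norm_nonneg x)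

omit [DecidableEq X] in
theorem IsKFunction.zero {F : EuclideanSpace ℝ X → ℝ} (h : IsKFunction F) : F 0 = 0 := by
  obtain ⟨β, hβ, h0, hF⟩ := h
  rw [hF, norm_zero, h0]

omit [DecidableEq X] in
/-- The gradient of a radial function is radial. -/
theorem IsKFunction.exists_gradient_eq_smul {μ L : ℝ} (hμL : μ ≤ L)
    {F : EuclideanSpace ℝ X → ℝ} (h : IsKFunction F) (hw : WellConditioned μ L F)
    (x : EuclideanSpace ℝ X) :
    ∃ θ : ℝ, μ ≤ θ ∧ θ ≤ L ∧ gradient F x = θ • x := by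
  have hm := hw.monoLip h.zero h.nonneg
  rcases eq_or_ne x 0 with rfl | hx
  · exact ⟨μ, le_rfl, hμL, by rw [hm.zero, smul_zero]⟩
  have hxn : 0 < ‖x‖ := norm_pos_iff.2 hx
  have hxx : 0 < (inner ℝ x x : ℝ) := by rw [real_inner_self_eq_norm_sq]; positivity
  -- Along a line through `x` orthogonal to `x` the norm is smallest at `x`, hence so is `F`.
  -- Monotonicity of `β` is enough; no derivative of `β` is taken.
  have horth : ∀ u, inner ℝ x u = 0 → inner ℝ (gradient F x) u = 0 := by
    intro u hu
    have hd := hasDerivAt_comp_line hw.differentiable x u 0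
    have hmin : IsLocalMin (fun s : ℝ => F (x + s • u)) 0 := by
      refine Filter.Eventually.of_forall fun s => ?_
      obtain ⟨β, hβ, h0, hF⟩ := h
      simp only [zero_smul, add_zero, hF]
      refine hβ.monotoneOn (norm_nonneg x) (norm_nonneg (x + s • u)) ?_
      refine abs_le_of_sq_le_sq' ?_ (norm_nonneg _) |>.2
      rw [norm_add_sq_real, real_inner_smul_right, hu]
      nlinarith [sq_nonneg ‖s • u‖]
    simpa using hmin.hasDerivAt_eq_zero hd
  set G := gradient F x with hG
  set θ := (inner ℝ x G : ℝ) / inner ℝ x x with hθ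
  have hGx : G = θ • x := by
    have h1 : (inner ℝ x (G - θ • x) : ℝ) = 0 := by
      rw [inner_sub_right, real_inner_smul_right, hθ]; field_simp; simp
    have h2 := horth _ h1
    have h3 : (inner ℝ (G - θ • x) (G - θ • x) : ℝ) = 0 := by
      rw [inner_sub_left (G), real_inner_smul_left, h1, h2]; simp
    rwa [inner_self_eq_zero, sub_eq_zero] at h3
  have h1 := hm.mono x 0
  have h2 := hm.lip x 0
  rw [hm.zero, sub_zero, sub_zero, ← hG, hGx] at h1 h2
  rw [real_inner_smul_left, real_inner_self_eq_norm_sq] at h1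
  rw [norm_smul] at h2
  refine ⟨θ, le_of_mul_le_mul_right h1 (by positivity), ?_, hGx⟩
  exact (le_abs_self θ).trans (le_of_mul_le_mul_right h2 hxn)

omit [DecidableEq X] in
-- A radial gradient mixes blocks through `‖x‖`, whereas a fixed multiple of the identity does not.
-- These fields therefore replace `∇F` in the spatial argument.
theorem localField_smul {μ L θ : ℝ} (hμ : 0 < μ) (h₁ : μ ≤ θ) (h₂ : θ ≤ L) {V : Type*}
    (π : X → V) : LocalField μ L π (fun x : EuclideanSpace ℝ X => θ • x) := by
  have h : ∀ (b : V → ℝ) (x y : EuclideanSpace ℝ X),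
      scale (fun i => b (π i)) (θ • x - θ • y) = θ • scale (fun i => b (π i)) (x - y) := by
    intro b x y; ext i; simp; ring
  refine ⟨smul_zero _, fun b x y => ?_, fun b x y => ?_⟩
  · rw [h, real_inner_smul_left, real_inner_self_eq_norm_sq]
    exact mul_le_mul_of_nonneg_right h₁ (sq_nonneg _)
  · rw [h, norm_smul, Real.norm_of_nonneg (by linarith)]
    exact mul_le_mul_of_nonneg_right h₂ (norm_nonneg _)

/-- The part of a stacked vector living on the fibre of `π` over `i`. -/
def onFibre {V : Type*} [DecidableEq V] (π : X → V) (i : V) (x : EuclideanSpace ℝ X) :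
    EuclideanSpace ℝ X :=
  scale (fun p => if π p = i then 1 else 0) x

omit [DecidableEq X] in
theorem inner_scale_eq_sum {V : Type*} [Fintype V] [DecidableEq V] (π : X → V) (b : V → ℝ)
    (x y : EuclideanSpace ℝ X) :
    inner ℝ (scale (fun p => b (π p)) x) (scale (fun p => b (π p)) y) =
      ∑ i, b i ^ 2 * inner ℝ (onFibre π i x) (onFibre π i y) := by
  simp only [PiLp.inner_apply, scale_apply, RCLike.inner_apply, conj_trivial, onFibre,
    Finset.mul_sum]
  rw [Finset.sum_comm]
  refine Finset.sum_congr rfl fun p _ => ?_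
  rw [Finset.sum_eq_single (π p)]
  · simp; ring
  · intro i _ hi
    simp [Ne.symm hi]
  · simp

omit [DecidableEq X] in
theorem norm_scale_sq_eq_sum {V : Type*} [Fintype V] [DecidableEq V] (π : X → V) (b : V → ℝ)
    (x : EuclideanSpace ℝ X) :
    ‖scale (fun p => b (π p)) x‖ ^ 2 = ∑ i, b i ^ 2 * ‖onFibre π i x‖ ^ 2 := by
  rw [← real_inner_self_eq_norm_sq, inner_scale_eq_sum]
  simp only [real_inner_self_eq_norm_sq]

omit [DecidableEq X] in
theorem localField_of_fibrewise {V : Type*} [Fintype V] [DecidableEq V] {π : X → V} {μ L : ℝ}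
    (hL : 0 ≤ L) {g : EuclideanSpace ℝ X → EuclideanSpace ℝ X} (h0 : g 0 = 0)
    (hmono : ∀ i x y, μ * ‖onFibre π i (x - y)‖ ^ 2 ≤
      inner ℝ (onFibre π i (g x - g y)) (onFibre π i (x - y)))
    (hlip : ∀ i x y, ‖onFibre π i (g x - g y)‖ ≤ L * ‖onFibre π i (x - y)‖) :
    LocalField μ L π g := by
  refine ⟨h0, fun b x y => ?_, fun b x y => ?_⟩
  · rw [norm_scale_sq_eq_sum, inner_scale_eq_sum, Finset.mul_sum]
    refine Finset.sum_le_sum fun i _ => ?_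
    have := mul_le_mul_of_nonneg_left (hmono i x y) (sq_nonneg (b i))
    linarith
  · refine abs_le_of_sq_le_sq' ?_ (by positivity) |>.2
    rw [mul_pow, norm_scale_sq_eq_sum, norm_scale_sq_eq_sum, Finset.mul_sum]
    refine Finset.sum_le_sum fun i _ => ?_
    have h1 : ‖onFibre π i (g x - g y)‖ ^ 2 ≤ (L * ‖onFibre π i (x - y)‖) ^ 2 := by
      have := hlip i x y
      gcongr
    have := mul_le_mul_of_nonneg_left h1 (sq_nonneg (b i))
    linarith

variable {V : Type*} [Fintype V] [DecidableEq V] {n : V → ℕ}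

theorem inner_onFibre_left (i : V) (x y : Stacked n) :
    (inner ℝ (onFibre Sigma.fst i x) (onFibre Sigma.fst i y) : ℝ)
      = inner ℝ x (onFibre Sigma.fst i y) := by
  simp only [PiLp.inner_apply, RCLike.inner_apply, conj_trivial, onFibre, scale_apply]
  refine Finset.sum_congr rfl fun p _ => ?_
  split_ifs <;> simp

/-- The block of the gradient of a decentralized cost depends only on the block of the state. -/
theorem inner_gradient_aggregate_congr {f : (i : V) → EuclideanSpace ℝ (Fin (n i)) → ℝ}
    (hd : Differentiable ℝ (aggregate f)) (i : V) {x x' : Stacked n}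
    (hx : block x i = block x' i) (u : Stacked n) :
    (inner ℝ (gradient (aggregate f) x) (onFibre Sigma.fst i u) : ℝ) =
      inner ℝ (gradient (aggregate f) x') (onFibre Sigma.fst i u) := by
  set e := onFibre Sigma.fst i u with he
  have h1 := hasDerivAt_comp_line hd x e 0
  have h2 := hasDerivAt_comp_line hd x' e 0
  simp only [zero_smul, add_zero] at h1 h2
  have hother : ∀ (z : Stacked n) (s : ℝ) (j : V), j ≠ i → block (z + s • e) j = block z j := by
    intro z s j hj
    ext a
    simp [block, he, onFibre, hj]
  have hsame : ∀ s : ℝ, block (x + s • e) i = block (x' + s • e) i := by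
    intro s
    ext a
    have := congrArg (fun w => w a) hx
    simp only [block] at this
    simp [block, this]
  -- Along a direction supported on block `i` the two restrictions differ by a constant, so their
  -- derivatives agree. Only the sum of the node costs has to be differentiable.
  have hfun : (fun s : ℝ => aggregate f (x + s • e)) =
      fun s : ℝ => aggregate f (x' + s • e) + (aggregate f x - aggregate f x') := by
    funext s
    simp only [aggregate]
    rw [← Finset.sum_sub_distrib, ← Finset.sum_add_distrib]
    refine Finset.sum_congr rfl fun j _ => ?_
    by_cases hj : j = i
    · subst hj; rw [hsame, hx]; ring
    · rw [hother x s j hj, hother x' s j hj]; ring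
  rw [hfun] at h1
  exact h1.unique (h2.add_const _)

/-- Let `z` be `y` with block `i` replaced by that of `x`. Block `i` of the gradient does not
distinguish `x` from `z`, and `z - y` is supported on that block, so the global inequalities at `(z,
y)` are the blockwise ones at `(x, y)`. -/
theorem localField_gradient_aggregate {μ L : ℝ} (hL : 0 ≤ L)
    {f : (i : V) → EuclideanSpace ℝ (Fin (n i)) → ℝ} (h : WellConditioned μ L (aggregate f))
    (h0 : aggregate f 0 = 0) (hnn : ∀ x, 0 ≤ aggregate f x) :
    LocalField μ L Sigma.fst (gradient (aggregate f)) := by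
  have hm := h.monoLip h0 hnn
  set G := gradient (aggregate f) with hG
  have key : ∀ (i : V) (x y : Stacked n), ∃ z : Stacked n, z - y = onFibre Sigma.fst i (x - y) ∧
      ∀ u, (inner ℝ (G x - G y) (onFibre Sigma.fst i u) : ℝ) =
        inner ℝ (G z - G y) (onFibre Sigma.fst i u) := by
    intro i x y
    refine ⟨y + onFibre Sigma.fst i (x - y), by abel, fun u => ?_⟩
    rw [inner_sub_left, inner_sub_left]
    congr 1
    refine inner_gradient_aggregate_congr h.differentiable i ?_ u
    ext a
    simp [block, onFibre]
  refine localField_of_fibrewise hL hm.zero (fun i x y => ?_) (fun i x y => ?_)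
  · obtain ⟨z, hz, hin⟩ := key i x y
    rw [inner_onFibre_left, hin, ← hz]
    exact hm.mono z y
  · obtain ⟨z, hz, hin⟩ := key i x y
    rw [← hz]
    refine le_trans ?_ (hm.lip z y)
    set a := onFibre Sigma.fst i (G x - G y) with ha
    have h1 : ‖a‖ ^ 2 ≤ ‖G z - G y‖ * ‖a‖ := by
      rw [← real_inner_self_eq_norm_sq, ha, inner_onFibre_left, hin]
      exact real_inner_le_norm _ _
    rcases eq_or_lt_of_le (norm_nonneg a) with h2 | h2
    · rw [← h2]; positivity
    · refine le_of_mul_le_mul_right (a := ‖a‖) ?_ h2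
      linarith [sq ‖a‖]

end CostFields

/-! ### First-order conditions and existence of optimal controls -/

section OptimalControl

universe u
variable {X U : Type u} [Fintype X] [DecidableEq X] [Fintype U] [DecidableEq U]

theorem sum_Icc_one_eq_sum_range (l : ℕ) (g : ℕ → ℝ) :
    ∑ τ ∈ Finset.Icc 1 l, g τ = ∑ τ ∈ Finset.range l, g (τ + 1) := by
  induction l with
  | zero => simp
  | succ l ih => rw [Finset.sum_Icc_succ_top (by omega), ih, Finset.sum_range_succ]

omit [Fintype X] [DecidableEq X] [Fintype U] [DecidableEq U] in
theorem horizonCost_eq (f : ℕ → EuclideanSpace ℝ X → ℝ) (c : ℕ → EuclideanSpace ℝ U → ℝ)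
    (F : EuclideanSpace ℝ X → ℝ) (t l : ℕ) (y : ℕ → EuclideanSpace ℝ X)
    (v : ℕ → EuclideanSpace ℝ U) :
    horizonCost f c F t l y v = ∑ τ ∈ Finset.range l, f (t + τ) (y τ)
      + ∑ τ ∈ Finset.range l, c (t + τ + 1) (v τ) + F (y l) := by
  rw [horizonCost, sum_Icc_one_eq_sum_range]; rfl

/-- The state trajectory generated by a control sequence. -/
def trajectory (A : Matrix X X ℝ) (B : Matrix X U ℝ) (x : EuclideanSpace ℝ X)
    (ζ : ℕ → EuclideanSpace ℝ X) (v : ℕ → EuclideanSpace ℝ U) : ℕ → EuclideanSpace ℝ X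
  | 0 => x
  | τ + 1 => actL A (trajectory A B x ζ v τ) + actL B (v τ) + ζ τ

theorem trajectory_succ (A : Matrix X X ℝ) (B : Matrix X U ℝ)
    (x : EuclideanSpace ℝ X) (ζ : ℕ → EuclideanSpace ℝ X) (v : ℕ → EuclideanSpace ℝ U) (τ : ℕ) :
    trajectory A B x ζ v (τ + 1) = actL A (trajectory A B x ζ v τ) + actL B (v τ) + ζ τ := rfl

theorem isFeasible_trajectory (A : Matrix X X ℝ) (B : Matrix X U ℝ) (l : ℕ)
    (x : EuclideanSpace ℝ X) (ζ : ℕ → EuclideanSpace ℝ X) (v : ℕ → EuclideanSpace ℝ U) :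
    IsFeasible A B l x ζ (trajectory A B x ζ v) v := ⟨rfl, fun _ _ => rfl⟩

theorem IsFeasible.eq_trajectory {A : Matrix X X ℝ} {B : Matrix X U ℝ} {l : ℕ}
    {x : EuclideanSpace ℝ X} {ζ y : ℕ → EuclideanSpace ℝ X} {v w : ℕ → EuclideanSpace ℝ U}
    (h : IsFeasible A B l x ζ y v) (hw : ∀ τ < l, w τ = v τ) :
    ∀ τ ≤ l, y τ = trajectory A B x ζ w τ := by
  intro τ
  induction τ with
  | zero => intro _; exact h.1
  | succ τ ih =>
    intro hτ
    rw [h.2 τ (by omega), trajectory_succ, ← ih (by omega), hw τ (by omega)]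
    rfl

open ContinuousLinearMap in
/-- First-order optimality conditions. -/
theorem IsOptimal.exists_isKKT {A : Matrix X X ℝ} {B : Matrix X U ℝ}
    {f : ℕ → EuclideanSpace ℝ X → ℝ} {c : ℕ → EuclideanSpace ℝ U → ℝ}
    {F : EuclideanSpace ℝ X → ℝ} {t l : ℕ} {x : EuclideanSpace ℝ X}
    {ζ y : ℕ → EuclideanSpace ℝ X} {v : ℕ → EuclideanSpace ℝ U}
    (h : IsOptimal A B f c F t l x ζ y v) (hf : ∀ τ < l, Differentiable ℝ (f (t + τ)))
    (hc : ∀ τ < l, Differentiable ℝ (c (t + τ + 1))) (hF : Differentiable ℝ F) :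
    ∃ p, IsKKT (actL A) (actL B) l (fun τ => gradient (f (t + τ)))
      (fun τ => gradient (c (t + τ + 1))) ζ y v p ∧ p l = gradient F (y l) := by
  -- The multipliers are computed backwards from the terminal time; `j` counts the remaining steps.
  set q : ℕ → EuclideanSpace ℝ X := fun j => Nat.rec (gradient F (y l))
    (fun j r => adjoint (actL A) r + gradient (f (t + (l - 1 - j))) (y (l - 1 - j))) j with hq
  have hqs : ∀ j, q (j + 1) = adjoint (actL A) (q j)
    + gradient (f (t + (l - 1 - j))) (y (l - 1 - j)) := fun j => rfl
  set p : ℕ → EuclideanSpace ℝ X := fun τ => q (l - τ) with hp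
  have hpl : p l = gradient F (y l) := by simp [hp, hq]
  have hps : ∀ τ < l, p τ = adjoint (actL A) (p (τ + 1)) + gradient (f (t + τ)) (y τ) := by
    intro τ hτ
    have h1 : l - τ = (l - (τ + 1)) + 1 := by omega
    have h2 : l - 1 - (l - (τ + 1)) = τ := by omega
    simp only [hp]
    rw [h1, hqs, h2]
  -- The control is varied in the direction of the stationarity residual itself, so the derivative
  -- of the cost is `∑ ‖ν τ‖ ^ 2`, and optimality makes it vanish.
  set ν : ℕ → EuclideanSpace ℝ U := fun τ =>
    gradient (c (t + τ + 1)) (v τ) + adjoint (actL B) (p (τ + 1)) with hν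
  set z := trajectory A B 0 (fun _ => 0) ν with hz
  have hz0 : z 0 = 0 := rfl
  have hzs : ∀ τ, z (τ + 1) = actL A (z τ) + actL B (ν τ) := fun τ => by
    rw [hz, trajectory_succ, add_zero]
  have hfeas : ∀ s : ℝ, IsFeasible A B l x ζ (fun τ => y τ + s • z τ) (fun τ => v τ + s • ν τ) := by
    intro s
    refine ⟨by simp [hz0, h.1.1], fun τ hτ => ?_⟩
    simp only
    rw [h.1.2 τ hτ, hzs, ← actL_eq_act, ← actL_eq_act, ← actL_eq_act, ← actL_eq_act,
      map_add (actL A) (y τ), map_add (actL B) (v τ), map_smul, map_smul]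
    module
  have hmin : IsLocalMin (fun s : ℝ => horizonCost f c F t l (fun τ => y τ + s • z τ)
      (fun τ => v τ + s • ν τ)) 0 := by
    refine Filter.Eventually.of_forall fun s => ?_
    simpa using h.2 _ _ (hfeas s)
  have hder : HasDerivAt (fun s : ℝ => horizonCost f c F t l (fun τ => y τ + s • z τ)
      (fun τ => v τ + s • ν τ))
      (∑ τ ∈ Finset.range l, inner ℝ (gradient (f (t + τ)) (y τ)) (z τ)
        + ∑ τ ∈ Finset.range l, inner ℝ (gradient (c (t + τ + 1)) (v τ)) (ν τ)
        + inner ℝ (gradient F (y l)) (z l)) 0 := by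
    simp only [horizonCost_eq]
    refine ((HasDerivAt.fun_sum fun τ hτ => ?_).add (HasDerivAt.fun_sum fun τ hτ => ?_)).add ?_
    · simpa using hasDerivAt_comp_line (hf τ (Finset.mem_range.1 hτ)) (y τ) (z τ) 0
    · simpa using hasDerivAt_comp_line (hc τ (Finset.mem_range.1 hτ)) (v τ) (ν τ) 0
    · simpa using hasDerivAt_comp_line hF (y l) (z l) 0
  have hzero := hmin.hasDerivAt_eq_zero hder
  have htel : ∑ τ ∈ Finset.range l, (inner ℝ (p (τ + 1)) (z (τ + 1)) - inner ℝ (p τ) (z τ) : ℝ) =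
      inner ℝ (p l) (z l) := by
    rw [Finset.sum_range_sub (fun τ => (inner ℝ (p τ) (z τ) : ℝ)), hz0, inner_zero_right, sub_zero]
  have hstep : ∀ τ ∈ Finset.range l,
      (inner ℝ (p (τ + 1)) (z (τ + 1)) - inner ℝ (p τ) (z τ) : ℝ) =
      inner ℝ (adjoint (actL B) (p (τ + 1))) (ν τ) - inner ℝ (gradient (f (t + τ)) (y τ)) (z τ) := by
    intro τ hτ
    rw [hzs, hps τ (Finset.mem_range.1 hτ), inner_add_right, inner_add_left, adjoint_inner_left,
      adjoint_inner_left]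
    ring
  rw [Finset.sum_congr rfl hstep, Finset.sum_sub_distrib, hpl] at htel
  have hnu : ∑ τ ∈ Finset.range l, ‖ν τ‖ ^ 2 = 0 := by
    have : ∀ τ, ‖ν τ‖ ^ 2 = inner ℝ (gradient (c (t + τ + 1)) (v τ)) (ν τ)
        + inner ℝ (adjoint (actL B) (p (τ + 1))) (ν τ) := by
      intro τ
      rw [← inner_add_left, ← real_inner_self_eq_norm_sq]
    simp only [this, Finset.sum_add_distrib]
    linarith
  refine ⟨p, ⟨fun τ hτ => h.1.2 τ hτ, hps, fun τ hτ => ?_⟩, hpl⟩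
  have := (Finset.sum_eq_zero_iff_of_nonneg fun _ _ => sq_nonneg _).1 hnu τ (Finset.mem_range.2 hτ)
  simpa using this

/-- Existence of optimal solutions for coercive control costs. -/
theorem exists_isOptimal (A : Matrix X X ℝ) (B : Matrix X U ℝ)
    {f : ℕ → EuclideanSpace ℝ X → ℝ} {c : ℕ → EuclideanSpace ℝ U → ℝ}
    {F : EuclideanSpace ℝ X → ℝ} {t l : ℕ} (x : EuclideanSpace ℝ X)
    (ζ : ℕ → EuclideanSpace ℝ X) {m : ℝ} (hm : 0 < m)
    (hf : ∀ τ < l, Continuous (f (t + τ))) (hf0 : ∀ τ < l, ∀ x, 0 ≤ f (t + τ) x)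
    (hc : ∀ τ < l, Continuous (c (t + τ + 1)))
    (hc0 : ∀ τ < l, ∀ u, m * ‖u‖ ^ 2 ≤ c (t + τ + 1) u)
    (hF : Continuous F) (hF0 : ∀ x, 0 ≤ F x) :
    ∃ y v, IsOptimal A B f c F t l x ζ y v := by
  -- Only the first `l` controls matter, which leaves a continuous coercive function on a
  -- finite-dimensional space.
  set ext : (Fin l → EuclideanSpace ℝ U) → ℕ → EuclideanSpace ℝ U :=
    fun a τ => if h : τ < l then a ⟨τ, h⟩ else 0 with hext
  have hextc : ∀ τ, Continuous fun a => ext a τ := by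
    intro τ
    by_cases h : τ < l
    · simp only [hext, h, dif_pos]; exact continuous_apply _
    · simp only [hext, h, dif_neg, not_false_eq_true]; exact continuous_const
  have htraj : ∀ τ, Continuous fun a => trajectory A B x ζ (ext a) τ := by
    intro τ
    induction τ with
    | zero => exact continuous_const
    | succ τ ih =>
      simp only [trajectory_succ]
      exact (((actL A).continuous.comp ih).add ((actL B).continuous.comp (hextc τ))).add
        continuous_const
  set J : (Fin l → EuclideanSpace ℝ U) → ℝ := fun a =>
    horizonCost f c F t l (trajectory A B x ζ (ext a)) (ext a) with hJ
  have hJc : Continuous J := by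
    simp only [hJ, horizonCost_eq]
    refine ((continuous_finsetSum _ fun τ hτ => ?_).add
      (continuous_finsetSum _ fun τ hτ => ?_)).add (hF.comp (htraj l))
    · exact (hf τ (Finset.mem_range.1 hτ)).comp (htraj τ)
    · exact (hc τ (Finset.mem_range.1 hτ)).comp (hextc τ)
  have hJlow : ∀ a, m * ‖a‖ ^ 2 ≤ J a := by
    intro a
    have h1 : 0 ≤ ∑ τ ∈ Finset.range l, f (t + τ) (trajectory A B x ζ (ext a) τ) :=
      Finset.sum_nonneg fun τ hτ => hf0 τ (Finset.mem_range.1 hτ) _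
    have h2 := hF0 (trajectory A B x ζ (ext a) l)
    have hcn : ∀ τ ∈ Finset.range l, 0 ≤ c (t + τ + 1) (ext a τ) := fun τ hτ =>
      le_trans (by positivity) (hc0 τ (Finset.mem_range.1 hτ) _)
    have h3 : m * ‖a‖ ^ 2 ≤ ∑ τ ∈ Finset.range l, c (t + τ + 1) (ext a τ) := by
      have hS := Finset.sum_nonneg hcn
      have h4 : ‖a‖ ≤ Real.sqrt ((∑ τ ∈ Finset.range l, c (t + τ + 1) (ext a τ)) / m) := by
        rw [pi_norm_le_iff_of_nonneg (Real.sqrt_nonneg _)]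
        intro i
        refine Real.le_sqrt_of_sq_le ?_
        rw [le_div_iff₀ hm]
        have h5 := Finset.single_le_sum hcn (Finset.mem_range.2 i.2)
        have h6 := hc0 i i.2 (ext a i)
        have h7 : ext a i = a i := by simp [hext]
        rw [h7] at h5 h6
        linarith
      have h8 : ‖a‖ ^ 2 ≤ (∑ τ ∈ Finset.range l, c (t + τ + 1) (ext a τ)) / m := by
        calc ‖a‖ ^ 2 ≤ Real.sqrt _ ^ 2 := by gcongr
          _ = _ := Real.sq_sqrt (by positivity)
      rw [le_div_iff₀ hm] at h8
      linarith
    simp only [hJ, horizonCost_eq]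
    linarith
  have hlim : Tendsto J (cocompact _) atTop := by
    refine tendsto_atTop_mono hJlow ?_
    exact ((tendsto_pow_atTop two_ne_zero).comp
      (tendsto_norm_cocompact_atTop (E := Fin l → EuclideanSpace ℝ U))).const_mul_atTop hm
  obtain ⟨a, ha⟩ := hJc.exists_forall_le hlim
  refine ⟨trajectory A B x ζ (ext a), ext a, isFeasible_trajectory A B l x ζ _, ?_⟩
  intro y' v' h'
  refine (ha fun i => v' i).trans (le_of_eq ?_)
  have hv : ∀ τ < l, ext (fun i => v' i) τ = v' τ := by
    intro τ hτ; simp [hext, hτ]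
  have hy := h'.eq_trajectory hv
  simp only [hJ, horizonCost_eq]
  rw [hy l le_rfl]
  congr 2
  · exact Finset.sum_congr rfl fun τ hτ => by rw [hy τ (Finset.mem_range.1 hτ).le]
  · exact Finset.sum_congr rfl fun τ hτ => by rw [hv τ (Finset.mem_range.1 hτ)]

end OptimalControl

/-! ### Blocks and sampled curves -/

section Blocks

variable {V : Type*} [Fintype V] [DecidableEq V] {n : V → ℕ}

omit [DecidableEq V] in
theorem norm_block_le_norm_scale {b : V → ℝ} {i : V} (hb : b i = 1) (x : Stacked n) :
    ‖block x i‖ ≤ ‖scale (fun p => b p.1) x‖ := by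
  refine abs_le_of_sq_le_sq' ?_ (norm_nonneg _) |>.2
  rw [EuclideanSpace.norm_sq_eq, EuclideanSpace.norm_sq_eq, Fintype.sum_sigma]
  refine le_trans (le_of_eq ?_) (Finset.single_le_sum
    (f := fun j => ∑ a, ‖scale (fun p : Idx n => b p.1) x ⟨j, a⟩‖ ^ 2)
    (fun j _ => Finset.sum_nonneg fun _ _ => sq_nonneg _) (Finset.mem_univ i))
  refine Finset.sum_congr rfl fun a _ => ?_
  simp [block, hb]

omit [DecidableEq V] in
theorem norm_le_sum_norm_block (x : Stacked n) : ‖x‖ ≤ ∑ i, ‖block x i‖ := by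
  refine abs_le_of_sq_le_sq' ?_ (Finset.sum_nonneg fun _ _ => norm_nonneg _) |>.2
  refine le_trans (le_of_eq ?_)
    (sum_sq_le_sq_sum_of_nonneg Finset.univ (fun i => ‖block x i‖) fun _ _ => norm_nonneg _)
  rw [EuclideanSpace.norm_sq_eq, Fintype.sum_sigma]
  refine Finset.sum_congr rfl fun i _ => ?_
  rw [EuclideanSpace.norm_sq_eq]
  rfl

/-- A vector whose blocks are sampled at different parameters from an `M`-Lipschitz curve stays
within `M` times the length of the parameter interval from the start of the curve. -/
theorem norm_sampled_sub_le {w : Stacked n} {v : ℝ → Stacked n} {θ : V → ℝ} {M a b : ℝ}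
    (hv : ∀ s t, a ≤ s → s ≤ t → t ≤ b → ‖v t - v s‖ ≤ M * (t - s)) (hM : 0 ≤ M) (hab : a ≤ b)
    (hθ₁ : ∀ i, a ≤ θ i) (hθ₂ : ∀ i, θ i ≤ b) (hw : ∀ i, block w i = block (v (θ i)) i) :
    ‖w - v a‖ ≤ M * (b - a) := by
  have hle : ∀ (S : Finset V) (x : Stacked n),
      ‖scale (fun p : Idx n => if p.1 ∈ S then 1 else 0) x‖ ≤ ‖x‖ := by
    intro S x
    rw [← one_mul ‖x‖]
    refine norm_scale_le (fun i => ?_) x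
    split_ifs <;> simp
  -- The nodes are swept in increasing order of `θ`. Moving the base point from `a'` to the least
  -- remaining `θ i` annihilates block `i` and costs `M (θ i - a')`; these lengths add up to at most
  -- `b - a`, however many nodes there are.
  suffices H : ∀ (k : ℕ) (S : Finset V), S.card = k → ∀ a', a ≤ a' → a' ≤ b →
      (∀ i ∈ S, a' ≤ θ i) →
      ‖scale (fun p : Idx n => if p.1 ∈ S then 1 else 0) (w - v a')‖ ≤ M * (b - a') by
    have h1 := H _ Finset.univ rfl a le_rfl hab (fun i _ => hθ₁ i)
    have h2 : scale (fun p : Idx n => if p.1 ∈ (Finset.univ : Finset V) then 1 else 0) (w - v a)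
        = w - v a := by ext p; simp
    rwa [h2] at h1
  intro k
  induction k with
  | zero =>
    intro S hS a' _ hb' _
    rw [Finset.card_eq_zero.1 hS]
    have : scale (fun p : Idx n => if p.1 ∈ (∅ : Finset V) then 1 else 0) (w - v a') = 0 := by
      ext p; simp
    rw [this, norm_zero]
    exact mul_nonneg hM (by linarith)
  | succ k ih =>
    intro S hS a' ha' hb' hθS
    obtain ⟨i, hiS, hi⟩ := S.exists_min_image θ (Finset.card_pos.1 (by omega))
    have h1 := ih (S.erase i) (by rw [Finset.card_erase_of_mem hiS]; omega) (θ i) (hθ₁ i) (hθ₂ i)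
      (fun j hj => hi j (Finset.mem_of_mem_erase hj))
    have h2 := (hle S (v (θ i) - v a')).trans (hv a' (θ i) ha' (hθS i hiS) (hθ₂ i))
    have hid : scale (fun p : Idx n => if p.1 ∈ S then 1 else 0) (w - v a') =
        scale (fun p : Idx n => if p.1 ∈ S.erase i then 1 else 0) (w - v (θ i)) +
        scale (fun p : Idx n => if p.1 ∈ S then 1 else 0) (v (θ i) - v a') := by
      ext ⟨j, r⟩
      by_cases hj : j = i
      · subst hj
        have := congrArg (fun z => z r) (hw j)
        simp only [block] at this
        simp [hiS, this]
      · by_cases hjS : j ∈ S <;> simp [hj, hjS]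
    rw [hid]
    refine (norm_add_le _ _).trans ?_
    linarith

end Blocks

/-! ### Decoupled systems -/

section Components

variable {X U : Type*} [Fintype X] [DecidableEq X] [Fintype U] [DecidableEq U]

/-- Orthogonal projection onto the vectors supported on a fibre of `π`. -/
def fibreProj {W : Type*} [DecidableEq W] (π : X → W) (i : W) :
    EuclideanSpace ℝ X →L[ℝ] EuclideanSpace ℝ X :=
  LinearMap.toContinuousLinearMap
    { toFun := onFibre π i
      map_add' := fun x y => by ext p; simp [onFibre, mul_add]
      map_smul' := fun c x => by ext p; simp [onFibre] }

omit [DecidableEq X] in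
theorem fibreProj_apply {W : Type*} [DecidableEq W] (π : X → W) (i : W) (x : EuclideanSpace ℝ X)
    (p : X) : fibreProj π i x p = if π p = i then x p else 0 := by
  change onFibre π i x p = _
  simp [onFibre]

omit [DecidableEq X] in
theorem norm_fibreProj_le {W : Type*} [DecidableEq W] (π : X → W) (i : W)
    (x : EuclideanSpace ℝ X) : ‖fibreProj π i x‖ ≤ ‖x‖ := by
  change ‖onFibre π i x‖ ≤ _
  rw [← one_mul ‖x‖]
  refine norm_scale_le (fun p => ?_) x
  split_ifs <;> simp

omit [DecidableEq X] in
theorem norm_sq_eq_sum_fibreProj {W : Type*} [Fintype W] [DecidableEq W] (π : X → W)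
    (x : EuclideanSpace ℝ X) : ‖x‖ ^ 2 = ∑ i, ‖fibreProj π i x‖ ^ 2 := by
  have h := norm_scale_sq_eq_sum π (fun _ => (1 : ℝ)) x
  have h1 : scale (fun p => (fun _ : W => (1 : ℝ)) (π p)) x = x := by ext p; simp
  rw [h1] at h
  simp only [one_pow, one_mul] at h
  exact h

omit [DecidableEq X] in
theorem norm_le_of_fibreProj_le {Y W : Type*} [Fintype Y] [Fintype W] [DecidableEq W]
    {π : X → W} {ρ : Y → W} {x : EuclideanSpace ℝ X} {y : EuclideanSpace ℝ Y} {c : ℝ} (hc : 0 ≤ c)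
    (h : ∀ i, ‖fibreProj π i x‖ ≤ c * ‖fibreProj ρ i y‖) : ‖x‖ ≤ c * ‖y‖ := by
  refine abs_le_of_sq_le_sq' ?_ (by positivity) |>.2
  rw [mul_pow, norm_sq_eq_sum_fibreProj π, norm_sq_eq_sum_fibreProj ρ, Finset.mul_sum]
  refine Finset.sum_le_sum fun i _ => ?_
  rw [← mul_pow]
  have := h i
  gcongr

omit [DecidableEq X] in
theorem actL_fibreProj {W : Type*} [DecidableEq W] {M : Matrix X U ℝ} {π : X → W} {ρ : U → W}
    (h : ∀ p q, M p q ≠ 0 → π p = ρ q) (i : W) (x : EuclideanSpace ℝ U) :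
    actL M (fibreProj ρ i x) = fibreProj π i (actL M x) := by
  ext p
  rw [fibreProj_apply, actL_apply, actL_apply]
  by_cases hp : π p = i
  · rw [if_pos hp]
    refine Finset.sum_congr rfl fun q _ => ?_
    by_cases h0 : M p q = 0
    · simp [h0]
    · rw [fibreProj_apply, if_pos ((h p q h0).symm.trans hp)]
  · rw [if_neg hp]
    refine Finset.sum_eq_zero fun q _ => ?_
    by_cases h0 : M p q = 0
    · simp [h0]
    · rw [fibreProj_apply, if_neg (fun h1 => hp ((h p q h0).trans h1)), mul_zero]

/-- A system that decouples into stabilizable subsystems is stabilizable. -/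
theorem stablePair_of_decoupled {W : Type*} [Fintype W] [DecidableEq W] {L γ : ℝ} (hγ : 0 < γ)
    (hL : 0 ≤ L) {A : Matrix X X ℝ} {B : Matrix X U ℝ} {π : X → W} {ρ : U → W}
    (hA : ∀ p q, A p q ≠ 0 → π p = π q) (hB : ∀ p q, B p q ≠ 0 → π p = ρ q)
    (hAL : ‖A‖ ≤ L) (hBL : ‖B‖ ≤ L)
    (hst : ∀ i, ∃ (A' : Matrix X X ℝ) (B' : Matrix X U ℝ), StablePair L γ (actL A') (actL B') ∧
      (∀ p q, A' p q = if π p = i then A p q else 0) ∧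
      (∀ p q, B' p q = if π p = i then B p q else 0)) :
    StablePair L γ (actL A) (actL B) := by
  refine ⟨(norm_actL A).trans_le hAL, (norm_actL B).trans_le hBL, ?_⟩
  choose A' B' hs hA' hB' using hst
  choose K hK hpow using fun i => (hs i).gain
  set P : W → EuclideanSpace ℝ X →L[ℝ] EuclideanSpace ℝ X := fibreProj π with hP
  set R : W → EuclideanSpace ℝ U →L[ℝ] EuclideanSpace ℝ U := fibreProj ρ with hR
  -- The individual gains may mix components, so each is compressed to its own component on both
  -- sides. The pieces then act orthogonally, and the bound `L` is not multiplied by their number.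
  set K₀ : EuclideanSpace ℝ X →L[ℝ] EuclideanSpace ℝ U := ∑ i, (R i) ∘L (K i) ∘L (P i) with hK₀
  have hRR : ∀ i j u, R i (R j u) = if i = j then R i u else 0 := by
    intro i j u
    by_cases hij : i = j
    · subst hij
      rw [if_pos rfl]; ext p
      simp only [hR, fibreProj_apply]
      split_ifs <;> rfl
    · rw [if_neg hij]; ext p
      simp only [hR, fibreProj_apply]
      split_ifs with h1 h2
      · exact absurd (h1.symm.trans h2) hij
      · rfl
      · rfl
  have hRK : ∀ i x, R i (K₀ x) = R i (K i (P i x)) := by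
    intro i x
    simp only [hK₀, _root_.sum_apply, ContinuousLinearMap.comp_apply, map_sum, hRR]
    simp
  have hPP : ∀ i x, P i (P i x) = P i x := by
    intro i x; ext p
    simp only [hP, fibreProj_apply]
    split_ifs <;> rfl
  have hA'P : ∀ i x, actL (A' i) x = P i (actL A x) := by
    intro i x; ext p
    simp only [hP, fibreProj_apply, actL_apply, hA']
    split_ifs <;> simp
  have hB'P : ∀ i x, actL (B' i) x = P i (actL B x) := by
    intro i x; ext p
    simp only [hP, fibreProj_apply, actL_apply, hB']
    split_ifs <;> simp
  have hAP : ∀ i x, P i (actL A x) = actL A (P i x) := fun i x => (actL_fibreProj hA i x).symm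
  have hBP : ∀ i u, P i (actL B u) = actL B (R i u) := fun i u => (actL_fibreProj hB i u).symm
  -- `P i` intertwines the global closed loop with the `i`-th one, so power bounds transfer
  -- componentwise.
  have hstep : ∀ i x, P i ((actL A - actL B ∘L K₀) x) =
      (actL (A' i) - actL (B' i) ∘L K i) (P i x) := by
    intro i x
    simp only [_root_.map_sub, _root_.sub_apply, ContinuousLinearMap.comp_apply]
    rw [hBP, hRK, ← hBP, hA'P, hB'P, ← hAP, hPP]
  have hiter : ∀ (t : ℕ) i x, P i (((actL A - actL B ∘L K₀) ^ t) x) =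
      ((actL (A' i) - actL (B' i) ∘L K i) ^ t) (P i x) := by
    intro t i x
    induction t with
    | zero => rfl
    | succ t ih =>
      rw [pow_succ', pow_succ']
      change P i ((actL A - actL B ∘L K₀) (((actL A - actL B ∘L K₀) ^ t) x)) = _
      rw [hstep, ih]
      rfl
  refine ⟨K₀, ?_, fun t => ?_⟩
  · refine ContinuousLinearMap.opNorm_le_bound _ hL fun x => ?_
    refine norm_le_of_fibreProj_le (π := ρ) (ρ := π) hL fun i => ?_
    change ‖R i (K₀ x)‖ ≤ L * ‖P i x‖
    rw [hRK]
    exact (norm_fibreProj_le ρ i _).trans (((K i).le_opNorm _).trans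
      (mul_le_mul_of_nonneg_right (hK i) (norm_nonneg _)))
  · refine ContinuousLinearMap.opNorm_le_bound _ (by positivity) fun x => ?_
    refine norm_le_of_fibreProj_le (π := π) (ρ := π) (by positivity) fun i => ?_
    change ‖P i _‖ ≤ _ * ‖P i x‖
    rw [hiter]
    exact (((actL (A' i) - actL (B' i) ∘L K i) ^ t).le_opNorm _).trans
      (mul_le_mul_of_nonneg_right (hpow i t) (norm_nonneg _))

end Components

/-! ### Networked systems and truncation -/

section Network

variable {V : Type*} [Fintype V] [DecidableEq V] {n m : V → ℕ} {G : SimpleGraph V}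

omit [Fintype V] [DecidableEq V] in
theorem IsNetworked.eq_or_adj {M : BlockMatrix n m} (h : IsNetworked G M) {p : Idx n} {q : Idx m}
    (hpq : M p q ≠ 0) : p.1 = q.1 ∨ G.Adj p.1 q.1 := by
  by_contra hcon
  rw [not_or] at hcon
  exact hpq (h p.1 q.1 hcon.1 hcon.2 p.2 q.2)

omit [Fintype V] [DecidableEq V] in
theorem truncMatrix_apply (κ : ℕ) (i : V) (M : BlockMatrix n m) (p : Idx n) (q : Idx m)
    [Decidable (p.1 ∈ hood G κ i)] :
    truncMatrix G κ i M p q = if p.1 ∈ hood G κ i then M p q else 0 := by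
  unfold truncMatrix
  congr

theorem norm_truncMatrix_le (κ : ℕ) (i : V) (M : BlockMatrix n m) :
    ‖truncMatrix G κ i M‖ ≤ ‖M‖ := by
  classical
  rw [← norm_actL]
  refine ContinuousLinearMap.opNorm_le_bound _ (norm_nonneg _) fun x => ?_
  have h1 : actL (truncMatrix G κ i M) x = erase (fun p : Idx n => p.1 ∉ hood G κ i) (actL M x) := by
    ext p
    simp only [actL_apply, erase_apply, truncMatrix_apply]
    by_cases hp : p.1 ∈ hood G κ i <;> simp [hp]
  rw [h1]
  refine (norm_erase_le _ _).trans ?_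
  have := (actL M).le_opNorm x
  rwa [norm_actL] at this

theorem SystemAssumption.stablePair_trunc {L γ σ : ℝ} {d κ₀ : ℕ} {A : BlockMatrix n n}
    {B : BlockMatrix n m} (h : SystemAssumption L γ σ d κ₀ G A B) (i : V) {κ : ℕ} (hκ : κ₀ ≤ κ) :
    StablePair L γ (actL (truncMatrix G κ i A)) (actL (truncMatrix G κ i B)) :=
  stablePair_actL ((norm_truncMatrix_le κ i A).trans h.norm_A)
    ((norm_truncMatrix_le κ i B).trans h.norm_B) (h.stabilizable i κ hκ)

/-- Stabilizability is assumed for truncated pairs only. For a large radius a neighbourhood is a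
whole connected component, and the full system decouples over the components, so the gains can be
glued. -/
theorem SystemAssumption.stablePair {L γ σ : ℝ} (hL : 0 ≤ L) (hγ : 0 < γ) {d κ₀ : ℕ}
    {A : BlockMatrix n n} {B : BlockMatrix n m} (h : SystemAssumption L γ σ d κ₀ G A B) :
    StablePair L γ (actL A) (actL B) := by
  classical
  -- Infinite distances contribute `0`, so this radius is at least every finite distance.
  set κ : ℕ := κ₀ + ∑ i, ∑ j, (G.edist i j).toNat with hκ
  have hhood : ∀ i j, j ∈ hood G κ i ↔ G.Reachable i j := by
    intro i j
    constructor
    · intro hj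
      by_contra hr
      have h1 : G.edist i j = ⊤ := SimpleGraph.edist_eq_top_of_not_reachable hr
      change G.edist i j ≤ (κ : ℕ∞) at hj
      rw [h1] at hj
      exact absurd hj (by simp)
    · intro hr
      change G.edist i j ≤ (κ : ℕ∞)
      have h1 : G.edist i j ≠ ⊤ := SimpleGraph.edist_ne_top_iff_reachable.2 hr
      rw [← ENat.natCast_toNat h1, Nat.cast_le]
      have h2 := Finset.single_le_sum (f := fun j => (G.edist i j).toNat)
        (fun _ _ => Nat.zero_le _) (Finset.mem_univ j)
      have h3 := Finset.single_le_sum (f := fun i => ∑ j, (G.edist i j).toNat)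
        (fun _ _ => Nat.zero_le _) (Finset.mem_univ i)
      omega
  have hcomp : ∀ {i j : V}, i = j ∨ G.Adj i j →
      G.connectedComponentMk i = G.connectedComponentMk j := by
    rintro i j (rfl | hij)
    · rfl
    · exact SimpleGraph.ConnectedComponent.sound hij.reachable
  refine stablePair_of_decoupled (W := G.ConnectedComponent)
    (π := fun p => G.connectedComponentMk p.1) (ρ := fun p => G.connectedComponentMk p.1)
    hγ hL (fun p q hpq => hcomp (h.networked_A.eq_or_adj hpq))
    (fun p q hpq => hcomp (h.networked_B.eq_or_adj hpq)) h.norm_A h.norm_B ?_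
  intro W
  induction W using SimpleGraph.ConnectedComponent.ind with
  | h i =>
    have hiff : ∀ j, j ∈ hood G κ i ↔ G.connectedComponentMk j = G.connectedComponentMk i := by
      intro j
      rw [hhood, SimpleGraph.ConnectedComponent.eq, SimpleGraph.reachable_comm]
    refine ⟨_, _, h.stablePair_trunc i (κ := κ) (by omega), fun p q => ?_, fun p q => ?_⟩ <;>
      simp only [truncMatrix_apply, hiff]

/-- The distance to node `i`, cut off at `κ`. -/
def cutDist (G : SimpleGraph V) (κ : ℕ) (i j : V) : ℕ := (min (G.edist i j) κ).toNat

omit [Fintype V] [DecidableEq V] in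
theorem coe_cutDist (κ : ℕ) (i j : V) : (cutDist G κ i j : ℕ∞) = min (G.edist i j) κ :=
  ENat.natCast_toNat (ne_top_of_le_ne_top (ENat.natCast_ne_top κ) (min_le_right _ _))

omit [Fintype V] [DecidableEq V] in
theorem cutDist_self (κ : ℕ) (i : V) : cutDist G κ i i = 0 := by
  simp [cutDist]

omit [Fintype V] [DecidableEq V] in
theorem le_cutDist {κ : ℕ} {i j : V} (h : j ∉ hood G κ i) : κ ≤ cutDist G κ i j := by
  have h1 : (κ : ℕ∞) ≤ G.edist i j := (not_le.1 h).le
  rw [← Nat.cast_le (α := ℕ∞), coe_cutDist, min_eq_right h1]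

omit [Fintype V] [DecidableEq V] in
-- The cutoff makes the level finite on other components and preserves the property that it changes
-- by at most one along an edge, as the spatial weights require.
theorem cutDist_le_succ {κ : ℕ} {i j k : V} (h : j = k ∨ G.Adj j k) :
    cutDist G κ i j ≤ cutDist G κ i k + 1 := by
  rcases h with rfl | h
  · omega
  have h1 : G.edist i j ≤ G.edist i k + 1 := by
    refine SimpleGraph.edist_triangle (v := k) |>.trans ?_
    gcongr
    exact (SimpleGraph.edist_eq_one_iff_adj.2 h.symm).le
  rw [← Nat.cast_le (α := ℕ∞), Nat.cast_add, coe_cutDist, coe_cutDist, Nat.cast_one]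
  rcases le_total (G.edist i k) κ with h2 | h2
  · rw [min_eq_left h2]; exact (min_le_left _ _).trans h1
  · rw [min_eq_right h2]; exact (min_le_right _ _).trans le_self_add

omit [Fintype V] [DecidableEq V] in
theorem IsNetworked.banded {M : BlockMatrix n m} (h : IsNetworked G M) (κ : ℕ) (i : V) :
    Banded M (fun p => cutDist G κ i p.1) (fun q => cutDist G κ i q.1) := by
  intro p q hpq
  rcases h.eq_or_adj hpq with h1 | h1
  · exact ⟨cutDist_le_succ (Or.inl h1), cutDist_le_succ (Or.inl h1.symm)⟩
  · exact ⟨cutDist_le_succ (Or.inr h1), cutDist_le_succ (Or.inr h1.symm)⟩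

omit [Fintype V] [DecidableEq V] in
theorem sub_truncVec (κ : ℕ) (i : V) (x : Stacked n) [DecidablePred fun p : Idx n => p.1 ∈ hood G κ i] :
    x - truncVec G κ i x = erase (fun p : Idx n => p.1 ∈ hood G κ i) x := by
  ext p
  by_cases hp : p.1 ∈ hood G κ i <;> simp [truncVec, hp]

end Network

/-! ### Per-step control errors and their accumulation -/

section PredictiveControl

universe u
variable {V : Type u} [Fintype V] [DecidableEq V] {n m : V → ℕ} {G : SimpleGraph V}
  {L γ μ σ η C δ : ℝ} {d κ₀ T : ℕ} {A : BlockMatrix n n} {B : BlockMatrix n m}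
  {f : ℕ → (i : V) → EuclideanSpace ℝ (Fin (n i)) → ℝ}
  {c : ℕ → (i : V) → EuclideanSpace ℝ (Fin (m i)) → ℝ} {F : Stacked n → ℝ}

theorem CostAssumption.localField_state (h : CostAssumption μ L T f c F) (hL : 0 ≤ L) {t : ℕ}
    (ht : t ≤ T) : LocalField μ L Sigma.fst (gradient (aggregate (f t))) :=
  localField_gradient_aggregate hL (h.state t ht) (h.state_zero t ht) (h.state_nonneg t ht)

theorem CostAssumption.localField_control (h : CostAssumption μ L T f c F) (hL : 0 ≤ L) {t : ℕ}
    (h1 : 1 ≤ t) (ht : t ≤ T) : LocalField μ L Sigma.fst (gradient (aggregate (c t))) :=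
  localField_gradient_aggregate hL (h.control t h1 ht) (h.control_zero t h1 ht)
    (h.control_nonneg t h1 ht)

/-- The constant in the bound for the effect of the truncation on the first control. -/
def truncConst (L η C : ℝ) : ℝ := C * (3 + (3 * L ^ 2 + 2 * (L + η) ^ 2) * (4 * C ^ 2))

/-- Solutions of the optimality system of the window of length `l` posed at time `t`. -/
def SolvesWindow (A : BlockMatrix n n) (B : BlockMatrix n m)
    (f : ℕ → (i : V) → EuclideanSpace ℝ (Fin (n i)) → ℝ)
    (c : ℕ → (i : V) → EuclideanSpace ℝ (Fin (m i)) → ℝ) (gF : Stacked n → Stacked n)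
    (t l : ℕ) (x : Stacked n) (ζ : ℕ → Stacked n)
    (y : ℕ → Stacked n) (v : ℕ → Stacked m) (p : ℕ → Stacked n) : Prop :=
  IsKKT (actL A) (actL B) l (fun τ => gradient (aggregate (f (t + τ))))
    (fun τ => gradient (aggregate (c (t + τ + 1)))) ζ y v p ∧ p l = gF (y l) ∧ y 0 = x

theorem IsOptimal.exists_solvesWindow (hcost : CostAssumption μ L T f c F) {g : Stacked n → ℝ}
    (hg : Differentiable ℝ g) {t l : ℕ} (hl : t + l ≤ T) {x : Stacked n} {ζ y : ℕ → Stacked n}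
    {v : ℕ → Stacked m}
    (h : IsOptimal A B (fun s => aggregate (f s)) (fun s => aggregate (c s)) g t l x ζ y v) :
    ∃ p, SolvesWindow A B f c (gradient g) t l x ζ y v p := by
  obtain ⟨p, hp, hpl⟩ := h.exists_isKKT
    (fun τ hτ => (hcost.state (t + τ) (by omega)).differentiable)
    (fun τ hτ => (hcost.control (t + τ + 1) (by omega) (by omega)).differentiable) hg
  exact ⟨p, hp, hpl, h.1.1⟩

theorem exists_solvesWindow (hμ : 0 < μ) (hcost : CostAssumption μ L T f c F) {g : Stacked n → ℝ}
    (hg : Differentiable ℝ g) (hg0 : ∀ x, 0 ≤ g x) {t l : ℕ} (hl : t + l ≤ T) (x : Stacked n)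
    (ζ : ℕ → Stacked n) :
    ∃ y v p, SolvesWindow A B f c (gradient g) t l x ζ y v p := by
  obtain ⟨y, v, h⟩ := exists_isOptimal A B (f := fun s => aggregate (f s))
    (c := fun s => aggregate (c s)) (F := g) (t := t) (l := l) x ζ (m := μ / 4) (by positivity)
    (fun τ hτ => (hcost.state (t + τ) (by omega)).differentiable.continuous)
    (fun τ hτ => hcost.state_nonneg (t + τ) (by omega))
    (fun τ hτ => (hcost.control (t + τ + 1) (by omega) (by omega)).differentiable.continuous)
    (fun τ hτ => quadratic_le_of_strongConvexOn
      (hcost.control (t + τ + 1) (by omega) (by omega)).strongConvex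
      (hcost.control_zero _ (by omega) (by omega)) (hcost.control_nonneg _ (by omega) (by omega)))
    hg.continuous hg0
  obtain ⟨p, hp⟩ := h.exists_solvesWindow hcost hg hl
  exact ⟨y, v, p, hp⟩

theorem gradient_half_smul_norm_sq {E : Type*} [NormedAddCommGroup E] [InnerProductSpace ℝ E]
    [CompleteSpace E] (θ : ℝ) :
    Differentiable ℝ (fun x : E => θ / 2 * ‖x‖ ^ 2) ∧
      gradient (fun x : E => θ / 2 * ‖x‖ ^ 2) = fun x => θ • x := by
  have h : ∀ x : E, HasGradientAt (fun x : E => θ / 2 * ‖x‖ ^ 2) (θ • x) x := by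
    intro x
    rw [hasGradientAt_iff_hasFDerivAt]
    have h1 := ((hasStrictFDerivAt_norm_sq x).hasFDerivAt).const_mul (θ / 2)
    refine h1.congr_fderiv ?_
    ext u
    simp
    ring
  exact ⟨fun x => (h x).differentiableAt, gradient_eq h⟩

theorem exists_solvesWindow_smul (hμ : 0 < μ) (hcost : CostAssumption μ L T f c F)
    {t l : ℕ} (hl : t + l ≤ T) (x : Stacked n) (ζ : ℕ → Stacked n) {θ : ℝ} (hθ : 0 ≤ θ) :
    ∃ y v p, SolvesWindow A B f c (fun x => θ • x) t l x ζ y v p := by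
  obtain ⟨h1, h2⟩ := gradient_half_smul_norm_sq (E := Stacked n) θ
  rw [← h2]
  exact exists_solvesWindow hμ hcost h1 (fun x => by positivity) hl x ζ

/-- The weight centred at `i` equals `1` on block `i`, so the weighted estimate controls that block
without loss. Each node needs its own weight, and summing over nodes later produces the factor `N`.
-/
theorem SolvesWindow.block_sub_le (hd : DecayData.{u} L γ μ η C δ) (hη : 0 ≤ η) (hγ : 0 < γ)
    (hsys : SystemAssumption L γ σ d κ₀ G A B) (hcost : CostAssumption μ L T f c F) (i : V)
    {κ : ℕ} (hκ : κ₀ ≤ κ) {gF : Stacked n → Stacked n} (hgF : LocalField μ L Sigma.fst gF)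
    {t l : ℕ} (hl : t + l ≤ T) (hl1 : 1 ≤ l) {x : Stacked n} {ζ y y' p p' : ℕ → Stacked n}
    {v v' : ℕ → Stacked m} (h : SolvesWindow A B f c gF t l x ζ y v p)
    (h' : SolvesWindow (truncMatrix G κ i A) (truncMatrix G κ i B) f c gF t l (truncVec G κ i x)
      (fun τ => truncVec G κ i (ζ τ)) y' v' p')
    {D : ℝ} (hD : ∑ τ ∈ Finset.range l, ‖ζ τ‖ ≤ D) :
    ‖block (v 0 - v' 0) i‖ ≤ truncConst L η C * δ ^ κ * (‖x‖ + D) := by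
  classical
  have hL : 0 ≤ L := by linarith [hd.one_lt]
  have key := truncation_sensitivity hd hη (hsys.stablePair hL hγ) (hsys.stablePair_trunc i hκ)
    (πX := Sigma.fst) (πU := Sigma.fst) (φ := cutDist G κ i) (hsys.networked_A.banded κ i)
    (hsys.networked_B.banded κ i) (fun p => p.1 ∈ hood G κ i) (fun p hp => le_cutDist hp)
    (fun p q => truncMatrix_apply κ i A p q) (fun p q => truncMatrix_apply κ i B p q) hl1
    (fun τ hτ => hcost.localField_state hL (by omega))
    (fun τ hτ => hcost.localField_control hL (by omega) (by omega)) hgF h.1 h.2.1 h'.1 h'.2.1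
    (fun τ hτ => sub_truncVec κ i (ζ τ)) (by rw [h.2.2, h'.2.2]; exact sub_truncVec κ i x) hD
  rw [h.2.2] at key
  refine (norm_block_le_norm_scale (b := fun j => δ ^ cutDist G κ i j) ?_ _).trans key
  simp [cutDist_self]

omit [DecidableEq V] in
theorem norm_le_card_mul_of_block_le {x : Stacked m} {a : ℝ} (h : ∀ i, ‖block x i‖ ≤ a) :
    ‖x‖ ≤ Fintype.card V * a := by
  refine (norm_le_sum_norm_block x).trans ((Finset.sum_le_sum fun i _ => h i).trans_eq ?_)
  simp

omit [Fintype V] [DecidableEq V] in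
theorem block_sub_congr {x y z : Stacked m} {i : V} (h : block x i = block y i) :
    block (z - x) i = block (z - y) i := by
  ext a
  have := congrArg (fun w => w a) h
  simp only [block] at this
  simp [block, this]

/-- Per-step error of the truncated controller in the final phase. -/
theorem control_error_final_phase (hd : DecayData.{u} L γ μ η C δ) (hη : 0 ≤ η) (hγ : 0 < γ)
    (hsys : SystemAssumption L γ σ d κ₀ G A B) (hcost : CostAssumption μ L T f c F)
    {κ : ℕ} (hκ : κ₀ ≤ κ) {t : ℕ} (ht : t < T) {x : Stacked n} {ζ : ℕ → Stacked n} {u : Stacked m}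
    (hu : ∀ i, ∃ (y : ℕ → Stacked n) (v : ℕ → Stacked m),
      IsOptimal (truncMatrix G κ i A) (truncMatrix G κ i B) (fun s => aggregate (f s))
        (fun s => aggregate (c s)) (aggregate (f T)) t (T - t) (truncVec G κ i x)
        (fun τ => truncVec G κ i (ζ τ)) y v ∧ block u i = block (v 0) i)
    {y p : ℕ → Stacked n} {v : ℕ → Stacked m}
    (h : SolvesWindow A B f c (gradient (aggregate (f T))) t (T - t) x ζ y v p)
    {D : ℝ} (hD : ∑ τ ∈ Finset.range (T - t), ‖ζ τ‖ ≤ D) :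
    ‖v 0 - u‖ ≤ Fintype.card V * (truncConst L η C * δ ^ κ * (‖x‖ + D)) := by
  have hL : 0 ≤ L := by linarith [hd.one_lt]
  refine norm_le_card_mul_of_block_le fun i => ?_
  obtain ⟨y', v', hopt, hblock⟩ := hu i
  obtain ⟨p', hp'⟩ := hopt.exists_solvesWindow hcost (hcost.state T le_rfl).differentiable (by omega)
  rw [block_sub_congr hblock]
  exact h.block_sub_le hd hη hγ hsys hcost i hκ (hcost.localField_state hL le_rfl) (by omega)
    (by omega) hp' hD

/-- Per-step error of the truncated controller before the final phase. -/
theorem control_error_predictive_phase (hd : DecayData.{u} L γ μ η C δ) (hη : 0 ≤ η) (hγ : 0 < γ)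
    (hμ : 0 < μ) (hμL : μ ≤ L)
    (hsys : SystemAssumption L γ σ d κ₀ G A B) (hcost : CostAssumption μ L T f c F)
    {κ k : ℕ} (hκ : κ₀ ≤ κ) {t : ℕ} (hk : 1 ≤ k) (ht : t + k < T) {x : Stacked n}
    {ζ : ℕ → Stacked n} {u : Stacked m}
    (hu : ∀ i, ∃ (y : ℕ → Stacked n) (v : ℕ → Stacked m),
      IsOptimal (truncMatrix G κ i A) (truncMatrix G κ i B) (fun s => aggregate (f s))
        (fun s => aggregate (c s)) F t k (truncVec G κ i x)
        (fun τ => truncVec G κ i (ζ τ)) y v ∧ block u i = block (v 0) i)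
    {y p : ℕ → Stacked n} {v : ℕ → Stacked m}
    (h : SolvesWindow A B f c (gradient (aggregate (f T))) t (T - t) x ζ y v p)
    {D : ℝ} (hD : ∑ τ ∈ Finset.range k, ‖ζ τ‖ ≤ D) (hζ : ∀ τ < T - t, ‖ζ τ‖ ≤ D) :
    ‖v 0 - u‖ ≤ Fintype.card V * (truncConst L η C * δ ^ κ * (‖x‖ + D))
      + C ^ 2 * (L + 1) * δ ^ k * (δ ^ k * ‖x‖ + 2 / (1 - δ) * D) := by
  have hL : 0 ≤ L := by linarith [hd.one_lt]
  have hC := hd.one_le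
  have hδ := hd.decay_pos
  have hδ' : 0 < 1 - δ := by linarith [hd.decay_lt_one]
  have hAB := hsys.stablePair hL hγ
  have hD0 : 0 ≤ D := (Finset.sum_nonneg fun _ _ => norm_nonneg _).trans hD
  have hgf : ∀ τ < T - t, MonoLip μ L (gradient (aggregate (f (t + τ)))) := fun τ hτ =>
    (hcost.localField_state hL (by omega)).monoLip
  have hgc : ∀ τ < T - t, MonoLip μ L (gradient (aggregate (c (t + τ + 1)))) := fun τ hτ =>
    (hcost.localField_control hL (by omega) (by omega)).monoLip
  set E := C * (δ ^ k * ‖x‖ + 2 / (1 - δ) * D) with hE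
  have hE0 : 0 ≤ E := by positivity
  -- Untruncated solutions of horizon `k` with terminal gradient `θ x`, as a curve in `θ`; the
  -- values at negative `θ` are junk that makes the choice total.
  have hex : ∀ θ : ℝ, ∃ yv : (ℕ → Stacked n) × (ℕ → Stacked m) × (ℕ → Stacked n), 0 ≤ θ →
      SolvesWindow A B f c (fun x => θ • x) t k x ζ yv.1 yv.2.1 yv.2.2 := by
    intro θ
    by_cases hθ : 0 ≤ θ
    · obtain ⟨y, v, p, h⟩ := exists_solvesWindow_smul (A := A) (B := B) hμ hcost
        (t := t) (l := k) (by omega) x ζ hθ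
      exact ⟨(y, v, p), fun _ => h⟩
    · exact ⟨(fun _ => 0, fun _ => 0, fun _ => 0), fun h => absurd h hθ⟩
  choose S hS using hex
  -- Changing `θ` from `a` to `b` creates the terminal mismatch `(b - a) y_a(k)`, where `‖y_a(k)‖ ≤
  -- E`, and its effect on the first control is damped by `δ ^ k`.
  have hlip : ∀ a b, μ ≤ a → a ≤ b → b ≤ L → ‖(S b).2.1 0 - (S a).2.1 0‖ ≤
      C * δ ^ k * E * (b - a) := by
    intro a b ha hab hb
    have h1 := hS a (by linarith)
    have h2 := hS b (by linarith)
    have hg := localField_smul (X := Idx n) hμ (by linarith : μ ≤ b) hb (Sigma.fst (β := fun i => Fin (n i)))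
    have hsize := (h1.1.size_at hd hAB (fun τ hτ => hgf τ (by omega))
      (fun τ hτ => hgc τ (by omega))
      (localField_smul (X := Idx n) hμ ha (by linarith) (Sigma.fst (β := fun i => Fin (n i)))).monoLip
      h1.2.1 le_rfl hD0 hD (fun τ hτ => hζ τ (by omega))).1
    rw [h1.2.2, ← hE] at hsize
    have hsens := h2.1.terminal_sensitivity hd hAB (fun τ hτ => hgf τ (by omega))
      (fun τ hτ => hgc τ (by omega)) h1.1 (h2.2.2.trans h1.2.2.symm) hk
      (gl := b • (S b).1 k - b • (S a).1 k) (H := (b - a) * E)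
      (mul_nonneg (by linarith) hE0) (hg.monoLip.mono _ _) (hg.monoLip.lip _ _) (by
        rw [h2.2.1, h1.2.1]
        have : b • (S b).1 k - a • (S a).1 k - (b • (S b).1 k - b • (S a).1 k)
            = (b - a) • (S a).1 k := by module
        rw [this, norm_smul, Real.norm_of_nonneg (by linarith)]
        exact mul_le_mul_of_nonneg_left hsize (by linarith))
    refine hsens.trans (le_of_eq (by ring))
  -- At the terminal state reached by node `i`, `∇F` is `θ` times that state, so the same trajectory
  -- satisfies the optimality system with the blockwise field `θ x`. The value of `θ` depends on
  -- `i`.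
  have hθ : ∀ i, ∃ θ : ℝ, μ ≤ θ ∧ θ ≤ L ∧
      ‖block ((S θ).2.1 0 - u) i‖ ≤ truncConst L η C * δ ^ κ * (‖x‖ + D) := by
    intro i
    obtain ⟨y', v', hopt, hblock⟩ := hu i
    obtain ⟨p', hp'⟩ := hopt.exists_solvesWindow hcost hcost.terminal.differentiable (by omega)
    obtain ⟨θ, h1, h2, h3⟩ := hcost.terminal_K.exists_gradient_eq_smul hμL hcost.terminal (y' k)
    refine ⟨θ, h1, h2, ?_⟩
    rw [block_sub_congr hblock]
    exact (hS θ (by linarith)).block_sub_le hd hη hγ hsys hcost i hκ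
      (localField_smul hμ h1 h2 _) (by omega) hk ⟨hp'.1, hp'.2.1.trans h3, hp'.2.2⟩ hD
  choose θ hθ₁ hθ₂ hθ₃ using hθ
  set w : Stacked m := WithLp.toLp 2 fun q => (S (θ q.1)).2.1 0 q with hw
  have hwblock : ∀ i, block w i = block ((S (θ i)).2.1 0) i := fun i => rfl
  have e1 : ‖w - u‖ ≤ Fintype.card V * (truncConst L η C * δ ^ κ * (‖x‖ + D)) :=
    norm_le_card_mul_of_block_le fun i => hθ₃ i
  have e2 : ‖w - (S μ).2.1 0‖ ≤ C * δ ^ k * E * (L - μ) :=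
    norm_sampled_sub_le (v := fun s => (S s).2.1 0) hlip (by positivity) hμL hθ₁ hθ₂ hwblock
  -- The solution up to time `T` is cut at step `k`, its multiplier `p k` serving as terminal datum.
  -- The mismatch `p k - μ y k` is at most `(1 + μ) E`.
  have e3 : ‖v 0 - (S μ).2.1 0‖ ≤ C * δ ^ k * ((μ + 1) * E) := by
    have hsize := h.1.size_at hd hAB hgf hgc (hcost.localField_state hL le_rfl).monoLip h.2.1
      (by omega : k ≤ T - t) hD0 hD hζ
    rw [h.2.2, ← hE] at hsize
    have h1 := hS μ hμ.le
    have hg := localField_smul (X := Idx n) hμ le_rfl hμL (Sigma.fst (β := fun i => Fin (n i)))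
    refine (h.1.mono (by omega : k ≤ T - t)).terminal_sensitivity hd hAB
      (fun τ hτ => hgf τ (by omega)) (fun τ hτ => hgc τ (by omega)) h1.1
      (h.2.2.trans h1.2.2.symm) hk (gl := μ • y k - μ • (S μ).1 k) (by positivity)
      (hg.monoLip.mono _ _) (hg.monoLip.lip _ _) ?_
    rw [h1.2.1]
    have : p k - μ • (S μ).1 k - (μ • y k - μ • (S μ).1 k) = p k - μ • y k := by abel
    rw [this]
    refine (norm_sub_le _ _).trans ?_
    rw [norm_smul, Real.norm_of_nonneg hμ.le]
    have := mul_le_mul_of_nonneg_left hsize.1 hμ.le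
    linarith [hsize.2]
  have htri : ‖v 0 - u‖ ≤ ‖v 0 - (S μ).2.1 0‖ + ‖w - (S μ).2.1 0‖ + ‖w - u‖ := by
    have : v 0 - u = (v 0 - (S μ).2.1 0) - (w - (S μ).2.1 0) + (w - u) := by abel
    rw [this]
    exact (norm_add_le _ _).trans (add_le_add_left (norm_sub_le _ _) _)
  refine htri.trans ?_
  have : C ^ 2 * (L + 1) * δ ^ k * (δ ^ k * ‖x‖ + 2 / (1 - δ) * D) =
      C * δ ^ k * ((μ + 1) * E) + C * δ ^ k * E * (L - μ) := by rw [hE]; ring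
  rw [this]
  linarith

/-- The continuation of a solution solves the problem posed one step later. -/
theorem SolvesWindow.tail {gF : Stacked n → Stacked n} {t : ℕ} (ht : t < T) {x : Stacked n}
    {w y p : ℕ → Stacked n} {v : ℕ → Stacked m}
    (h : SolvesWindow A B f c gF t (T - t) x (fun τ => w (t + τ)) y v p) :
    SolvesWindow A B f c gF (t + 1) (T - (t + 1)) (y 1) (fun τ => w (t + 1 + τ))
      (fun τ => y (τ + 1)) (fun τ => v (τ + 1)) (fun τ => p (τ + 1)) := by
  have hshift : ∀ τ, t + 1 + τ = t + (τ + 1) := fun τ => by omega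
  have hlast : T - (t + 1) + 1 = T - t := by omega
  refine ⟨⟨fun τ hτ => ?_, fun τ hτ => ?_, fun τ hτ => ?_⟩, ?_, rfl⟩
  · simp only [hshift]; exact h.1.dyn (τ + 1) (by omega)
  · simp only [hshift]; exact h.1.adj (τ + 1) (by omega)
  · simp only [hshift]; exact h.1.stat (τ + 1) (by omega)
  · simp only [hlast]; exact h.2.1

/-- Per-step errors with respect to the optimal continuation accumulate with exponentially
decaying weights. -/
theorem norm_sub_le_sum_step_errors (hd : DecayData.{u} L γ μ η C δ) (hγ : 0 < γ)
    (hsys : SystemAssumption L γ σ d κ₀ G A B) (hcost : CostAssumption μ L T f c F)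
    {w x xstar : ℕ → Stacked n} {Y P : ℕ → ℕ → Stacked n} {W : ℕ → ℕ → Stacked m}
    (hY : ∀ t ≤ T, SolvesWindow A B f c (gradient (aggregate (f T))) t (T - t) (x t)
      (fun τ => w (t + τ)) (Y t) (W t) (P t))
    (hstar : IsOfflineOptimal A B f c w T (x 0) xstar) {ε : ℕ → ℝ}
    (hε : ∀ t < T, ‖x (t + 1) - Y t 1‖ ≤ ε t) {t : ℕ} (ht : t < T) :
    ‖x (t + 1) - xstar (t + 1)‖ ≤ ∑ s ∈ Finset.range (t + 1), C * δ ^ (t - s) * ε s := by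
  have hL : 0 ≤ L := by linarith [hd.one_lt]
  have hAB := hsys.stablePair hL hγ
  have hgT := (hcost.localField_state hL le_rfl).monoLip
  have hC := hd.one_le
  have hδ := hd.decay_pos
  have hgf : ∀ s τ, τ < T - s → MonoLip μ L (gradient (aggregate (f (s + τ)))) := fun s τ hτ =>
    (hcost.localField_state hL (by omega)).monoLip
  have hgc : ∀ s τ, τ < T - s → MonoLip μ L (gradient (aggregate (c (s + τ + 1)))) :=
    fun s τ hτ => (hcost.localField_control hL (by omega) (by omega)).monoLip
  -- Uniqueness of the optimal states is the case of equal initial states in the decay estimate.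
  have h0 : Y 0 (t + 1) = xstar (t + 1) := by
    obtain ⟨u, hu⟩ := hstar
    obtain ⟨p, hp⟩ := hu.exists_solvesWindow hcost (hcost.state T le_rfl).differentiable
      (by omega)
    have h1 := hY 0 (by omega)
    simp only [zero_add, Nat.sub_zero] at h1
    have h2 := h1.1.initial_decay hd hAB
      (fun τ hτ => hgf 0 τ (by omega)) (fun τ hτ => hgc 0 τ (by omega)) hp.1 hgT h1.2.1 hp.2.1
      (τ := t + 1) (by omega)
    rw [h1.2.2, hp.2.2, sub_self, norm_zero, mul_zero] at h2
    exact sub_eq_zero.1 (norm_le_zero_iff.1 h2)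
  have hstep : ∀ s, s < t + 1 → dist (Y s (t + 1 - s)) (Y (s + 1) (t + 1 - (s + 1))) ≤
      C * δ ^ (t - s) * ε s := by
    intro s hs
    have h1 := (hY s (by omega)).tail (by omega)
    have h2 := hY (s + 1) (by omega)
    have h3 := h1.1.initial_decay hd hAB (hgf (s + 1)) (hgc (s + 1)) h2.1 hgT h1.2.1 h2.2.1
      (τ := t - s) (by omega)
    rw [dist_eq_norm]
    have e1 : t + 1 - s = t - s + 1 := by omega
    have e2 : t + 1 - (s + 1) = t - s := by omega
    rw [e1, e2]
    refine h3.trans (mul_le_mul_of_nonneg_left ?_ (by positivity))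
    rw [h2.2.2, norm_sub_rev]
    exact hε s (by omega)
  -- The prediction for time `t + 1` made at time `s` is the offline optimum for `s = 0` and the
  -- actual state for `s = t + 1`.
  have hsum := dist_le_range_sum_of_dist_le (f := fun s => Y s (t + 1 - s)) (t + 1)
    (d := fun s => C * δ ^ (t - s) * ε s) (fun {s} hs => hstep s hs)
  have hend : Y (t + 1) (t + 1 - (t + 1)) = x (t + 1) := by
    rw [Nat.sub_self]; exact (hY (t + 1) (by omega)).2.2
  simp only [Nat.sub_zero, hend, h0] at hsum
  rwa [dist_comm, dist_eq_norm] at hsum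

end PredictiveControl

/-! ### The accumulated deviation -/

section ErrorBounds

universe u
variable {V : Type u} [Fintype V] [DecidableEq V] {n m : V → ℕ} {G : SimpleGraph V}
  {L γ μ σ η C δ : ℝ} {d κ₀ T : ℕ} {A : BlockMatrix n n} {B : BlockMatrix n m}
  {f : ℕ → (i : V) → EuclideanSpace ℝ (Fin (n i)) → ℝ}
  {c : ℕ → (i : V) → EuclideanSpace ℝ (Fin (m i)) → ℝ} {F : Stacked n → ℝ}

/-- The deviation from the offline optimum as an accumulation of truncation errors and of
prediction errors. -/
theorem norm_sub_offline_le (hd : DecayData.{u} L γ μ η C δ) (hη : 0 ≤ η) (hγ : 0 < γ)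
    (hμ : 0 < μ) (hμL : μ ≤ L) (hsys : SystemAssumption L γ σ d κ₀ G A B)
    (hcost : CostAssumption μ L T f c F) {κ k : ℕ} (hκ : κ₀ ≤ κ) (hk : 1 ≤ k) (hkT : k ≤ T)
    {w : ℕ → Stacked n} {D : ℝ} (hD : ∀ s, s + k ≤ T → ∑ τ ∈ Finset.range k, ‖w (s + τ)‖ ≤ D)
    {xbar : Stacked n} {x xstar : ℕ → Stacked n}
    (hx : IsDTPCTrajectory G A B f c F w T k κ xbar x)
    (hstar : IsOfflineOptimal A B f c w T xbar xstar) {t : ℕ} (ht : t < T) :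
    ‖x (t + 1) - xstar (t + 1)‖ ≤ ∑ s ∈ Finset.range (t + 1), C * δ ^ (t - s) *
      (L * (Fintype.card V * (truncConst L η C * δ ^ κ * (‖x s‖ + D))
        + if s + k < T then C ^ 2 * (L + 1) * δ ^ k * (δ ^ k * ‖x s‖ + 2 / (1 - δ) * D)
          else 0)) := by
  obtain ⟨rfl, u, hu⟩ := hx
  -- Each time `τ < T` lies in a window of length `k` inside the horizon; near the end, the last
  -- one, starting at `T - k`.
  have hw : ∀ τ < T, ‖w τ‖ ≤ D := by
    intro τ hτ
    refine le_trans ?_ (hD (min τ (T - k)) (by omega))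
    have h1 := Finset.single_le_sum (f := fun j => ‖w (min τ (T - k) + j)‖)
      (fun _ _ => norm_nonneg _) (Finset.mem_range.2 (by omega : τ - min τ (T - k) < k))
    have h2 : min τ (T - k) + (τ - min τ (T - k)) = τ := by omega
    simpa only [h2] using h1
  have hY : ∀ t, ∃ Y : (ℕ → Stacked n) × (ℕ → Stacked m) × (ℕ → Stacked n), t ≤ T →
      SolvesWindow A B f c (gradient (aggregate (f T))) t (T - t) (x t)
        (fun τ => w (t + τ)) Y.1 Y.2.1 Y.2.2 := by
    intro t
    by_cases h : t ≤ T
    · obtain ⟨y, v, p, h1⟩ := exists_solvesWindow (A := A) (B := B) hμ hcost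
        (hcost.state T le_rfl).differentiable (hcost.state_nonneg T le_rfl) (t := t) (l := T - t)
        (by omega) (x t) (fun τ => w (t + τ))
      exact ⟨(y, v, p), fun _ => h1⟩
    · exact ⟨(fun _ => 0, fun _ => 0, fun _ => 0), fun h' => absurd h' h⟩
  choose S hS using hY
  refine norm_sub_le_sum_step_errors hd hγ hsys hcost (Y := fun t => (S t).1)
    (W := fun t => (S t).2.1) (P := fun t => (S t).2.2) hS hstar (fun s hs => ?_) ht
  have h1 := hS s hs.le
  obtain ⟨hdyn, hctrl⟩ := hu s hs
  have hdiff : x (s + 1) - (S s).1 1 = -actL B ((S s).2.1 0 - u s) := by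
    rw [hdyn, h1.1.dyn 0 (by omega), h1.2.2, map_sub, ← actL_eq_act, ← actL_eq_act]
    simp only [add_zero]
    abel
  have hL : 0 ≤ L := by linarith [hd.one_lt]
  rw [hdiff, norm_neg]
  refine ((actL B).le_opNorm _).trans (mul_le_mul ?_ ?_ (norm_nonneg _) hL)
  · exact (norm_actL B).trans_le hsys.norm_B
  · split_ifs with hsk
    · simp only [if_pos hsk] at hctrl
      exact control_error_predictive_phase hd hη hγ hμ hμL hsys hcost hκ hk hsk hctrl h1
        (hD s (by omega)) (fun τ hτ => hw _ (by omega))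
    · simp only [if_neg hsk] at hctrl
      rw [add_zero]
      refine control_error_final_phase hd hη hγ hsys hcost hκ hs hctrl h1 ?_
      refine le_trans ?_ (hD (T - k) (by omega))
      -- The remaining horizon is the tail of the last full window, so `D` bounds its disturbances
      -- too.
      have e1 : k = (k - (T - s)) + (T - s) := by omega
      have e2 : ∑ τ ∈ Finset.range (T - s), ‖w (s + τ)‖ =
          ∑ τ ∈ Finset.range (T - s), ‖w (T - k + (k - (T - s) + τ))‖ := by
        refine Finset.sum_congr rfl fun τ _ => ?_
        congr 2; omega
      rw [e2]
      conv_rhs => rw [e1, Finset.sum_range_add]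
      rw [← e1]
      exact le_add_of_nonneg_left (Finset.sum_nonneg fun _ _ => norm_nonneg _)

end ErrorBounds

/-! ### Bookkeeping of constants and conclusion -/

theorem predictive_term_le {C L c₁ c₂ K N δ a D : ℝ} {κ k : ℕ} (hδ : 0 < δ) (hδ₁ : δ < 1)
    (hC : 1 ≤ C) (hL : 1 < L) (hc₁ : 0 ≤ c₁) (hc₂ : 0 ≤ c₂) (hN : 1 ≤ N) (ha : 0 ≤ a)
    (hD : 0 ≤ D) (hK : K = 1 + C * L * c₁ + C * L * (c₂ * (2 / (1 - δ)))) :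
    C * (L * (N * (c₁ * δ ^ κ * (a + D)) + c₂ * δ ^ k * (δ ^ k * a + 2 / (1 - δ) * D))) ≤
      4 * K ^ 2 * (K * L * N) / (δ * (1 - δ) ^ 2) *
        ((δ ^ κ + δ ^ (2 * k)) * a + (δ ^ κ + δ ^ k) * D) := by
  have h1 : 0 < 1 - δ := by linarith
  set r := 2 / (1 - δ) with hr
  have hr1 : 1 ≤ r := by rw [hr, le_div_iff₀ h1]; linarith
  have hCL : 0 ≤ C * L := by nlinarith
  have p1 : 0 ≤ C * L * c₁ := by positivity
  have p2 : 0 ≤ C * L * (c₂ * r) := by positivity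
  have hK1 : 1 ≤ K := by linarith
  have hu : 0 < δ ^ κ := pow_pos hδ κ
  have hv : 0 < δ ^ k := pow_pos hδ k
  have hv2 : δ ^ (2 * k) = δ ^ k * δ ^ k := by rw [two_mul, pow_add]
  set Z := (δ ^ κ + δ ^ (2 * k)) * a + (δ ^ κ + δ ^ k) * D with hZ
  have hZ0 : 0 ≤ Z := by positivity
  have b1 : δ ^ κ * (a + D) ≤ Z := by
    have : 0 ≤ δ ^ (2 * k) * a + δ ^ k * D := by positivity
    rw [hZ]; linarith
  have b2 : δ ^ k * (δ ^ k * a + r * D) ≤ r * Z := by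
    have e1 : 0 ≤ r * (δ ^ κ * a + δ ^ κ * D) := by positivity
    have e2 : 0 ≤ (r - 1) * (δ ^ k * δ ^ k * a) := mul_nonneg (by linarith) (by positivity)
    rw [hZ, hv2]; linarith
  have b3 : C * (L * (N * (c₁ * δ ^ κ * (a + D)) + c₂ * δ ^ k * (δ ^ k * a + r * D))) ≤
      K * N * Z := by
    have e1 := mul_le_mul_of_nonneg_left b1 (mul_nonneg p1 (by linarith : (0 : ℝ) ≤ N))
    have e2 := mul_le_mul_of_nonneg_left b2 (mul_nonneg hCL hc₂)
    have e3 : 0 ≤ (N - 1) * (C * L * (c₂ * r) * Z) :=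
      mul_nonneg (by linarith) (mul_nonneg p2 hZ0)
    have e4 : 0 ≤ N * Z := mul_nonneg (by linarith) hZ0
    rw [hK]; linarith
  refine b3.trans (mul_le_mul_of_nonneg_right ?_ hZ0)
  have hden : δ * (1 - δ) ^ 2 ≤ 1 := by
    have : (1 - δ) ^ 2 ≤ 1 := pow_le_one₀ h1.le (by linarith)
    exact mul_le_one₀ hδ₁.le (by positivity) this
  rw [le_div_iff₀ (by positivity)]
  have hKN : 0 ≤ K * N := by positivity
  have e5 : K * N * (δ * (1 - δ) ^ 2) ≤ K * N := mul_le_of_le_one_right hKN hden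
  have e6 : (1 : ℝ) ≤ 4 * K ^ 2 * L := by
    have : 1 ≤ K ^ 2 := one_le_pow₀ hK1
    nlinarith
  have e7 := mul_le_mul_of_nonneg_left e6 hKN
  linarith

/-- The horizon error alone, which carries no factor `N`. As `δ (1 - δ) ^ 2 ≤ 1` and `1 ≤ K`, the
target constant dominates `K`. -/
theorem terminal_term_le {C L c₁ c₂ K δ a D : ℝ} {k : ℕ} (hδ : 0 < δ) (hδ₁ : δ < 1)
    (hC : 1 ≤ C) (hL : 1 < L) (hc₁ : 0 ≤ c₁) (hc₂ : 0 ≤ c₂) (ha : 0 ≤ a)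
    (hD : 0 ≤ D) (hK : K = 1 + C * L * c₁ + C * L * (c₂ * (2 / (1 - δ)))) :
    C * (L * (c₂ * δ ^ k * (δ ^ k * a + 2 / (1 - δ) * D))) ≤
      4 * K ^ 3 / (δ * (1 - δ) ^ 2) * (δ ^ (2 * k) * a + δ ^ k * D) := by
  have h1 : 0 < 1 - δ := by linarith
  set r := 2 / (1 - δ) with hr
  have hr1 : 1 ≤ r := by rw [hr, le_div_iff₀ h1]; linarith
  have hCL : 0 ≤ C * L := by nlinarith
  have p1 : 0 ≤ C * L * c₁ := by positivity
  have p2 : 0 ≤ C * L * (c₂ * r) := by positivity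
  have hK1 : 1 ≤ K := by linarith
  have hv : 0 < δ ^ k := pow_pos hδ k
  have hv2 : δ ^ (2 * k) = δ ^ k * δ ^ k := by rw [two_mul, pow_add]
  set Z := δ ^ (2 * k) * a + δ ^ k * D with hZ
  have hZ0 : 0 ≤ Z := by positivity
  have b2 : δ ^ k * (δ ^ k * a + r * D) ≤ r * Z := by
    have e2 : 0 ≤ (r - 1) * (δ ^ k * δ ^ k * a) := mul_nonneg (by linarith) (by positivity)
    rw [hZ, hv2]; linarith
  have b3 : C * (L * (c₂ * δ ^ k * (δ ^ k * a + r * D))) ≤ K * Z := by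
    have e2 := mul_le_mul_of_nonneg_left b2 (mul_nonneg hCL hc₂)
    have e3 : 0 ≤ (1 + C * L * c₁) * Z := mul_nonneg (by linarith) hZ0
    rw [hK]; linarith
  refine b3.trans (mul_le_mul_of_nonneg_right ?_ hZ0)
  have hden : δ * (1 - δ) ^ 2 ≤ 1 := by
    have : (1 - δ) ^ 2 ≤ 1 := pow_le_one₀ h1.le (by linarith)
    exact mul_le_one₀ hδ₁.le (by positivity) this
  rw [le_div_iff₀ (by positivity)]
  have e5 : K * (δ * (1 - δ) ^ 2) ≤ K := mul_le_of_le_one_right (by linarith) hden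
  have e6 : K ≤ K ^ 3 := le_self_pow₀ hK1 (by norm_num)
  linarith

end DTPC

end

theorem theorem5
    (L γ μ σ : ℝ) (d : ℕ) (hL : 1 < L) (hγ₀ : 0 < γ) (hγ₁ : γ < 1) (hμ : 0 < μ) (hσ : 0 < σ) :
    ∃ δ : ℝ, 0 < δ ∧ δ < 1 ∧
    ∀ p : ℕ → ℝ, DTPC.IsSubexponential p →
    ∃ C : ℝ, 0 < C ∧
    ∀ (V : Type*) [Fintype V] [DecidableEq V] (G : SimpleGraph V) (n m : V → ℕ)
      (A : DTPC.BlockMatrix n n) (B : DTPC.BlockMatrix n m)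
      (f : ℕ → (i : V) → EuclideanSpace ℝ (Fin (n i)) → ℝ)
      (c : ℕ → (i : V) → EuclideanSpace ℝ (Fin (m i)) → ℝ)
      (F : DTPC.Stacked n → ℝ) (w : ℕ → DTPC.Stacked n)
      (T k κ₀ κ : ℕ) (D LN : ℝ) (xbar : DTPC.Stacked n) (x xstar : ℕ → DTPC.Stacked n),
      DTPC.SystemAssumption L γ σ d κ₀ G A B →
      DTPC.CostAssumption μ L T f c F →
      DTPC.HasGrowth G p →
      1 ≤ k → k ≤ T → κ₀ ≤ κ →
      (∀ s, s + k ≤ T → ∑ τ ∈ Finset.range k, ‖w (s + τ)‖ ≤ D) →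
      LN = C * L * (Fintype.card V : ℝ) →
      DTPC.IsDTPCTrajectory G A B f c F w T k κ xbar x →
      DTPC.IsOfflineOptimal A B f c w T xbar xstar →
      (∀ t : ℕ, t + 1 + k ≤ T →
        ‖x (t + 1) - xstar (t + 1)‖ ≤
          C * δ ^ k * (2 * C * δ ^ T * ‖x 0‖ + 4 * C / (1 - δ) * D) +
          ∑ m' ∈ Finset.range (t + 1), 4 * C ^ 2 * LN / (δ * (1 - δ) ^ 2) * δ ^ m' *
            ((δ ^ κ + δ ^ (2 * k)) * ‖x (t - m')‖ + (δ ^ κ + δ ^ k) * D)) ∧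
      (∀ t : ℕ, t < T → T ≤ t + k →
        ‖x (t + 1) - xstar (t + 1)‖ ≤
          ∑ m' ∈ Finset.range (t + 1), C * LN * (‖x (t - m')‖ + D) * δ ^ (κ + m') +
          ∑ m' ∈ Finset.Icc 1 (T - k), 4 * C ^ 3 / (δ * (1 - δ) ^ 2) * δ ^ (t + k - T + m') *
            (δ ^ (2 * k) * ‖x (T - k - m')‖ + δ ^ k * D)) := by
  obtain ⟨η, C, δ, hd⟩ := DTPC.exists_decayData hL hγ₀ hγ₁ hμ
  have hδ := hd.decay_pos
  have hδ₁ := hd.decay_lt_one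
  have hC := hd.one_le
  have h1δ : 0 < 1 - δ := by linarith
  have hη : 0 ≤ η := by
    have h1 : 0 ≤ η * δ := le_trans (by positivity) hd.small
    exact nonneg_of_mul_nonneg_left h1 hδ
  refine ⟨δ, hδ, hδ₁, fun p _ => ?_⟩
  obtain ⟨c₁, hc₁⟩ : ∃ c₁, c₁ = DTPC.truncConst L η C := ⟨_, rfl⟩
  obtain ⟨c₂, hc₂⟩ : ∃ c₂, c₂ = C ^ 2 * (L + 1) := ⟨_, rfl⟩
  have hc₁0 : 0 ≤ c₁ := by rw [hc₁]; unfold DTPC.truncConst; positivity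
  have hc₂0 : 0 ≤ c₂ := by rw [hc₂]; positivity
  -- The three summands secure `1 ≤ K`, the truncation constant and the horizon constant.
  obtain ⟨K, hK⟩ : ∃ K, K = 1 + C * L * c₁ + C * L * (c₂ * (2 / (1 - δ))) := ⟨_, rfl⟩
  have hK1 : 1 ≤ K := by
    have q1 : 0 ≤ C * L * c₁ := by positivity
    have q2 : 0 ≤ C * L * (c₂ * (2 / (1 - δ))) := by positivity
    linarith
  refine ⟨K, by linarith, ?_⟩
  intro V _ _ G n m A B f c F w T k κ₀ κ D LN xbar x xstar hsys hcost _ hk hkT hκ hD hLN hx hstar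
  have hD0 : 0 ≤ D := (Finset.sum_nonneg fun _ _ => norm_nonneg _).trans (hD 0 (by omega))
  have hne : Nonempty (DTPC.Idx n) := by
    rw [← Fintype.card_pos_iff]
    exact lt_of_lt_of_le hsys.one_le_index hsys.index_le
  have hμL : μ ≤ L := hcost.terminal.le
  have hN : (1 : ℝ) ≤ Fintype.card V := by
    obtain ⟨⟨i, _⟩⟩ := hne
    exact_mod_cast Fintype.card_pos_iff.2 ⟨i⟩
  set N : ℝ := (Fintype.card V : ℝ)
  have hmain : ∀ t < T, ‖x (t + 1) - xstar (t + 1)‖ ≤ ∑ s ∈ Finset.range (t + 1), C * δ ^ (t - s) *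
      (L * (N * (c₁ * δ ^ κ * (‖x s‖ + D))
        + if s + k < T then c₂ * δ ^ k * (δ ^ k * ‖x s‖ + 2 / (1 - δ) * D) else 0)) := by
    intro t ht
    rw [hc₁, hc₂]
    exact DTPC.norm_sub_offline_le hd hη hγ₀ hμ hμL hsys hcost hκ hk hkT hD hx hstar ht
  constructor
  · intro t ht
    refine (hmain t (by omega)).trans ?_
    rw [← Finset.sum_range_reflect]
    -- The sum already dominates the deviation, so the first summand of the claimed bound enters
    -- only through its sign.
    have h0 : 0 ≤ K * δ ^ k * (2 * K * δ ^ T * ‖x 0‖ + 4 * K / (1 - δ) * D) := by positivity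
    refine le_trans (Finset.sum_le_sum fun j hj => ?_) (le_add_of_nonneg_left h0)
    have hj' := Finset.mem_range.1 hj
    have e1 : t + 1 - 1 - j = t - j := by omega
    have e2 : t - (t - j) = j := by omega
    rw [e1, e2, if_pos (by omega), hLN]
    have h1 := DTPC.predictive_term_le (κ := κ) (k := k) hδ hδ₁ hC hL hc₁0 hc₂0 hN
      (norm_nonneg (x (t - j))) hD0 hK
    have h2 := mul_le_mul_of_nonneg_left h1 (pow_pos hδ j).le
    refine le_trans (le_of_eq ?_) (h2.trans (le_of_eq ?_)) <;> ring
  · intro t ht htk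
    refine (hmain t ht).trans ?_
    have hsplit : ∀ a b e : ℝ, e * (L * (a + b)) = e * (L * a) + e * (L * b) := fun a b e => by ring
    simp only [hsplit, Finset.sum_add_distrib]
    refine add_le_add ?_ ?_
    · rw [← Finset.sum_range_reflect]
      refine Finset.sum_le_sum fun j hj => ?_
      have hj' := Finset.mem_range.1 hj
      have e1 : t + 1 - 1 - j = t - j := by omega
      have e2 : t - (t - j) = j := by omega
      rw [e1, e2, hLN]
      have h1 : C * L * c₁ ≤ K * (K * L) := by
        have q2 : 0 ≤ C * L * (c₂ * (2 / (1 - δ))) := by positivity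
        have q3 : 1 * K ≤ (K * L) * K := by
          refine mul_le_mul_of_nonneg_right ?_ (by linarith)
          nlinarith
        linarith
      have h2 := mul_le_mul_of_nonneg_right h1
        (by positivity : 0 ≤ N * ((‖x (t - j)‖ + D) * (δ ^ κ * δ ^ j)))
      rw [pow_add]
      refine le_trans (le_of_eq ?_) (h2.trans (le_of_eq ?_)) <;> ring
    · rw [DTPC.sum_Icc_one_eq_sum_range, ← Finset.sum_range_reflect _ (T - k)]
      -- Horizon errors occur only at times `s < T - k`, and `T - k ≤ t` in this phase.
      have hsub : ∑ s ∈ Finset.range (t + 1), C * δ ^ (t - s) * (L *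
          if s + k < T then c₂ * δ ^ k * (δ ^ k * ‖x s‖ + 2 / (1 - δ) * D) else 0) =
          ∑ s ∈ Finset.range (T - k), C * δ ^ (t - s) * (L *
          if s + k < T then c₂ * δ ^ k * (δ ^ k * ‖x s‖ + 2 / (1 - δ) * D) else 0) := by
        refine (Finset.sum_subset ?_ fun s _ hs => ?_).symm
        · intro s hs
          rw [Finset.mem_range] at hs ⊢
          omega
        · rw [Finset.mem_range] at hs
          rw [if_neg (by omega), mul_zero, mul_zero]
      rw [hsub]
      refine Finset.sum_le_sum fun s hs => ?_
      have hs' := Finset.mem_range.1 hs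
      -- The index `m' = T - k - s` matches the claimed sum; the truncated subtractions are exact
      -- because `T ≤ t + k` and `s < T - k`.
      have e1 : t + k - T + (T - k - 1 - s + 1) = t - s := by omega
      have e2 : T - k - (T - k - 1 - s + 1) = s := by omega
      rw [e1, e2, if_pos (by omega)]
      have h1 := DTPC.terminal_term_le (k := k) hδ hδ₁ hC hL hc₁0 hc₂0
        (norm_nonneg (x s)) hD0 hK
      have h2 := mul_le_mul_of_nonneg_left h1 (pow_pos hδ (t - s)).le
      refine le_trans (le_of_eq ?_) (h2.trans (le_of_eq ?_)) <;> ring
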